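/- **Setting.** Let $d\ge 1$, $\psi(c)=(2\pi c^2)^{-1/2}e^{-c^2/2}$, $I_{t,\zeta}=\prod_{i=1}^d[t_i,t_i+\zeta)$, and for $D\subset\mathbf R^d$ let $[D]_\delta=\{t+u:t\in D,\|u\|<\delta\}$. Fix $D$, $\delta>0$, $0<\alpha\le 2$, a (measurable) function $L:(0,\infty)\to(0,\infty)$ slowly varying at $0$, and for all large $c$ let $\Delta_c=\min\{x>0:x^\alpha L(x)=(2c^2)^{-1}\}$ (the minimum is assumed to exist). For $t\in[D]_\delta$ let $r_t$ be a continuous positive function on the unit sphere $S^{d-1}$ such that $\sup_{t,v}r_t(v)<\infty$ and $\sup_{v}|r_t(v)-r_u(v)|\to0$ as $u\to t$, uniformly in $t\in[D]_\delta$. Put $\sigma_t(u)=\|u\|^\alpha r_t(u/\|u\|)$, $\sigma_t(0)=0$, and let $\{W_t(u):u\in[0,\infty)^d\}$ be a continuous Gaussian random field with $W_t(0)=0$, $E W_t(u)=-\sigma_t(u)/2$ and $\mathrm{Cov}(W_t(u),W_t(v))=[\sigma_t(u)+\sigma_t(v)-\sigma_t(u-v)]/2$. Define $$H_K(t)=\int_0^\infty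 e^y P\Big\{\sup_{0\le u_i\le K\ \forall i}W_t(u)>y\Big\}\,dy .$$ For $c>0$ let $X_c$ be random fields (possibly on different probability spaces) such that, for all large $c$, $X_c$ is defined on $[D]_\delta$ with $EX_c(t)=0$, $EX_c(t)^2=1$. (Probabilities of non-measurable supremum events are outer probabilities; all points at which $X_c$ is evaluated below are required to lie in $[D]_\delta$.) **Conditions.** Assume that the following hold, uniformly over $t\in[D]_\delta$, as $c\to\infty$. (C) $E[X_c(t)X_c(t+u)]=1-(1+o(1))\|u\|^\alpha L(\|u\|)r_t(u/\|u\|)$, uniformly over $u/\Delta_c$ in compact subsets of $(0,\infty)^d$. (A1) $P\{X_c(t)>c-y/c\}\sim\psi(c-y/c)$, uniformly over positive, bounded $y$. (A2) For all $a>0$ and integers $m\ge1$, the conditional law of $\{c[X_c(t+ak\Delta_c)-X_c(t)]:0\le k_i<m\}$ given $X_c(t)=c-y/c$ converges weakly to the law of $\{W_t(ak):0\le k_i<m\}$, uniformly over positive, bounded $y$ (for every bounded continuous test function, and for almost every $y$ with respect to the law of $X_c(t)$). (A3) For every $u\in[0,\infty)^d$ and $\gamma>0$ there is a positive function $h$ with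 $h(y)\to0$ as $y\to\infty$ such that, for each $y>0$ and all large $c$, $P\{X_c(t+u\Delta_c)>c-\gamma/c,\ X_c(t)\le c-y/c\}\le h(y)\psi(c)$. (A4) There are nonincreasing functions $N_a$ on $(0,\infty)$ and constants $\gamma_a>0$ $(a>0)$ with $\gamma_a\to0$ and, for every $s>0$, $N_a(\gamma_a)+\int_1^\infty\omega^sN_a(\gamma_a+\omega)\,d\omega=o(a^d)$ as $a\to0$, such that for every $a>0$ and all large $c$, $P\{\sup_{u\in[0,a]^d}X_c(t+u\Delta_c)>c,\ X_c(t)\le c-\gamma/c\}\le N_a(\gamma)\psi(c)$ for all $\gamma_a\le\gamma\le c$. (A5) There is a nonincreasing $f:[0,\infty)\to(0,\infty)$ with $f(x)=O(e^{-x^p})$ for some $p>0$ such that for all large $c$ and all $0<\gamma\le c$, $P\{X_c(t)>c-\gamma/c,\ X_c(t+u\Delta_c)>c-\gamma/c\}\le\psi(c-\gamma/c)f(\|u\|)$ whenever $t,\,t+u\Delta_c\in[D]_\delta$. **Conclusion.** Let $\ell_c\to\infty$ with $\ell_c\Delta_c\to0$ as $c\to\infty$. Then for every $t\in D$ the limit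 $H(t)=\lim_{K\to\infty}K^{-d}H_K(t)$ exists and is finite; $H$ is uniformly continuous on $D$ and $\inf_{t\in D}H(t)>0$; $$P\Big\{\sup_{u\in I_{t,\ell_c\Delta_c}}X_c(u)>c\Big\}\sim\ell_c^d\,\psi(c)\,H(t)\qquad\text{as }c\to\infty,$$ uniformly over $t\in D$; and for every $\delta'<\delta$ and $v_0<\infty$, $$P\Big\{\sup_{u\in I_{t,\ell_c\Delta_c}}X_c(u)>c,\ \sup_{v\in B\setminus I_{t,\ell_c\Delta_c}}X_c(v)>c\Big\}=o(\ell_c^d\,\psi(c))\qquad\text{as }c\to\infty,$$ uniformly over $t\in D$ and over subsets $B$ of $[D]_{\delta'}$ with volume at most $v_0$. -/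

import Mathlib

open MeasureTheory ProbabilityTheory Filter Topology Set Asymptotics
open scoped ENNReal NNReal BoundedContinuousFunction

namespace AsympGaussian

noncomputable section

/-- `d`-dimensional Euclidean space. -/
abbrev Space (d : ℕ) : Type := EuclideanSpace ℝ (Fin d)

/-- `ψ(c) = (2πc²)^{-1/2} exp(-c²/2)`. -/
def psi (c : ℝ) : ℝ := (√(2 * Real.pi * c ^ 2))⁻¹ * Real.exp (-c ^ 2 / 2)

/-- The half-open cube `I_{t,ζ} = ∏ᵢ [tᵢ, tᵢ + ζ)`. -/
def cube {d : ℕ} (t : Space d) (ζ : ℝ) : Set (Space d) :=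
  {u | ∀ i, t i ≤ u i ∧ u i < t i + ζ}

/-- The closed orthant `[0, ∞)^d`. -/
def orthant (d : ℕ) : Set (Space d) := {u | ∀ i, 0 ≤ u i}

/-- The closed cube `[0, a]^d`. -/
def closedBox (d : ℕ) (a : ℝ) : Set (Space d) := {u | ∀ i, 0 ≤ u i ∧ u i ≤ a}

/-- The vector `a k` for a multi-index `k` with `0 ≤ kᵢ < m`. -/
def gridPoint {d m : ℕ} (a : ℝ) (k : Fin d → Fin m) : Space d :=
  WithLp.toLp 2 (fun i => a * (k i : ℝ))

/-- `L : (0, ∞) → (0, ∞)` is measurable and slowly varying at `0`. -/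
structure SlowlyVaryingAtZero (L : ℝ → ℝ) : Prop where
  measurable : Measurable L
  pos : ∀ x, 0 < x → 0 < L x
  tendsto : ∀ s, 0 < s → Tendsto (fun x => L (s * x) / L x) (𝓝[>] 0) (𝓝 1)

/-- `Δ_c = min {x > 0 : x^α L(x) = (2c²)⁻¹}` for all large `c`. -/
def IsScale (α : ℝ) (L : ℝ → ℝ) (Δ : ℝ → ℝ) : Prop :=
  ∀ᶠ c in atTop, IsLeast {x : ℝ | 0 < x ∧ x ^ α * L x = (2 * c ^ 2)⁻¹} (Δ c)

/-- `‖u‖^α ρ(u / ‖u‖)` for a function `ρ` on the unit sphere (equal to `0` at `u = 0`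
as soon as `α > 0`). -/
def radial {d : ℕ} (α : ℝ) (ρ : Space d → ℝ) (u : Space d) : ℝ :=
  ‖u‖ ^ α * ρ (‖u‖⁻¹ • u)

/-- Conditions on the functions `r_t`, `t ∈ T`, on the unit sphere: each is continuous and
positive, `r_u → r_t` uniformly on the sphere as `u → t`, uniformly in `t ∈ T`, and they are
uniformly bounded. -/
structure IsShape {d : ℕ} (r : Space d → Space d → ℝ) (T : Set (Space d)) : Prop where
  continuousOn : ∀ t ∈ T, ContinuousOn (r t) (Metric.sphere 0 1)
  pos : ∀ t ∈ T, ∀ v ∈ Metric.sphere (0 : Space d) 1, 0 < r t v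
  unif : ∀ ε > 0, ∃ η > 0, ∀ t ∈ T, ∀ u ∈ T, ‖u - t‖ < η →
    ∀ v ∈ Metric.sphere (0 : Space d) 1, |r t v - r u v| ≤ ε
  bdd : ∃ M : ℝ, ∀ t ∈ T, ∀ v ∈ Metric.sphere (0 : Space d) 1, r t v ≤ M

/-- `W` is a Gaussian random field on `[0, ∞)^d` with continuous paths, `W(0) = 0`,
`E W(u) = -‖u‖^α ρ(u/‖u‖)/2` and `Cov(W(u), W(v))` equal to
`[‖u‖^α ρ(u/‖u‖) + ‖v‖^α ρ(v/‖v‖) - ‖u-v‖^α ρ((u-v)/‖u-v‖)]/2`. -/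
structure IsLimitField {d : ℕ} {Ω : Type*} [MeasurableSpace Ω] (α : ℝ) (ρ : Space d → ℝ)
    (W : Space d → Ω → ℝ) (Q : Measure Ω) : Prop where
  gaussian : IsGaussianProcess (fun u : orthant d => W u) Q
  continuous : ∀ᵐ ω ∂Q, ContinuousOn (fun u => W u ω) (orthant d)
  zero : ∀ᵐ ω ∂Q, W 0 ω = 0
  mean : ∀ u ∈ orthant d, ∫ ω, W u ω ∂Q = -radial α ρ u / 2
  cov : ∀ u ∈ orthant d, ∀ v ∈ orthant d,
    covariance (W u) (W v) Q = (radial α ρ u + radial α ρ v - radial α ρ (u - v)) / 2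

/-- `H_K = ∫₀^∞ e^y P(sup_{0 ≤ uᵢ ≤ K} W(u) > y) dy`, as an element of `[0, ∞]`. -/
def HK {d : ℕ} {Ω : Type*} [MeasurableSpace Ω] (W : Space d → Ω → ℝ) (Q : Measure Ω)
    (K : ℝ) : ℝ≥0∞ :=
  ∫⁻ y in Ioi (0 : ℝ),
    ENNReal.ofReal (Real.exp y) * Q {ω | ∃ u ∈ closedBox d K, y < W u ω}

/-- The real number `H = limsup_{K → ∞} K^{-d} H_K`; that it is a limit is a separate claim. -/
def Hlim {d : ℕ} {Ω : Type*} [MeasurableSpace Ω] (W : Space d → Ω → ℝ) (Q : Measure Ω) : ℝ :=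
  (limsup (fun K : ℝ => HK W Q K / ENNReal.ofReal (K ^ d)) atTop).toReal

section Fields

/-! Below `X c` is a random field on the probability space `(Ω c, P c)`. Only its values at the
points of the set `T` (the domain) matter, so that every condition is imposed at points of `T`
only. The measure of a supremum event that is not measurable is its outer measure. -/

variable {d : ℕ} {Ω : ℝ → Type*} [∀ c, MeasurableSpace (Ω c)]

/-- For all large `c`, `X_c(t)`, `t ∈ T`, are random variables with `E X_c(t) = 0` and
`E X_c(t)² = 1`. -/
def Standardized (X : (c : ℝ) → Space d → Ω c → ℝ) (P : (c : ℝ) → Measure (Ω c))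
    (T : Set (Space d)) : Prop :=
  ∀ᶠ c in atTop, ∀ t ∈ T, Measurable (X c t) ∧ MemLp (X c t) 2 (P c) ∧
    ∫ ω, X c t ω ∂(P c) = 0 ∧ ∫ ω, X c t ω ^ 2 ∂(P c) = 1

/-- `E[X_c(t) X_c(t+u)] = 1 - (1 + o(1)) ‖u‖^α L(‖u‖) r_t(u/‖u‖)`, uniformly over `t ∈ T` and
`u/Δ_c` in compact subsets of `(0, ∞)^d`. -/
def CondC (X : (c : ℝ) → Space d → Ω c → ℝ) (P : (c : ℝ) → Measure (Ω c))
    (T : Set (Space d)) (α : ℝ) (L : ℝ → ℝ) (Δ : ℝ → ℝ) (r : Space d → Space d → ℝ) : Prop :=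
  ∀ S : Set (Space d), IsCompact S → S ⊆ {w | ∀ i, 0 < w i} → ∀ ε > 0, ∀ᶠ c in atTop,
    ∀ t ∈ T, ∀ w ∈ S, t + Δ c • w ∈ T →
      |∫ ω, X c t ω * X c (t + Δ c • w) ω ∂(P c)
          - (1 - L ‖Δ c • w‖ * radial α (r t) (Δ c • w))|
        ≤ ε * (L ‖Δ c • w‖ * radial α (r t) (Δ c • w))

/-- `P{X_c(t) > c - y/c} ∼ ψ(c - y/c)`, uniformly over `t ∈ T` and positive bounded `y`. -/
def CondA1 (X : (c : ℝ) → Space d → Ω c → ℝ) (P : (c : ℝ) → Measure (Ω c))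
    (T : Set (Space d)) : Prop :=
  ∀ M > 0, ∀ ε > 0, ∀ᶠ c in atTop, ∀ t ∈ T, ∀ y ∈ Ioc (0 : ℝ) M,
    |(P c).real {ω | c - y / c < X c t ω} - psi (c - y / c)| ≤ ε * psi (c - y / c)

/-- Conditionally on `X_c(t) = c - y/c`, the vector `c [X_c(t + akΔ_c) - X_c(t)]`,
`0 ≤ kᵢ < m`, converges weakly to `W_t(ak)`, `0 ≤ kᵢ < m`, uniformly over `t ∈ T` and positive
bounded `y` (almost every `y`, as conditional laws are defined up to null sets). -/
def CondA2 {Ω' : Space d → Type*} [∀ t, MeasurableSpace (Ω' t)]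
    (X : (c : ℝ) → Space d → Ω c → ℝ) (P : (c : ℝ) → Measure (Ω c))
    (T : Set (Space d)) (Δ : ℝ → ℝ)
    (W : (t : Space d) → Space d → Ω' t → ℝ) (Q : (t : Space d) → Measure (Ω' t)) : Prop :=
  ∀ a > 0, ∀ m : ℕ, 0 < m → ∀ g : ((Fin d → Fin m) → ℝ) →ᵇ ℝ, ∀ M > 0, ∀ ε > 0,
    ∀ᶠ c in atTop, ∀ t ∈ T, (∀ k : Fin d → Fin m, t + Δ c • gridPoint a k ∈ T) →
      ∀ᵐ ω ∂(P c), X c t ω ∈ Ico (c - M / c) c →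
        |((P c)[fun ω' => g (fun k => c * (X c (t + Δ c • gridPoint a k) ω' - X c t ω')) |
            MeasurableSpace.comap (X c t) inferInstance]) ω
          - ∫ ω', g (fun k => W t (gridPoint a k) ω') ∂(Q t)| ≤ ε

/-- For every `u ≥ 0` and `γ > 0` there is a positive function `h` with `h(y) → 0` as `y → ∞`
such that, for each `y > 0` and all large `c`, uniformly over `t ∈ T`,
`P{X_c(t + uΔ_c) > c - γ/c, X_c(t) ≤ c - y/c} ≤ h(y) ψ(c)`. -/
def CondA3 (X : (c : ℝ) → Space d → Ω c → ℝ) (P : (c : ℝ) → Measure (Ω c))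
    (T : Set (Space d)) (Δ : ℝ → ℝ) : Prop :=
  ∀ u ∈ orthant d, ∀ γ > 0, ∃ h : ℝ → ℝ, (∀ y > 0, 0 < h y) ∧ Tendsto h atTop (𝓝 0) ∧
    ∀ y > 0, ∀ᶠ c in atTop, ∀ t ∈ T, t + Δ c • u ∈ T →
      (P c).real {ω | c - γ / c < X c (t + Δ c • u) ω ∧ X c t ω ≤ c - y / c} ≤ h y * psi c

/-- There are nonincreasing functions `N_a` on `(0, ∞)` and `γ_a > 0` with `γ_a → 0` and
`N_a(γ_a) + ∫₁^∞ ω^s N_a(γ_a + ω) dω = o(a^d)` as `a → 0` for every `s > 0`, such that for all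
large `c`, uniformly over `t ∈ T` and `γ_a ≤ γ ≤ c`,
`P{sup_{0 ≤ u ≤ a} X_c(t + uΔ_c) > c, X_c(t) ≤ c - γ/c} ≤ N_a(γ) ψ(c)`. -/
def CondA4 (X : (c : ℝ) → Space d → Ω c → ℝ) (P : (c : ℝ) → Measure (Ω c))
    (T : Set (Space d)) (Δ : ℝ → ℝ) : Prop :=
  ∃ (N : ℝ → ℝ → ℝ) (g : ℝ → ℝ),
    (∀ a > 0, AntitoneOn (N a) (Ioi 0)) ∧ (∀ a > 0, 0 < g a) ∧
    Tendsto g (𝓝[>] 0) (𝓝 0) ∧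
    (∀ s : ℝ, 0 < s →
      (∀ᶠ a in 𝓝[>] (0 : ℝ), IntegrableOn (fun x : ℝ => x ^ s * N a (g a + x)) (Ioi 1)) ∧
      (fun a : ℝ => N a (g a) + ∫ x in Ioi (1 : ℝ), x ^ s * N a (g a + x))
        =o[𝓝[>] 0] (fun a : ℝ => a ^ d)) ∧
    ∀ a > 0, ∀ᶠ c in atTop, ∀ t ∈ T, ∀ γ ∈ Icc (g a) c,
      (P c).real {ω | (∃ u ∈ closedBox d a, t + Δ c • u ∈ T ∧ c < X c (t + Δ c • u) ω) ∧
        X c t ω ≤ c - γ / c} ≤ N a γ * psi c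

/-- There is a nonincreasing `f : [0, ∞) → (0, ∞)` with `f(x) = O(exp(-x^p))` for some `p > 0`
such that for all large `c` and all `0 < γ ≤ c`, uniformly over `t, t + uΔ_c ∈ T`,
`P{X_c(t) > c - γ/c, X_c(t + uΔ_c) > c - γ/c} ≤ ψ(c - γ/c) f(‖u‖)`. -/
def CondA5 (X : (c : ℝ) → Space d → Ω c → ℝ) (P : (c : ℝ) → Measure (Ω c))
    (T : Set (Space d)) (Δ : ℝ → ℝ) : Prop :=
  ∃ f : ℝ → ℝ, AntitoneOn f (Ici 0) ∧ (∀ x, 0 ≤ x → 0 < f x) ∧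
    (∃ p > 0, f =O[atTop] (fun x : ℝ => Real.exp (-x ^ p))) ∧
    ∀ᶠ c in atTop, ∀ γ ∈ Ioc (0 : ℝ) c, ∀ t ∈ T, ∀ u : Space d, t + Δ c • u ∈ T →
      (P c).real {ω | c - γ / c < X c t ω ∧ c - γ / c < X c (t + Δ c • u) ω}
        ≤ psi (c - γ / c) * f ‖u‖

end Fields

end

end AsympGaussian

namespace AsympGaussian

/-! ### The Gaussian tail `psi` at the level `c - y / c`. -/

section Psi

/-! This is the double-sum method of Pickands. Start from one point t and condition on X_c(t) = c -
y/c. By (A1) the variable y has mass about e^y ψ(c) dy, and by (A2) the rescaled increments over a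
grid of mesh aΔ_c look like W_t. Hence the maximum over a finite grid exceeds c with probability
between (Φ - ε)ψ(c) and (1 + Φ + ε)ψ(c), where Φ is the integral over y > 0 of e^y P(max W_t > y),
the maximum being over the grid. The integral is handled as a Riemann sum over bins of y, indicators
are smoothed so that weak convergence applies, and (A3) disposes of starting points far below the
level (`eventually_grid_le`, `eventually_le_grid`). The gap of 1 is never resolved: it disappears
after division by K^d.

Condition (A4) fills the gaps of the grid, so the same bounds hold for a whole cube of side KΔ_c.
Comparing at a single large c the lower bound of an arbitrarily fine dyadic grid with the upper
bound of one fixed grid shows that H_K is finite, and that a grid computes it up to an absolute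
constant (`exists_cube_asymptotics`).

A cube of side ℓ_cΔ_c is then cut into blocks of side KΔ_c. The union bound gives the upper
estimate; Bonferroni gives the lower one, the correction being the event of exceedances both inside
and outside a block. This is controlled by `eventually_pair_le`: cells near the boundary of the
block are few, and two cells at lattice distance k both contain an exceedance with probability at
most a constant times (|k|^{-n} + c^{-q})ψ(c), by (A4) and (A5) (`exists_cell_bounds`). The first
term is summable; the second is summed over polynomially many cells, because the conditions force
the domain to be bounded (`exists_norm_le_of_cond`) and slow variation makes 1/Δ_c at most a power
of c. The same estimate with K = ℓ_c is the last assertion of the theorem.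

Altogether the exceedance probability of the large cube, divided by ℓ_c^d ψ(c), is eventually within
ε of K^{-d}H_K(t), for every large K and uniformly in t (`exists_abs_measureReal_cube_sub_le`). The
probability does not involve K, so K^{-d}H_K(t) is uniformly Cauchy; its limit is H and carries the
asymptotics. Since H_K(t) moves by a bounded amount when t moves slightly (Gaussian vectors with
close parameters), division by K^d makes H uniformly continuous. Positivity comes from a sparse
grid: each point exceeds c with probability at least κψ(c), and at wide spacing the pair terms cost
at most half of the sum (`exists_le_measureReal_cube`). -/

lemma psi_pos {c : ℝ} (hc : 0 < c) : 0 < psi c := by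
  unfold psi; positivity

lemma psi_eq_of_pos {c : ℝ} (hc : 0 < c) :
    psi c = (√(2 * Real.pi))⁻¹ * (c⁻¹ * Real.exp (-c ^ 2 / 2)) := by
  unfold psi
  rw [Real.sqrt_mul (by positivity), Real.sqrt_sq hc.le, mul_inv, mul_assoc]

/-- Expanding the square in the exponent gives an exact factorisation, from which both the limit
ratio e^y and the crude bound with constant 2 are read off. -/
lemma psi_sub_div {c y : ℝ} (hc : 0 < c) (hy : y < c ^ 2) :
    psi (c - y / c) = psi c * ((1 - y / c ^ 2)⁻¹ * Real.exp (y - y ^ 2 / (2 * c ^ 2))) := by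
  have h1 : c - y / c = c * (1 - y / c ^ 2) := by field_simp
  have h2 : 0 < 1 - y / c ^ 2 := by
    rw [sub_pos, div_lt_one (by positivity)]; exact hy
  have h3 : 0 < c - y / c := by rw [h1]; positivity
  rw [psi_eq_of_pos h3, psi_eq_of_pos hc]
  have h4 : Real.exp (-(c - y / c) ^ 2 / 2)
      = Real.exp (-c ^ 2 / 2) * Real.exp (y - y ^ 2 / (2 * c ^ 2)) := by
    rw [← Real.exp_add]; congr 1; field_simp; ring
  rw [h4, h1, mul_inv]; ring

/-- For c ≥ 2 and y ≤ c the ratio y/c² is at most 1/2. The whole range γ ≤ c of (A5) is thus covered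
by a multiple of e^γ ψ(c). -/
lemma psi_sub_div_le {c y : ℝ} (hc : 2 ≤ c) (hyc : y ≤ c) :
    psi (c - y / c) ≤ 2 * Real.exp y * psi c := by
  have hc0 : 0 < c := by linarith
  have h1 : y / c ^ 2 ≤ 1 / 2 := by
    rw [div_le_div_iff₀ (by positivity) (by norm_num)]; nlinarith
  rw [psi_sub_div hc0 (by nlinarith)]
  have h2 : (1 - y / c ^ 2)⁻¹ ≤ 2 := by
    rw [inv_le_comm₀ (by linarith) (by norm_num)]; linarith
  have h3 : Real.exp (y - y ^ 2 / (2 * c ^ 2)) ≤ Real.exp y := by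
    apply Real.exp_le_exp.2
    have : 0 ≤ y ^ 2 / (2 * c ^ 2) := by positivity
    linarith
  have := psi_pos hc0
  rw [mul_comm]
  gcongr

/-- `ψ(c - y/c) / ψ(c) → e^y`, uniformly over bounded `y`. -/
lemma eventually_abs_psi_sub_le (M : ℝ) {ε : ℝ} (hε : 0 < ε) :
    ∀ᶠ c : ℝ in atTop, ∀ y ∈ Icc (0 : ℝ) M,
      |psi (c - y / c) - Real.exp y * psi c| ≤ ε * psi c := by
  have h1 : Tendsto (fun c : ℝ => M / c ^ 2) atTop (𝓝 0) :=
    tendsto_const_nhds.div_atTop (tendsto_pow_atTop two_ne_zero)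
  have h2 : Tendsto (fun c : ℝ => M ^ 2 / (2 * c ^ 2)) atTop (𝓝 0) :=
    tendsto_const_nhds.div_atTop
      ((tendsto_pow_atTop two_ne_zero).const_mul_atTop (by norm_num))
  have h3 : Tendsto (fun c : ℝ => Real.exp M * ((1 - M / c ^ 2)⁻¹ - 1)) atTop (𝓝 0) := by
    have := ((tendsto_const_nhds (x := (1 : ℝ))).sub h1).inv₀ (by norm_num)
    simpa using (this.sub_const 1).const_mul (Real.exp M)
  have h4 : Tendsto (fun c : ℝ => Real.exp M * (1 - Real.exp (-(M ^ 2 / (2 * c ^ 2)))))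
      atTop (𝓝 0) := by
    have := (Real.continuous_exp.tendsto _).comp h2.neg
    simp only [neg_zero, Real.exp_zero] at this
    simpa using (this.const_sub 1).const_mul (Real.exp M)
  filter_upwards [h1.eventually (gt_mem_nhds (show (0 : ℝ) < 1 by norm_num)),
    h3.eventually (gt_mem_nhds hε), h4.eventually (gt_mem_nhds hε), eventually_gt_atTop 0]
    with c c1 c3 c4 hc y hy
  have hy1 : y / c ^ 2 ≤ M / c ^ 2 := by gcongr; exact hy.2
  have hy0 : 0 ≤ y / c ^ 2 := div_nonneg hy.1 (by positivity)
  have hyc : y < c ^ 2 := by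
    have : y / c ^ 2 < 1 := by linarith
    rwa [div_lt_one (by positivity)] at this
  rw [psi_sub_div hc hyc]
  have hψ := psi_pos hc
  rw [show psi c * ((1 - y / c ^ 2)⁻¹ * Real.exp (y - y ^ 2 / (2 * c ^ 2))) - Real.exp y * psi c
    = ((1 - y / c ^ 2)⁻¹ * Real.exp (y - y ^ 2 / (2 * c ^ 2)) - Real.exp y) * psi c by ring,
    abs_mul, abs_of_pos hψ]
  gcongr
  have e1 : Real.exp y ≤ Real.exp M := Real.exp_le_exp.2 hy.2
  have e2 : Real.exp (y - y ^ 2 / (2 * c ^ 2)) ≤ Real.exp y := by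
    apply Real.exp_le_exp.2
    have : 0 ≤ y ^ 2 / (2 * c ^ 2) := by positivity
    linarith
  have i1 : 1 ≤ (1 - y / c ^ 2)⁻¹ := by
    rw [one_le_inv₀ (by linarith)]; linarith
  have i2 : (1 - y / c ^ 2)⁻¹ ≤ (1 - M / c ^ 2)⁻¹ := by
    apply inv_anti₀ (by linarith); linarith
  have e3 : Real.exp y * Real.exp (-(M ^ 2 / (2 * c ^ 2)))
      ≤ Real.exp (y - y ^ 2 / (2 * c ^ 2)) := by
    rw [← Real.exp_add]
    apply Real.exp_le_exp.2
    have : y ^ 2 / (2 * c ^ 2) ≤ M ^ 2 / (2 * c ^ 2) := by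
      gcongr
      · exact hy.1
      · exact hy.2
    linarith
  have e4 : Real.exp (-(M ^ 2 / (2 * c ^ 2))) ≤ 1 := by
    rw [Real.exp_le_one_iff]
    have : 0 ≤ M ^ 2 / (2 * c ^ 2) := by positivity
    linarith
  have p1 := Real.exp_pos y
  have p2 := Real.exp_pos (y - y ^ 2 / (2 * c ^ 2))
  rw [abs_le]
  constructor
  · nlinarith
  · nlinarith

end Psi

/-! ### Bonferroni inequalities. -/

section Bonferroni

/-- A Bonferroni inequality. -/
lemma sum_measureReal_le {Ω ι : Type*} [MeasurableSpace Ω] (P : Measure Ω)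
    [IsProbabilityMeasure P] (s : Finset ι) (A : ι → Set Ω)
    (hA : ∀ i ∈ s, MeasurableSet (A i)) :
    ∑ i ∈ s, P.real (A i) ≤ P.real (⋃ i ∈ s, A i)
      + ∑ i ∈ s, P.real (A i ∩ {ω | ∃ j ∈ s, j ≠ i ∧ ω ∈ A j}) := by
  classical
  have hB : ∀ i ∈ s, MeasurableSet (A i ∩ {ω | ∃ j ∈ s, j ≠ i ∧ ω ∈ A j}) := by
    intro i hi
    refine (hA i hi).inter ?_
    have : {ω | ∃ j ∈ s, j ≠ i ∧ ω ∈ A j} = ⋃ j ∈ s.filter (· ≠ i), A j := by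
      ext ω; simp [and_assoc]
    rw [this]
    exact Finset.measurableSet_biUnion _ fun j hj => hA j (Finset.mem_filter.1 hj).1
  have hU : MeasurableSet (⋃ i ∈ s, A i) := Finset.measurableSet_biUnion _ hA
  have e1 : ∀ i ∈ s, P.real (A i) = ∫ ω, (A i).indicator (fun _ => (1 : ℝ)) ω ∂P := by
    intro i hi; rw [integral_indicator (hA i hi)]; simp
  have e2 : ∀ i ∈ s, P.real (A i ∩ {ω | ∃ j ∈ s, j ≠ i ∧ ω ∈ A j})
      = ∫ ω, (A i ∩ {ω | ∃ j ∈ s, j ≠ i ∧ ω ∈ A j}).indicator (fun _ => (1 : ℝ)) ω ∂P := by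
    intro i hi; rw [integral_indicator (hB i hi)]; simp
  have e3 : P.real (⋃ i ∈ s, A i)
      = ∫ ω, (⋃ i ∈ s, A i).indicator (fun _ => (1 : ℝ)) ω ∂P := by
    rw [integral_indicator hU]; simp
  have i1 : ∀ B : Set Ω, MeasurableSet B → Integrable (B.indicator fun _ => (1 : ℝ)) P :=
    fun B hB => (integrable_const 1).indicator hB
  rw [Finset.sum_congr rfl e1, Finset.sum_congr rfl e2, e3,
    ← integral_finsetSum _ (fun i hi => i1 _ (hA i hi)),
    ← integral_finsetSum _ (fun i hi => i1 _ (hB i hi)), ← integral_add (i1 _ hU)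
      (integrable_finsetSum _ fun i hi => i1 _ (hB i hi))]
  refine integral_mono (integrable_finsetSum _ fun i hi => i1 _ (hA i hi))
    ((i1 _ hU).add (integrable_finsetSum _ fun i hi => i1 _ (hB i hi))) fun ω => ?_
  simp only
  by_cases h : ∃ i ∈ s, ω ∈ A i
  · obtain ⟨i₀, hi₀, hω⟩ := h
    have hu : (⋃ i ∈ s, A i).indicator (fun _ => (1 : ℝ)) ω = 1 :=
      indicator_of_mem (by simp only [mem_iUnion]; exact ⟨i₀, hi₀, hω⟩) _
    rw [hu]
    -- The index `i₀` is paid for by the union; every other index whose event occurs is paid for by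
    -- the second sum, with `i₀` as its witness.
    rw [← Finset.add_sum_erase _ _ hi₀, indicator_of_mem hω]
    gcongr
    rw [← Finset.add_sum_erase (a := i₀) s
      (fun i => (A i ∩ {ω | ∃ j ∈ s, j ≠ i ∧ ω ∈ A j}).indicator (fun _ => (1 : ℝ)) ω) hi₀]
    refine le_add_of_nonneg_of_le (indicator_nonneg (by simp) _) ?_
    refine Finset.sum_le_sum fun i hi => ?_
    by_cases hi' : ω ∈ A i
    · rw [indicator_of_mem hi', indicator_of_mem]
      exact ⟨hi', i₀, hi₀, (Finset.mem_erase.1 hi).1.symm, hω⟩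
    · rw [indicator_of_notMem hi']
      exact indicator_nonneg (by simp) _
  · push Not at h
    rw [Finset.sum_eq_zero fun i hi => indicator_of_notMem (h i hi) _]
    exact add_nonneg (indicator_nonneg (by simp) _)
      (Finset.sum_nonneg fun i _ => indicator_nonneg (by simp) _)

/-- The Bonferroni inequality with pairwise intersections. -/
lemma sum_measureReal_le_pairs {Ω ι : Type*} [MeasurableSpace Ω] [DecidableEq ι] (P : Measure Ω)
    [IsProbabilityMeasure P] (s : Finset ι) (A : ι → Set Ω)
    (hA : ∀ i ∈ s, MeasurableSet (A i)) :
    ∑ i ∈ s, P.real (A i) ≤ P.real (⋃ i ∈ s, A i)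
      + ∑ i ∈ s, ∑ j ∈ s.erase i, P.real (A i ∩ A j) := by
  refine (sum_measureReal_le P s A hA).trans ?_
  gcongr with i hi
  refine le_trans (measureReal_mono ?_ (measure_ne_top _ _)) (measureReal_biUnion_finset_le _ _)
  rintro ω ⟨h1, j, hj, hji, h2⟩
  simp only [mem_iUnion]
  exact ⟨j, Finset.mem_erase.2 ⟨hji, hj⟩, h1, h2⟩

end Bonferroni

/-! ### Lattice points, cells and lattice sums. -/

section Lattice

lemma abs_apply_le_norm {d : ℕ} (x : Space d) (i : Fin d) : |x i| ≤ ‖x‖ := by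
  simpa using PiLp.norm_apply_le x i

lemma norm_le_mul_of_abs_le {d : ℕ} {x : Space d} {R : ℝ} (h : ∀ i, |x i| ≤ R) :
    ‖x‖ ≤ d * R := by
  have h1 : x = ∑ i, x i • EuclideanSpace.single i (1 : ℝ) := by
    ext j; simp [Pi.single_apply]
  rw [h1]
  refine (norm_sum_le _ _).trans ?_
  calc ∑ i, ‖x i • EuclideanSpace.single i (1 : ℝ)‖ ≤ ∑ _i : Fin d, R := by
        refine Finset.sum_le_sum fun i _ => ?_
        rw [norm_smul]; simpa using h i
    _ = d * R := by simp

/-- The point `a k` of the lattice `a ℤ^d`. -/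
noncomputable def latticePoint {d : ℕ} (a : ℝ) (k : Fin d → ℤ) : Space d :=
  WithLp.toLp 2 (fun i => a * (k i : ℝ))

@[simp]
lemma latticePoint_apply {d : ℕ} (a : ℝ) (k : Fin d → ℤ) (i : Fin d) :
    latticePoint a k i = a * (k i : ℝ) := rfl

@[simp]
lemma gridPoint_apply {d m : ℕ} (a : ℝ) (k : Fin d → Fin m) (i : Fin d) :
    gridPoint a k i = a * (k i : ℝ) := rfl

lemma gridPoint_eq_latticePoint {d m : ℕ} (a : ℝ) (k : Fin d → Fin m) :
    gridPoint a k = latticePoint a (fun i => ((k i : ℕ) : ℤ)) := by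
  ext i; simp

lemma latticePoint_sub {d : ℕ} (a : ℝ) (k k' : Fin d → ℤ) :
    latticePoint a (k - k') = latticePoint a k - latticePoint a k' := by
  ext i; simp [mul_sub]

lemma mul_norm_le_norm_latticePoint {d : ℕ} {a : ℝ} (ha : 0 ≤ a) (k : Fin d → ℤ) :
    a * ‖k‖ ≤ ‖latticePoint a k‖ := by
  rcases ha.eq_or_lt with rfl | ha
  · simp
  rw [← le_div_iff₀' ha, pi_norm_le_iff_of_nonneg (by positivity)]
  intro i
  rw [le_div_iff₀' ha]
  have := abs_apply_le_norm (latticePoint a k) i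
  rwa [latticePoint_apply, abs_mul, abs_of_pos ha, ← Int.norm_eq_abs] at this

lemma norm_gridPoint_le {d m : ℕ} {a : ℝ} (ha : 0 ≤ a) (k : Fin d → Fin m) :
    ‖gridPoint a k‖ ≤ d * (a * m) := by
  refine norm_le_mul_of_abs_le fun i => ?_
  rw [gridPoint_apply, abs_of_nonneg (by positivity)]
  have : ((k i : ℕ) : ℝ) ≤ m := by exact_mod_cast (k i).2.le
  gcongr

lemma gridPoint_mem_orthant {d m : ℕ} {a : ℝ} (ha : 0 ≤ a) (k : Fin d → Fin m) :
    gridPoint a k ∈ orthant d := fun i => by rw [gridPoint_apply]; positivity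

/-- Each point lies in one of the half-open cells `t + Δ (a k + [0, a)^d)`. -/
lemma exists_cell {d : ℕ} {a D : ℝ} (ha : 0 < a) (hD : 0 < D) (t v : Space d) :
    ∃ w : Space d, (∀ i, 0 ≤ w i ∧ w i < a) ∧
      v = t + D • latticePoint a (fun i => ⌊(v i - t i) / (D * a)⌋) + D • w := by
  refine ⟨WithLp.toLp 2 fun i => a * Int.fract ((v i - t i) / (D * a)), fun i => ?_, ?_⟩
  · have h1 := Int.fract_nonneg ((v i - t i) / (D * a))
    have h2 := Int.fract_lt_one ((v i - t i) / (D * a))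
    simp only
    constructor
    · positivity
    · nlinarith
  · ext i
    have := Int.floor_add_fract ((v i - t i) / (D * a))
    simp only [PiLp.add_apply, PiLp.smul_apply, latticePoint_apply, smul_eq_mul]
    rw [add_assoc, ← mul_add, ← mul_add, this]
    field_simp
    ring

lemma sum_inv_one_add_sq_le (N : ℕ) :
    ∑ i ∈ Finset.Icc (-(N : ℤ)) N, ((1 + |(i : ℝ)|) ^ 2)⁻¹ ≤ 4 := by
  -- The sharper bound is what the induction carries: the two new terms are absorbed by a
  -- telescoping difference of 2/(N+1).
  suffices h : ∑ i ∈ Finset.Icc (-(N : ℤ)) N, ((1 + |(i : ℝ)|) ^ 2)⁻¹ ≤ 4 - 2 / ((N : ℝ) + 1) by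
    have : (0 : ℝ) ≤ 2 / ((N : ℝ) + 1) := by positivity
    linarith
  induction N with
  | zero => norm_num
  | succ n ih =>
    have h1 : Finset.Icc (-((n + 1 : ℕ) : ℤ)) ((n + 1 : ℕ) : ℤ)
        = insert (-((n : ℤ) + 1)) (insert ((n : ℤ) + 1) (Finset.Icc (-(n : ℤ)) n)) := by
      ext x; simp only [Finset.mem_Icc, Finset.mem_insert]; push_cast; omega
    rw [h1, Finset.sum_insert (by simp only [Finset.mem_Icc, Finset.mem_insert]; omega),
      Finset.sum_insert (by simp only [Finset.mem_Icc]; omega)]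
    have h2 : |((-((n : ℤ) + 1) : ℤ) : ℝ)| = n + 1 := by
      push_cast; rw [abs_neg, abs_of_nonneg (by positivity)]
    have h3 : |(((n : ℤ) + 1 : ℤ) : ℝ)| = n + 1 := by
      push_cast; rw [abs_of_nonneg (by positivity)]
    rw [h2, h3]
    have h4 : ((1 + ((n : ℝ) + 1)) ^ 2)⁻¹ ≤ 1 / ((n : ℝ) + 1) - 1 / (n + 2) := by
      rw [div_sub_div _ _ (by positivity) (by positivity), inv_eq_one_div,
        div_le_div_iff₀ (by positivity) (by positivity)]
      nlinarith
    push_cast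
    have h5 : (2 : ℝ) / (n + 1 + 1) = 2 * (1 / (n + 2)) := by ring
    have h6 : (2 : ℝ) / (n + 1) = 2 * (1 / (n + 1)) := by ring
    rw [h5]; rw [h6] at ih
    linarith

/-- The sum of `(1 + ‖k‖)^{-(2d+1)}` over lattice points with `‖k‖ ≥ J` is `O(1/J)`. -/
lemma sum_inv_one_add_norm_pow_le {d : ℕ} (F : Finset (Fin d → ℤ)) {J : ℝ} (hJ : 0 ≤ J)
    (hF : ∀ k ∈ F, J ≤ ‖k‖) :
    ∑ k ∈ F, ((1 + ‖k‖) ^ (2 * d + 1))⁻¹ ≤ 4 ^ d * (1 + J)⁻¹ := by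
  obtain ⟨N, hN⟩ : ∃ N : ℕ, ∀ k ∈ F, ‖k‖ ≤ N := by
    obtain ⟨N, hN⟩ := exists_nat_ge (∑ k ∈ F, ‖k‖)
    exact ⟨N, fun k hk => (Finset.single_le_sum (f := fun k => ‖k‖)
      (fun _ _ => norm_nonneg _) hk).trans hN⟩
  have hsub : F ⊆ Fintype.piFinset fun _ : Fin d => Finset.Icc (-(N : ℤ)) N := by
    intro k hk
    rw [Fintype.mem_piFinset]
    intro i
    have h1 := (norm_le_pi_norm k i).trans (hN k hk)
    rw [Int.norm_eq_abs] at h1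
    rw [Finset.mem_Icc, ← abs_le]
    exact_mod_cast h1
  -- Of the 2d + 1 powers, 2d dominate the product of the coordinatewise squares (the norm is the
  -- sup norm), and the remaining one gives the decay in `J`.
  have hterm : ∀ k ∈ F, ((1 + ‖k‖) ^ (2 * d + 1))⁻¹
      ≤ (∏ i, ((1 + |(k i : ℝ)|) ^ 2)⁻¹) * (1 + J)⁻¹ := by
    intro k hk
    rw [pow_succ, mul_inv, pow_mul]
    have h1 : (((1 + ‖k‖) ^ 2) ^ d)⁻¹ ≤ ∏ i, ((1 + |(k i : ℝ)|) ^ 2)⁻¹ := by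
      rw [Finset.prod_inv_distrib]
      apply inv_anti₀ (Finset.prod_pos fun i _ => by positivity)
      calc ∏ i, (1 + |(k i : ℝ)|) ^ 2 ≤ ∏ _i : Fin d, (1 + ‖k‖) ^ 2 := by
            refine Finset.prod_le_prod (fun i _ => by positivity) fun i _ => ?_
            have := norm_le_pi_norm k i
            rw [Int.norm_eq_abs] at this
            gcongr
        _ = _ := by simp
    have h2 : (1 + ‖k‖)⁻¹ ≤ (1 + J)⁻¹ := inv_anti₀ (by positivity) (by linarith [hF k hk])
    gcongr
  refine (Finset.sum_le_sum hterm).trans ?_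
  rw [← Finset.sum_mul]
  gcongr
  calc ∑ k ∈ F, ∏ i, ((1 + |(k i : ℝ)|) ^ 2)⁻¹
      ≤ ∑ k ∈ Fintype.piFinset fun _ : Fin d => Finset.Icc (-(N : ℤ)) N,
          ∏ i, ((1 + |(k i : ℝ)|) ^ 2)⁻¹ :=
        Finset.sum_le_sum_of_subset_of_nonneg hsub fun k _ _ =>
          Finset.prod_nonneg fun i _ => by positivity
    _ = ∏ _i : Fin d, ∑ j ∈ Finset.Icc (-(N : ℤ)) N, ((1 + |(j : ℝ)|) ^ 2)⁻¹ :=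
        (Finset.prod_univ_sum (fun _ => Finset.Icc (-(N : ℤ)) N)
          (fun _ j => ((1 + |(j : ℝ)|) ^ 2)⁻¹)).symm
    _ ≤ ∏ _i : Fin d, (4 : ℝ) :=
        Finset.prod_le_prod (fun i _ => Finset.sum_nonneg fun j _ => by positivity)
          fun i _ => sum_inv_one_add_sq_le N
    _ = 4 ^ d := by simp

end Lattice

/-! ### Slowly varying functions and the size of the scale. -/

section SlowVariation

/-- An additive form of the uniform convergence theorem for slowly varying functions. -/
lemma exists_abs_sub_le_of_tendsto_sub {h : ℝ → ℝ} (hm : Measurable h)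
    (ht : ∀ s, 0 < s → Tendsto (fun y => h (y + s) - h y) atTop (𝓝 0)) :
    ∃ Y, ∀ y ≥ Y, ∀ u ∈ Icc (0 : ℝ) 1, |h (y + u) - h y| ≤ 2 := by
  let E : ℝ → Set ℝ := fun y => {s ∈ Icc (0 : ℝ) 2 | |h (y + s) - h y| < 1}
  have hE : ∀ y, MeasurableSet (E y) := fun y =>
    measurableSet_Icc.inter
      (measurableSet_lt (f := fun s => |h (y + s) - h y|) (by fun_prop) measurable_const)
  have hlim : Tendsto (fun y => ∫ s in Icc (0 : ℝ) 2, (E y).indicator (fun _ => (1 : ℝ)) s)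
      atTop (𝓝 (∫ _s in Icc (0 : ℝ) 2, (1 : ℝ))) := by
    -- Dominated convergence turns the pointwise hypothesis into |E y| → 2. Only s > 0 is covered by
    -- it, so the null set {0} is discarded.
    refine tendsto_integral_filter_of_dominated_convergence (fun _ => 1) ?_ ?_ ?_ ?_
    · exact Eventually.of_forall fun y =>
        (measurable_const.indicator (hE y)).aestronglyMeasurable
    · refine Eventually.of_forall fun y => Eventually.of_forall fun s => ?_
      rw [Real.norm_eq_abs, abs_of_nonneg (indicator_nonneg (by simp) _)]
      exact indicator_le_self' (by simp) s
    · exact integrable_const _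
    · rw [ae_restrict_iff' measurableSet_Icc]
      have h0 : ∀ᵐ s : ℝ, s ≠ 0 := by simp [ae_iff]
      filter_upwards [h0] with s hs0 hs
      have := (ht s (lt_of_le_of_ne hs.1 hs0.symm)).eventually
        (Metric.ball_mem_nhds 0 one_pos)
      refine tendsto_const_nhds.congr' ?_
      filter_upwards [this] with y hy
      rw [indicator_of_mem]
      refine ⟨hs, ?_⟩
      simpa using hy
  have hval : ∫ _s in Icc (0 : ℝ) 2, (1 : ℝ) = 2 := by simp
  rw [hval] at hlim
  have hmeas : ∀ y, ∫ s in Icc (0 : ℝ) 2, (E y).indicator (fun _ => (1 : ℝ)) s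
      = volume.real (E y) := by
    intro y
    rw [integral_indicator (hE y), Measure.restrict_restrict (hE y),
      inter_eq_self_of_subset_left (sep_subset _ _)]
    simp [E]
  simp_rw [hmeas] at hlim
  obtain ⟨Y, hY⟩ :=
    (hlim.eventually (lt_mem_nhds (show (1.5 : ℝ) < 2 by norm_num))).exists_forall_of_atTop
  refine ⟨Y, fun y hy u hu => ?_⟩
  have h1 := hY y hy
  have h2 := hY (y + u) (by linarith [hu.1])
  -- the sets `E y` and `u + E (y + u)` are too large to be disjoint in `[0, 3]`
  have h3 : ((fun s => s - u) ⁻¹' E (y + u) ∩ E y).Nonempty := by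
    by_contra hne
    rw [not_nonempty_iff_eq_empty, ← disjoint_iff_inter_eq_empty] at hne
    have hm' : volume.real ((fun s => s - u) ⁻¹' E (y + u)) = volume.real (E (y + u)) := by
      have := measure_preimage_add_right volume (-u) (E (y + u))
      simp only [measureReal_def, sub_eq_add_neg, this]
    have hfin : ∀ z, volume (E z) ≠ ⊤ := fun z =>
      ((measure_mono (sep_subset _ _)).trans_lt (by simp : volume (Icc (0 : ℝ) 2) < ⊤)).ne
    have hfin' : volume ((fun s => s - u) ⁻¹' E (y + u)) ≠ ⊤ := by
      have := measure_preimage_add_right volume (-u) (E (y + u))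
      simp only [sub_eq_add_neg, this]; exact hfin _
    have hun := measureReal_union hne (hE y) hfin' (hfin y) (μ := volume)
    have hle : volume.real ((fun s => s - u) ⁻¹' E (y + u) ∪ E y)
        ≤ volume.real (Icc (0 : ℝ) 3) := by
      refine measureReal_mono (union_subset ?_ ?_) (by simp)
      · intro s hs
        have := hs.1
        simp only [mem_Icc] at this ⊢
        constructor <;> linarith [hu.1, hu.2]
      · intro s hs
        have := hs.1
        simp only [mem_Icc] at this ⊢
        constructor <;> linarith
    rw [hun, hm'] at hle
    have : volume.real (Icc (0 : ℝ) 3) = 3 := by simp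
    linarith
  obtain ⟨s, hs1, hs2⟩ := h3
  have a1 := hs1.2
  have a2 := hs2.2
  simp only at a1
  rw [show y + u + (s - u) = y + s by ring] at a1
  rw [abs_lt] at a1 a2
  rw [abs_le]
  constructor <;> linarith

/-- A Potter type bound: a function slowly varying at `0` is `O(x^{-η})`. -/
lemma SlowlyVaryingAtZero.eventually_le_rpow {L : ℝ → ℝ} (hL : SlowlyVaryingAtZero L) {η : ℝ}
    (hη : 0 < η) : ∀ᶠ x in 𝓝[>] (0 : ℝ), L x ≤ x ^ (-η) := by
  let h : ℝ → ℝ := fun y => Real.log (L (Real.exp (-y)))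
  have hm : Measurable h := Real.measurable_log.comp (hL.measurable.comp (by fun_prop))
  have ht : ∀ s, 0 < s → Tendsto (fun y => h (y + s) - h y) atTop (𝓝 0) := by
    intro s _
    have h1 : Tendsto (fun y : ℝ => Real.exp (-y)) atTop (𝓝[>] 0) :=
      tendsto_nhdsWithin_iff.2 ⟨Real.tendsto_exp_neg_atTop_nhds_zero,
        Eventually.of_forall fun y => Real.exp_pos _⟩
    have h2 := (hL.tendsto (Real.exp (-s)) (Real.exp_pos _)).comp h1
    have h3 := (Real.continuousAt_log one_ne_zero).tendsto.comp h2
    rw [Real.log_one] at h3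
    refine h3.congr fun y => ?_
    simp only [Function.comp, h]
    rw [Real.log_div (hL.pos _ (by positivity)).ne' (hL.pos _ (Real.exp_pos _)).ne',
      ← Real.exp_add]
    congr 4; ring
  obtain ⟨Y, hY⟩ := exists_abs_sub_le_of_tendsto_sub hm ht
  obtain ⟨Z, hZ⟩ := ((ht 1 one_pos).eventually
    (Metric.ball_mem_nhds 0 (half_pos hη))).exists_forall_of_atTop
  -- Beyond `Y'` a unit step raises `h` by at most η/2 and a fractional step by at most 2, so `h`
  -- grows with slope at most η/2; the other half of η absorbs the constant `h Y' + 2`.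
  set Y' := max (max Y Z) 0
  have hstep : ∀ n : ℕ, h (Y' + n) ≤ h Y' + n * (η / 2) := by
    intro n
    induction n with
    | zero => simp
    | succ n ih =>
      have := hZ (Y' + n) (by
        have : Z ≤ Y' := (le_max_right _ _).trans (le_max_left _ _)
        have : (0 : ℝ) ≤ n := by positivity
        linarith)
      rw [dist_zero_right, Real.norm_eq_abs, abs_lt] at this
      push_cast
      rw [← add_assoc]
      linarith [this.2]
  have hbound : ∀ y ≥ Y', h y ≤ h Y' + 2 + (y - Y') * (η / 2) := by
    intro y hy
    have h0 : 0 ≤ y - Y' := by linarith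
    have hfl := Nat.floor_le h0
    have hfl2 := Nat.lt_floor_add_one (y - Y')
    have h1 := hY (Y' + ⌊y - Y'⌋₊) (by
        have : Y ≤ Y' := (le_max_left _ _).trans (le_max_left _ _)
        have : (0 : ℝ) ≤ ⌊y - Y'⌋₊ := by positivity
        linarith) (y - Y' - ⌊y - Y'⌋₊) ⟨by linarith, by linarith⟩
    rw [show Y' + (⌊y - Y'⌋₊ : ℝ) + (y - Y' - ⌊y - Y'⌋₊) = y by ring, abs_le] at h1
    have h2 := hstep ⌊y - Y'⌋₊
    nlinarith [h1.2]
  have hlog : Tendsto (fun x : ℝ => -Real.log x) (𝓝[>] 0) atTop :=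
    tendsto_neg_atBot_atTop.comp Real.tendsto_log_nhdsGT_zero
  filter_upwards [hlog.eventually_ge_atTop Y',
    hlog.eventually_ge_atTop ((h Y' + 2) / (η / 2)), self_mem_nhdsWithin] with x hx1 hx2 hx0
  have hx0 : 0 < x := hx0
  have h1 := hbound _ hx1
  rw [div_le_iff₀ (by positivity)] at hx2
  have h2 : h (-Real.log x) = Real.log (L x) := by
    simp only [h, neg_neg, Real.exp_log hx0]
  rw [h2] at h1
  have hY0 : 0 ≤ Y' := le_max_right _ _
  rw [Real.rpow_def_of_pos hx0, ← Real.log_le_iff_le_exp (hL.pos x hx0)]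
  nlinarith

/-- The scale `Δ_c` is bounded below by a negative power of `c` if it tends to `0`. -/
lemma IsScale.exists_inv_le_rpow {α : ℝ} (hα : 0 < α) {L : ℝ → ℝ} (hL : SlowlyVaryingAtZero L)
    {Δ : ℝ → ℝ} (hΔ : IsScale α L Δ) (h0 : Tendsto Δ atTop (𝓝 0)) :
    ∃ κ : ℕ, ∀ᶠ c in atTop, (Δ c)⁻¹ ≤ c ^ κ := by
  have h1 : Tendsto Δ atTop (𝓝[>] 0) :=
    tendsto_nhdsWithin_iff.2 ⟨h0, hΔ.mono fun c hc => hc.1.1⟩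
  -- Half of the exponent α is given up to bound L, leaving 1/(2c²) ≤ Δ^{α/2}. With 2c² ≤ c³ this
  -- reads 1/Δ ≤ (c³)^{2/α}, hence the exponent 6/α.
  obtain ⟨κ, hκ⟩ := exists_nat_ge (6 / α)
  refine ⟨κ, ?_⟩
  filter_upwards [hΔ, h1.eventually (hL.eventually_le_rpow (half_pos hα)),
    eventually_ge_atTop 2] with c hc h2 hc2
  obtain ⟨hpos, heq⟩ := hc.1
  have h3 : (2 * c ^ 2)⁻¹ ≤ Δ c ^ (α / 2) := by
    rw [← heq]
    calc Δ c ^ α * L (Δ c) ≤ Δ c ^ α * Δ c ^ (-(α / 2)) := by gcongr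
      _ = Δ c ^ (α / 2) := by rw [← Real.rpow_add hpos]; congr 1; ring
  have h4 : ((Δ c)⁻¹) ^ (α / 2) ≤ c ^ 3 := by
    rw [Real.inv_rpow hpos.le, inv_le_comm₀ (by positivity) (by positivity)]
    refine le_trans ?_ h3
    apply inv_anti₀ (by positivity)
    nlinarith [sq_nonneg c]
  have h5 : (Δ c)⁻¹ ≤ (c ^ 3) ^ (2 / α) := by
    have : (Δ c)⁻¹ = (((Δ c)⁻¹) ^ (α / 2)) ^ (2 / α) := by
      rw [← Real.rpow_mul (by positivity)]
      rw [show α / 2 * (2 / α) = 1 by field_simp, Real.rpow_one]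
    rw [this]
    gcongr
  refine h5.trans ?_
  rw [← Real.rpow_natCast c 3, ← Real.rpow_mul (by linarith), ← Real.rpow_natCast c κ]
  apply Real.rpow_le_rpow_of_exponent_le (by linarith)
  refine le_trans (le_of_eq ?_) hκ
  push_cast; ring

end SlowVariation

/-! ### Riemann sums for integrals of e^y times a decreasing function. -/

section Riemann

variable {φ : ℝ → ℝ} {A : ℝ}

lemma intervalIntegrable_exp_mul (hφ : Antitone φ) (a b : ℝ) :
    IntervalIntegrable (fun y => Real.exp y * φ y) volume a b :=
  (hφ.antitoneOn _).intervalIntegrable.continuousOn_mul Real.continuous_exp.continuousOn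

lemma integral_exp_mul_le (hφ : Antitone φ) {a b : ℝ} (hab : a ≤ b) :
    ∫ y in a..b, Real.exp y * φ y ≤ (Real.exp b - Real.exp a) * φ a := by
  rw [← integral_exp, ← intervalIntegral.integral_mul_const]
  refine intervalIntegral.integral_mono_on hab (intervalIntegrable_exp_mul hφ a b)
    ((Real.continuous_exp.mul continuous_const).intervalIntegrable _ _) fun y hy => ?_
  have := hφ hy.1
  gcongr

lemma le_integral_exp_mul (hφ : Antitone φ) {a b : ℝ} (hab : a ≤ b) :
    (Real.exp b - Real.exp a) * φ b ≤ ∫ y in a..b, Real.exp y * φ y := by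
  rw [← integral_exp, ← intervalIntegral.integral_mul_const]
  refine intervalIntegral.integral_mono_on hab
    ((Real.continuous_exp.mul continuous_const).intervalIntegrable _ _)
    (intervalIntegrable_exp_mul hφ a b) fun y hy => ?_
  have := hφ hy.2
  gcongr

lemma exp_mul_le_of_le_exp (hA : ∀ y, 0 ≤ y → φ y ≤ A * Real.exp (-2 * y)) {y : ℝ} (hy : 0 ≤ y) :
    Real.exp y * φ y ≤ A * Real.exp (-y) := by
  have h1 := mul_le_mul_of_nonneg_left (hA y hy) (Real.exp_pos y).le
  have h2 : Real.exp (-y) = Real.exp y * Real.exp (-2 * y) := by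
    rw [← Real.exp_add]; congr 1; ring
  rw [h2]; linarith

lemma integrableOn_exp_mul (hφ : Antitone φ) (h0 : ∀ y, 0 ≤ φ y)
    (hA : ∀ y, 0 ≤ y → φ y ≤ A * Real.exp (-2 * y)) :
    IntegrableOn (fun y => Real.exp y * φ y) (Ioi 0) := by
  refine Integrable.mono' ((integrableOn_exp_neg_Ioi 0).const_mul A)
    ((Real.measurable_exp.mul hφ.measurable).aestronglyMeasurable) ?_
  filter_upwards [ae_restrict_mem measurableSet_Ioi] with y hy
  rw [Real.norm_eq_abs, abs_of_nonneg (mul_nonneg (Real.exp_pos _).le (h0 y))]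
  exact exp_mul_le_of_le_exp hA (le_of_lt hy)

lemma setIntegral_exp_mul_le (hφ : Antitone φ) (h0 : ∀ y, 0 ≤ φ y)
    (hA : ∀ y, 0 ≤ y → φ y ≤ A * Real.exp (-2 * y)) {M : ℝ} (hM : 0 ≤ M) :
    ∫ y in Ioi M, Real.exp y * φ y ≤ A * Real.exp (-M) := by
  calc ∫ y in Ioi M, Real.exp y * φ y ≤ ∫ y in Ioi M, A * Real.exp (-y) := by
        refine setIntegral_mono_on
          ((integrableOn_exp_mul hφ h0 hA).mono_set (Ioi_subset_Ioi hM))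
          ((integrableOn_exp_neg_Ioi M).const_mul A) measurableSet_Ioi fun y hy => ?_
        exact exp_mul_le_of_le_exp hA (hM.trans (le_of_lt hy))
    _ = A * Real.exp (-M) := by
        rw [integral_const_mul, integral_exp_neg_Ioi]

lemma setIntegral_exp_mul_eq (hφ : Antitone φ) (h0 : ∀ y, 0 ≤ φ y)
    (hA : ∀ y, 0 ≤ y → φ y ≤ A * Real.exp (-2 * y)) {M : ℝ} (hM : 0 ≤ M) :
    ∫ y in Ioi 0, Real.exp y * φ y
      = (∫ y in (0 : ℝ)..M, Real.exp y * φ y) + ∫ y in Ioi M, Real.exp y * φ y := by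
  have hi := integrableOn_exp_mul hφ h0 hA
  rw [intervalIntegral.integral_of_le hM, ← setIntegral_union (Ioc_disjoint_Ioi le_rfl)
    measurableSet_Ioi (hi.mono_set Ioc_subset_Ioi_self) (hi.mono_set (Ioi_subset_Ioi hM)),
    Ioc_union_Ioi_eq_Ioi hM]

/-- The weight of the j-th term is e^{2h} times the mass of e^y on the interval ending at jh, over
which φ is at least φ(jh). Only the term j = 0 has no such interval; it uses φ ≤ 1. The offsets are
those of the bins of y after smoothing by `ramp`. -/
lemma sum_exp_mul_le (hφ : Antitone φ) (h0 : ∀ y, 0 ≤ φ y) (h1 : ∀ y, φ y ≤ 1)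
    (hA : ∀ y, 0 ≤ y → φ y ≤ A * Real.exp (-2 * y)) {h : ℝ} (hh : 0 < h) (n : ℕ) :
    ∑ j ∈ Finset.range n, (Real.exp ((j + 2) * h) - Real.exp ((j + 1) * h)) * φ (j * h)
      ≤ Real.exp (2 * h) * (1 + ∫ y in Ioi 0, Real.exp y * φ y) - Real.exp h := by
  have hnn : ∀ y, 0 ≤ Real.exp y * φ y := fun y => mul_nonneg (Real.exp_pos _).le (h0 y)
  have key : ∑ j ∈ Finset.range n,
      (Real.exp ((j + 2) * h) - Real.exp ((j + 1) * h)) * φ (j * h)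
      ≤ Real.exp (2 * h) * (∫ y in (0 : ℝ)..(n * h), Real.exp y * φ y)
        + (Real.exp (2 * h) - Real.exp h) := by
    have hmono : Real.exp h ≤ Real.exp (2 * h) := Real.exp_le_exp.2 (by linarith)
    rcases n with _ | n
    · simpa using hmono
    rw [Finset.sum_range_succ']
    have hlast : (Real.exp (((0 : ℕ) + 2) * h) - Real.exp (((0 : ℕ) + 1) * h)) * φ ((0 : ℕ) * h)
        ≤ Real.exp (2 * h) - Real.exp h := by
      simp only [Nat.cast_zero, zero_add, one_mul, zero_mul]
      exact mul_le_of_le_one_right (by linarith) (h1 0)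
    have hsum : ∑ j ∈ Finset.range n, (Real.exp (((j + 1 : ℕ) + 2) * h)
        - Real.exp (((j + 1 : ℕ) + 1) * h)) * φ ((j + 1 : ℕ) * h)
        ≤ Real.exp (2 * h) * ∫ y in (0 : ℝ)..((n : ℕ) * h), Real.exp y * φ y := by
      have := intervalIntegral.sum_integral_adjacent_intervals (μ := volume)
        (f := fun y => Real.exp y * φ y) (a := fun j : ℕ => (j : ℝ) * h) (n := n)
        (fun k _ => intervalIntegrable_exp_mul hφ _ _)
      simp only [Nat.cast_zero, zero_mul] at this
      rw [← this, Finset.mul_sum]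
      refine Finset.sum_le_sum fun j _ => ?_
      have h3 := le_integral_exp_mul hφ (a := j * h) (b := ((j + 1 : ℕ) : ℝ) * h)
        (by push_cast; nlinarith)
      refine le_trans (le_of_eq ?_) (mul_le_mul_of_nonneg_left h3 (Real.exp_pos _).le)
      rw [← mul_assoc, mul_sub, ← Real.exp_add, ← Real.exp_add]
      push_cast; congr 3 <;> ring_nf
    have hle : ∫ y in (0 : ℝ)..((n : ℕ) * h), Real.exp y * φ y
        ≤ ∫ y in (0 : ℝ)..((n + 1 : ℕ) * h), Real.exp y * φ y := by
      refine intervalIntegral.integral_mono_interval le_rfl (by positivity)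
        (by push_cast; nlinarith) (Eventually.of_forall hnn)
        (intervalIntegrable_exp_mul hφ _ _)
    have := mul_le_mul_of_nonneg_left hle (Real.exp_pos (2 * h)).le
    linarith
  have h3 := setIntegral_exp_mul_eq hφ h0 hA (M := n * h) (by positivity)
  have h4 : 0 ≤ ∫ y in Ioi ((n : ℝ) * h), Real.exp y * φ y := integral_nonneg hnn
  have := mul_le_mul_of_nonneg_left
    (show (∫ y in (0 : ℝ)..(n * h), Real.exp y * φ y) ≤ ∫ y in Ioi 0, Real.exp y * φ y by linarith)
    (Real.exp_pos (2 * h)).le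
  linarith

/-- The weight of the j-th term is e^{-2h} times the mass of e^y on the interval starting at (j+3)h,
over which φ is at most φ((j+3)h). What is missed is the integral over [0, 3h] and the tail. -/
lemma le_sum_exp_mul (hφ : Antitone φ) (h0 : ∀ y, 0 ≤ φ y) (h1 : ∀ y, φ y ≤ 1)
    (hA : ∀ y, 0 ≤ y → φ y ≤ A * Real.exp (-2 * y)) {h : ℝ} (hh : 0 < h) (n : ℕ) :
    Real.exp (-2 * h) * ((∫ y in Ioi 0, Real.exp y * φ y) - (Real.exp (3 * h) - 1)
        - A * Real.exp (-((n + 3) * h)))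
      ≤ ∑ j ∈ Finset.range n,
        (Real.exp ((j + 2) * h) - Real.exp ((j + 1) * h)) * φ ((j + 3) * h) := by
  have hsum : Real.exp (-2 * h) * ∫ y in (3 * h)..((n + 3) * h), Real.exp y * φ y
      ≤ ∑ j ∈ Finset.range n,
        (Real.exp ((j + 2) * h) - Real.exp ((j + 1) * h)) * φ ((j + 3) * h) := by
    have := intervalIntegral.sum_integral_adjacent_intervals (μ := volume)
      (f := fun y => Real.exp y * φ y) (a := fun j : ℕ => ((j : ℝ) + 3) * h) (n := n)
      (fun k _ => intervalIntegrable_exp_mul hφ _ _)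
    simp only [Nat.cast_zero, zero_add] at this
    rw [← this, Finset.mul_sum]
    refine Finset.sum_le_sum fun j _ => ?_
    have h3 := integral_exp_mul_le hφ (a := (j + 3) * h) (b := (((j + 1 : ℕ) : ℝ) + 3) * h)
      (by push_cast; nlinarith)
    refine le_trans (mul_le_mul_of_nonneg_left h3 (Real.exp_pos _).le) (le_of_eq ?_)
    rw [← mul_assoc, mul_sub, ← Real.exp_add, ← Real.exp_add]
    push_cast; congr 3 <;> ring_nf
  have h3 := setIntegral_exp_mul_eq hφ h0 hA (M := (n + 3) * h) (by positivity)
  have h4 := setIntegral_exp_mul_le hφ h0 hA (M := (n + 3) * h) (by positivity)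
  have h5 := intervalIntegral.integral_add_adjacent_intervals
    (intervalIntegrable_exp_mul hφ 0 (3 * h)) (intervalIntegrable_exp_mul hφ (3 * h) ((n + 3) * h))
  have h6 := integral_exp_mul_le hφ (a := 0) (b := 3 * h) (by positivity)
  have h7 : (Real.exp (3 * h) - Real.exp 0) * φ 0 ≤ Real.exp (3 * h) - 1 := by
    rw [Real.exp_zero]
    refine mul_le_of_le_one_right ?_ (h1 0)
    have := Real.one_le_exp (show 0 ≤ 3 * h by positivity)
    linarith
  refine le_trans (mul_le_mul_of_nonneg_left ?_ (Real.exp_pos _).le) hsum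
  linarith

end Riemann

/-! ### Excursion probabilities of a random vector and their smoothing. -/

section Excursion

variable {ι : Type*}

/-- The probability that some coordinate in `S` exceeds `y`. -/
noncomputable def excProb (ν : Measure (ι → ℝ)) (S : Finset ι) (y : ℝ) : ℝ :=
  ν.real {w | ∃ k ∈ S, y < w k}

/-- `∫₀^∞ e^y ν(max_S w > y) dy`. -/
noncomputable def excMean (ν : Measure (ι → ℝ)) (S : Finset ι) : ℝ :=
  ∫ y in Ioi (0 : ℝ), Real.exp y * excProb ν S y

lemma excProb_antitone (ν : Measure (ι → ℝ)) [IsFiniteMeasure ν] (S : Finset ι) :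
    Antitone (excProb ν S) := fun _ _ h =>
  measureReal_mono (fun _ ⟨k, hk, hy⟩ => ⟨k, hk, h.trans_lt hy⟩)

lemma excProb_nonneg (ν : Measure (ι → ℝ)) (S : Finset ι) (y : ℝ) : 0 ≤ excProb ν S y :=
  measureReal_nonneg

lemma excProb_le_one (ν : Measure (ι → ℝ)) [IsProbabilityMeasure ν] (S : Finset ι) (y : ℝ) :
    excProb ν S y ≤ 1 := measureReal_le_one

lemma measurableSet_exc (S : Finset ι) (y : ℝ) :
    MeasurableSet {w : ι → ℝ | ∃ k ∈ S, y < w k} := by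
  have : {w : ι → ℝ | ∃ k ∈ S, y < w k} = ⋃ k ∈ S, {w | y < w k} := by ext; simp
  rw [this]
  exact Finset.measurableSet_biUnion _ fun k _ =>
    measurableSet_lt measurable_const (measurable_pi_apply k)

/-- A continuous approximation of the indicator of `{max_S w > z}`. -/
noncomputable def ramp (S : Finset ι) (hS : S.Nonempty) (z h : ℝ) : (ι → ℝ) →ᵇ ℝ :=
  BoundedContinuousFunction.ofNormedAddCommGroup
    (fun w => max 0 (min 1 ((S.sup' hS (fun k => w k) - z) / h + 1)))
    (by
      have : Continuous fun w : ι → ℝ => S.sup' hS fun k => w k :=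
        Continuous.finset_sup'_apply hS fun k _ => continuous_apply k
      fun_prop) 1
    (fun w => by
      rw [Real.norm_eq_abs, abs_of_nonneg (le_max_left _ _)]
      exact max_le zero_le_one (min_le_left _ _))

variable {S : Finset ι} {hS : S.Nonempty} {z h : ℝ}

lemma ramp_nonneg (w : ι → ℝ) : 0 ≤ ramp S hS z h w := le_max_left _ _

lemma ramp_le_one (w : ι → ℝ) : ramp S hS z h w ≤ 1 := max_le zero_le_one (min_le_left _ _)

lemma ramp_eq_one (hh : 0 < h) {w : ι → ℝ} (hw : ∃ k ∈ S, z ≤ w k) : ramp S hS z h w = 1 := by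
  obtain ⟨k, hk, hkw⟩ := hw
  have h1 : z ≤ S.sup' hS fun k => w k := hkw.trans (Finset.le_sup' (fun k => w k) hk)
  have h2 : 0 ≤ (S.sup' hS (fun k => w k) - z) / h := div_nonneg (by linarith) hh.le
  refine le_antisymm (ramp_le_one w) (le_max_of_le_right (le_min le_rfl (by linarith)))

lemma ramp_eq_zero (hh : 0 < h) {w : ι → ℝ} (hw : ¬ ∃ k ∈ S, z - h < w k) :
    ramp S hS z h w = 0 := by
  push Not at hw
  have h1 : S.sup' hS (fun k => w k) ≤ z - h := Finset.sup'_le hS _ hw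
  have h2 : (S.sup' hS (fun k => w k) - z) / h + 1 ≤ 0 := by
    rw [div_add_one hh.ne']
    exact div_nonpos_of_nonpos_of_nonneg (by linarith) hh.le
  exact max_eq_left ((min_le_right _ _).trans h2)

/-- Weak convergence only tests continuous functions; replacing the indicator by the ramp costs a
shift of the level by at most `h`, here on the upper side. -/
lemma integral_ramp_le (ν : Measure (ι → ℝ)) [IsProbabilityMeasure ν] [Countable ι]
    (hh : 0 < h) : ∫ w, ramp S hS z h w ∂ν ≤ excProb ν S (z - h) := by
  have hm := measurableSet_exc S (z - h)
  calc ∫ w, ramp S hS z h w ∂ν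
      ≤ ∫ w, {w : ι → ℝ | ∃ k ∈ S, z - h < w k}.indicator (fun _ => (1 : ℝ)) w ∂ν := by
        refine integral_mono ((ramp S hS z h).integrable ν)
          ((integrable_const _).indicator hm) fun w => ?_
        by_cases hw : ∃ k ∈ S, z - h < w k
        · rw [indicator_of_mem (by exact hw)]; exact ramp_le_one w
        · simp only [ramp_eq_zero hh hw]; exact indicator_nonneg (by simp) _
    _ = _ := by rw [integral_indicator hm]; simp [excProb]

lemma le_integral_ramp (ν : Measure (ι → ℝ)) [IsProbabilityMeasure ν] [Countable ι]
    (hh : 0 < h) : excProb ν S z ≤ ∫ w, ramp S hS z h w ∂ν := by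
  have hm := measurableSet_exc S z
  calc excProb ν S z
      = ∫ w, {w : ι → ℝ | ∃ k ∈ S, z < w k}.indicator (fun _ => (1 : ℝ)) w ∂ν := by
        rw [integral_indicator hm]; simp [excProb]
    _ ≤ ∫ w, ramp S hS z h w ∂ν := by
        refine integral_mono ((integrable_const _).indicator hm)
          ((ramp S hS z h).integrable ν) fun w => ?_
        by_cases hw : ∃ k ∈ S, z < w k
        · rw [indicator_of_mem (by exact hw), ramp_eq_one hh (hw.imp fun k hk => ⟨hk.1, hk.2.le⟩)]
        · rw [indicator_of_notMem (by exact hw)]; exact ramp_nonneg w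

end Excursion

/-! ### Exceedance over a finite grid for one fixed level `c`. -/

section OneLevel

variable {Ω ι : Type*} [MeasurableSpace Ω] [Fintype ι] {P : Measure Ω} [IsProbabilityMeasure P]
  {X : Ω → ℝ} {Z : ι → Ω → ℝ} {c : ℝ}

/-- Averaging an approximate conditional expectation over an event `{X ∈ A}`. -/
lemma abs_setIntegral_sub_le (hX : Measurable X) {G : Ω → ℝ} (hG : Integrable G P)
    {A B : Set ℝ} (hA : MeasurableSet A) (hAB : A ⊆ B) {I e : ℝ}
    (hcond : ∀ᵐ ω ∂P, X ω ∈ B → |(P[G | MeasurableSpace.comap X inferInstance]) ω - I| ≤ e) :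
    |∫ ω in X ⁻¹' A, G ω ∂P - P.real (X ⁻¹' A) * I| ≤ e * P.real (X ⁻¹' A) := by
  have hle : MeasurableSpace.comap X inferInstance ≤ (inferInstance : MeasurableSpace Ω) :=
    hX.comap_le
  have hm : MeasurableSet[MeasurableSpace.comap X inferInstance] (X ⁻¹' A) := ⟨A, hA, rfl⟩
  -- The event is measurable for the σ-algebra generated by `X`, so `G` may be replaced by its
  -- conditional expectation, which is within `e` of `I` there.
  rw [← setIntegral_condExp hle hG hm]
  have h1 : ∫ _ω in X ⁻¹' A, I ∂P = P.real (X ⁻¹' A) * I := by simp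
  rw [← h1, ← integral_sub integrable_condExp.integrableOn (integrable_const _)]
  rw [mul_comm, ← Real.norm_eq_abs, mul_comm]
  have h2 := norm_setIntegral_le_of_norm_le_const_ae' (μ := P) (s := X ⁻¹' A) (C := e)
    (f := fun ω => (P[G | MeasurableSpace.comap X inferInstance]) ω - I)
    (measure_lt_top _ _) (hcond.mono fun ω h hω => by
      rw [Real.norm_eq_abs]; exact h (hAB hω))
  exact h2

lemma measureReal_bin (hX : Measurable X) {a b : ℝ} (hab : a ≤ b) :
    P.real (X ⁻¹' Ioc a b) = P.real {ω | a < X ω} - P.real {ω | b < X ω} := by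
  have h1 : X ⁻¹' Ioc a b = {ω | a < X ω} \ {ω | b < X ω} := by
    ext ω; simp
  have h2 : {ω | b < X ω} ⊆ {ω | a < X ω} := fun ω h => hab.trans_lt h
  rw [h1, measureReal_sdiff h2 (measurableSet_lt measurable_const hX)]

end OneLevel

section OneLevel

variable {Ω ι : Type*} [MeasurableSpace Ω] {P : Measure Ω} [IsProbabilityMeasure P]
  {X : Ω → ℝ} {Z : ι → Ω → ℝ} {c : ℝ}

lemma measurableSet_exists_lt (hZ : ∀ k, Measurable (Z k)) (S : Finset ι) (b : ℝ) :
    MeasurableSet {ω | ∃ k ∈ S, b < Z k ω} := by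
  have : {ω | ∃ k ∈ S, b < Z k ω} = ⋃ k ∈ S, {ω | b < Z k ω} := by ext; simp
  rw [this]
  exact Finset.measurableSet_biUnion _ fun k _ => measurableSet_lt measurable_const (hZ k)

lemma measurable_increments (hX : Measurable X) (hZ : ∀ k, Measurable (Z k)) (c : ℝ) :
    Measurable fun ω => fun k => c * (Z k ω - X ω) :=
  measurable_pi_lambda _ fun k => ((hZ k).sub hX).const_mul c

variable [Fintype ι]

lemma integrable_comp_increments (hX : Measurable X) (hZ : ∀ k, Measurable (Z k)) (c : ℝ)
    (g : (ι → ℝ) →ᵇ ℝ) : Integrable (fun ω => g fun k => c * (Z k ω - X ω)) P :=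
  Integrable.of_bound
    (g.continuous.measurable.comp (measurable_increments hX hZ c)).aestronglyMeasurable ‖g‖
    (Eventually.of_forall fun _ => g.norm_coe_le_norm _)

/-- On this bin X ≤ c - y/c, so Z > c - γ/c forces the scaled increment above y - γ ≥ z, where the
ramp equals 1. -/
lemma measureReal_bin_inter_le (hX : Measurable X) (hZ : ∀ k, Measurable (Z k)) (hc : 0 < c)
    (ν : Measure (ι → ℝ)) [IsProbabilityMeasure ν] {S : Finset ι} (hS : S.Nonempty)
    {γ y y' z h e : ℝ} (hh : 0 < h) (hz : z ≤ y - γ) {B : Set ℝ}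
    (hB : Ioc (c - y' / c) (c - y / c) ⊆ B)
    (hcond : ∀ᵐ ω ∂P, X ω ∈ B →
      |(P[fun ω' => ramp S hS z h (fun k => c * (Z k ω' - X ω')) |
        MeasurableSpace.comap X inferInstance]) ω - ∫ w, ramp S hS z h w ∂ν| ≤ e) :
    P.real (X ⁻¹' Ioc (c - y' / c) (c - y / c) ∩ {ω | ∃ k ∈ S, c - γ / c < Z k ω})
      ≤ P.real (X ⁻¹' Ioc (c - y' / c) (c - y / c)) * (excProb ν S (z - h) + e) := by
  set A := Ioc (c - y' / c) (c - y / c)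
  have hG := integrable_comp_increments (P := P) hX hZ c (ramp S hS z h)
  have h1 := abs_setIntegral_sub_le hX hG (A := A) measurableSet_Ioc hB hcond
  have hE := measurableSet_exists_lt hZ S (c - γ / c)
  have hA : MeasurableSet (X ⁻¹' A) := hX measurableSet_Ioc
  have h2 : P.real (X ⁻¹' A ∩ {ω | ∃ k ∈ S, c - γ / c < Z k ω})
      ≤ ∫ ω in X ⁻¹' A, ramp S hS z h (fun k => c * (Z k ω - X ω)) ∂P := by
    have : P.real (X ⁻¹' A ∩ {ω | ∃ k ∈ S, c - γ / c < Z k ω})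
        = ∫ ω in X ⁻¹' A, {ω | ∃ k ∈ S, c - γ / c < Z k ω}.indicator (fun _ => (1 : ℝ)) ω ∂P := by
      rw [setIntegral_indicator hE]; simp
    rw [this]
    refine setIntegral_mono_on ((integrable_const _).indicator hE).integrableOn hG.integrableOn
      hA fun ω hω => ?_
    by_cases hω' : ∃ k ∈ S, c - γ / c < Z k ω
    · rw [indicator_of_mem (by exact hω'), ramp_eq_one hh]
      obtain ⟨k, hk, hlt⟩ := hω'
      refine ⟨k, hk, hz.trans ?_⟩
      have h3 : X ω ≤ c - y / c := hω.2
      have h4 : (y - γ) / c ≤ Z k ω - X ω := by rw [sub_div]; linarith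
      rw [div_le_iff₀ hc] at h4
      linarith
    · rw [indicator_of_notMem (by exact hω')]; exact ramp_nonneg _
  have h3 := integral_ramp_le (S := S) (hS := hS) (z := z) ν hh
  have h4 := mul_le_mul_of_nonneg_left h3 (measureReal_nonneg (μ := P) (s := X ⁻¹' A))
  linarith [(abs_le.1 h1).2]

/-- On this bin X > c - y'/c. Where the ramp is positive the scaled increment exceeds z - h ≥ y' -
γ, which lifts Z above c - γ/c. -/
lemma le_measureReal_bin_inter (hX : Measurable X) (hZ : ∀ k, Measurable (Z k)) (hc : 0 < c)
    (ν : Measure (ι → ℝ)) [IsProbabilityMeasure ν] {S : Finset ι} (hS : S.Nonempty)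
    {γ y y' z h e : ℝ} (hh : 0 < h) (hz : y' - γ ≤ z - h) {B : Set ℝ}
    (hB : Ioc (c - y' / c) (c - y / c) ⊆ B)
    (hcond : ∀ᵐ ω ∂P, X ω ∈ B →
      |(P[fun ω' => ramp S hS z h (fun k => c * (Z k ω' - X ω')) |
        MeasurableSpace.comap X inferInstance]) ω - ∫ w, ramp S hS z h w ∂ν| ≤ e) :
    P.real (X ⁻¹' Ioc (c - y' / c) (c - y / c)) * (excProb ν S z - e)
      ≤ P.real (X ⁻¹' Ioc (c - y' / c) (c - y / c) ∩ {ω | ∃ k ∈ S, c - γ / c < Z k ω}) := by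
  set A := Ioc (c - y' / c) (c - y / c)
  have hG := integrable_comp_increments (P := P) hX hZ c (ramp S hS z h)
  have h1 := abs_setIntegral_sub_le hX hG (A := A) measurableSet_Ioc hB hcond
  have hE := measurableSet_exists_lt hZ S (c - γ / c)
  have hA : MeasurableSet (X ⁻¹' A) := hX measurableSet_Ioc
  have h2 : ∫ ω in X ⁻¹' A, ramp S hS z h (fun k => c * (Z k ω - X ω)) ∂P
      ≤ P.real (X ⁻¹' A ∩ {ω | ∃ k ∈ S, c - γ / c < Z k ω}) := by
    have : P.real (X ⁻¹' A ∩ {ω | ∃ k ∈ S, c - γ / c < Z k ω})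
        = ∫ ω in X ⁻¹' A, {ω | ∃ k ∈ S, c - γ / c < Z k ω}.indicator (fun _ => (1 : ℝ)) ω ∂P := by
      rw [setIntegral_indicator hE]; simp
    rw [this]
    refine setIntegral_mono_on hG.integrableOn ((integrable_const _).indicator hE).integrableOn
      hA fun ω hω => ?_
    by_cases hω' : ∃ k ∈ S, z - h < c * (Z k ω - X ω)
    · rw [indicator_of_mem]
      · exact ramp_le_one _
      obtain ⟨k, hk, hlt⟩ := hω'
      refine ⟨k, hk, ?_⟩
      have h3 : c - y' / c < X ω := hω.1
      have h4 : (y' - γ) / c < Z k ω - X ω := by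
        rw [div_lt_iff₀ hc]; linarith
      rw [sub_div] at h4
      linarith
    · rw [ramp_eq_zero hh hω']; exact indicator_nonneg (by simp) _
  have h3 := le_integral_ramp (S := S) (hS := hS) (z := z) ν hh
  have h4 := mul_le_mul_of_nonneg_left h3 (measureReal_nonneg (μ := P) (s := X ⁻¹' A))
  linarith [(abs_le.1 h1).1]

/-- The bin probabilities `P(c - y'/c < X ≤ c - y/c)`. -/
lemma abs_measureReal_bin_sub_le (hX : Measurable X) (hc : 0 < c) {ψ e M y y' : ℝ}
    (h1 : ∀ y ∈ Ioc (0 : ℝ) M, |P.real {ω | c - y / c < X ω} - Real.exp y * ψ| ≤ e * ψ)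
    (hy : 0 < y) (hyy : y ≤ y') (hyM : y' ≤ M) :
    |P.real (X ⁻¹' Ioc (c - y' / c) (c - y / c)) - (Real.exp y' - Real.exp y) * ψ|
      ≤ 2 * e * ψ := by
  rw [measureReal_bin hX (by gcongr)]
  have a1 := abs_le.1 (h1 y ⟨hy, hyy.trans hyM⟩)
  have a2 := abs_le.1 (h1 y' ⟨hy.trans_le hyy, hyM⟩)
  rw [abs_le]
  constructor <;> linarith [a1.1, a1.2, a2.1, a2.2]

variable {ν : Measure (ι → ℝ)} [IsProbabilityMeasure ν] {S : Finset ι} {hS : S.Nonempty}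
  {ψ γ h e e' A : ℝ} {n : ℕ}

/-- The event is split by the position of X: above the first bin edge, in one of n bins of width
h/c, or below the last edge. The first piece is counted in full and produces the 1 next to
`excMean`; the bins form a Riemann sum; the last piece is the hypothesis `h3`. -/
lemma measureReal_exists_lt_le (hX : Measurable X) (hZ : ∀ k, Measurable (Z k)) (hc : 0 < c)
    (hψ : 0 ≤ ψ) (hγ : 0 ≤ γ) (hh : 0 < h) (he0 : 0 ≤ e) (he1 : e ≤ 1)
    (hA : ∀ y, 0 ≤ y → excProb ν S y ≤ A * Real.exp (-2 * y))
    (h1 : ∀ y ∈ Ioc (0 : ℝ) (γ + (n + 1) * h),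
      |P.real {ω | c - y / c < X ω} - Real.exp y * ψ| ≤ e * ψ)
    (h2 : ∀ j ∈ Finset.range n, ∀ᵐ ω ∂P, X ω ∈ Ico (c - (γ + (n + 1) * h) / c) c →
      |(P[fun ω' => ramp S hS ((j + 1) * h) h (fun k => c * (Z k ω' - X ω')) |
        MeasurableSpace.comap X inferInstance]) ω - ∫ w, ramp S hS ((j + 1) * h) h w ∂ν| ≤ e)
    (h3 : P.real {ω | ∃ k ∈ S, c - γ / c < Z k ω ∧ X ω ≤ c - (γ + (n + 1) * h) / c} ≤ e' * ψ) :
    P.real {ω | ∃ k ∈ S, c - γ / c < Z k ω}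
      ≤ (Real.exp (γ + 2 * h) * (1 + excMean ν S)
          + e * (1 + 4 * n + Real.exp (γ + (n + 1) * h)) + e') * ψ := by
  set E := {ω | ∃ k ∈ S, c - γ / c < Z k ω} with hE
  -- The edges start at γ + h and not at γ: they must be positive for `h1` to apply, also when γ =
  -- 0.
  let y : ℕ → ℝ := fun j => γ + (j + 1) * h
  have hy0 : ∀ j, 0 < y j := fun j => by simp only [y]; positivity
  have hymono : ∀ j, y j ≤ y (j + 1) := fun j => by simp only [y]; push_cast; nlinarith
  have hyn : ∀ j, j < n → y (j + 1) ≤ γ + (n + 1) * h := fun j hj => by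
    simp only [y]; push_cast
    have : (j : ℝ) + 1 ≤ n := by exact_mod_cast hj
    nlinarith
  let T : ℕ → Set Ω := fun j => X ⁻¹' Ioc (c - y (j + 1) / c) (c - y j / c)
  have hcover : ∀ m : ℕ, E ⊆ {ω | c - y 0 / c < X ω} ∪ (⋃ j ∈ Finset.range m, T j ∩ E)
      ∪ {ω | ∃ k ∈ S, c - γ / c < Z k ω ∧ X ω ≤ c - y m / c} := by
    intro m
    induction m with
    | zero =>
      rintro ω hω
      by_cases h : c - y 0 / c < X ω
      · exact Or.inl (Or.inl h)
      · obtain ⟨k, hk, hk'⟩ := hω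
        exact Or.inr ⟨k, hk, hk', not_lt.1 h⟩
    | succ m ih =>
      intro ω hω
      rcases ih hω with (h | h) | ⟨k, hk, hk', h⟩
      · exact Or.inl (Or.inl h)
      · refine Or.inl (Or.inr ?_)
        simp only [mem_iUnion] at h ⊢
        obtain ⟨j, hj, h⟩ := h
        exact ⟨j, Finset.mem_range.2 ((Finset.mem_range.1 hj).trans m.lt_succ_self), h⟩
      · by_cases h' : c - y (m + 1) / c < X ω
        · refine Or.inl (Or.inr ?_)
          simp only [mem_iUnion]
          exact ⟨m, Finset.self_mem_range_succ m, ⟨h', h⟩, hω⟩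
        · exact Or.inr ⟨k, hk, hk', not_lt.1 h'⟩
  have hbin : ∀ j ∈ Finset.range n, P.real (T j ∩ E)
      ≤ ((Real.exp (y (j + 1)) - Real.exp (y j)) * excProb ν S (j * h)
        + e * (Real.exp (y (j + 1)) - Real.exp (y j)) + 4 * e) * ψ := by
    intro j hj
    have hjn := Finset.mem_range.1 hj
    have b1 := measureReal_bin_inter_le hX hZ hc ν hS (γ := γ) (y := y j) (y' := y (j + 1))
      (z := (j + 1) * h) (h := h) (e := e) hh (by simp only [y]; linarith)
      (B := Ico (c - (γ + (n + 1) * h) / c) c) (fun x hx => by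
        refine ⟨le_trans ?_ hx.1.le, hx.2.trans_lt ?_⟩
        · have := hyn j hjn
          gcongr
        · have := div_pos (hy0 j) hc
          linarith) (h2 j hj)
    have b2 := abs_measureReal_bin_sub_le hX hc h1 (hy0 j) (hymono j) (hyn j hjn)
    have hφ0 := excProb_nonneg ν S (j * h)
    have hφ1 := excProb_le_one ν S (j * h)
    rw [show (j + 1) * h - h = j * h by ring] at b1
    have b3 := (abs_le.1 b2).2
    refine b1.trans ?_
    calc P.real (T j) * (excProb ν S (j * h) + e)
        ≤ ((Real.exp (y (j + 1)) - Real.exp (y j) + 2 * e) * ψ) * (excProb ν S (j * h) + e) := by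
          refine mul_le_mul_of_nonneg_right ?_ (by linarith)
          linarith
      _ = ((Real.exp (y (j + 1)) - Real.exp (y j)) * excProb ν S (j * h)
        + e * (Real.exp (y (j + 1)) - Real.exp (y j))
          + 2 * e * (excProb ν S (j * h) + e)) * ψ := by ring
      _ ≤ _ := by
          refine mul_le_mul_of_nonneg_right ?_ hψ
          have : 2 * e * (excProb ν S (j * h) + e) ≤ 2 * e * 2 := by gcongr; linarith
          linarith
  have hfirst := (abs_le.1 (h1 (y 0) ⟨hy0 0, by
    simp only [y]
    have : (0 : ℝ) ≤ n := by positivity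
    push_cast; nlinarith⟩)).2
  have hsum := sum_exp_mul_le (excProb_antitone ν S) (excProb_nonneg ν S) (excProb_le_one ν S)
    hA hh n
  have htel : ∑ j ∈ Finset.range n, (Real.exp (y (j + 1)) - Real.exp (y j))
      = Real.exp (y n) - Real.exp (y 0) := Finset.sum_range_sub (fun j => Real.exp (y j)) n
  have hexp : ∑ j ∈ Finset.range n, (Real.exp (y (j + 1)) - Real.exp (y j)) * excProb ν S (j * h)
      = Real.exp γ * ∑ j ∈ Finset.range n, (Real.exp ((j + 2) * h) - Real.exp ((j + 1) * h))
        * excProb ν S (j * h) := by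
    rw [Finset.mul_sum]
    refine Finset.sum_congr rfl fun j _ => ?_
    rw [← mul_assoc, mul_sub, ← Real.exp_add, ← Real.exp_add]
    simp only [y]; push_cast; congr 3; ring
  have hy0' : y 0 = γ + h := by simp [y]
  have hyn' : y n = γ + (n + 1) * h := rfl
  calc P.real E
      ≤ P.real {ω | c - y 0 / c < X ω} + ∑ j ∈ Finset.range n, P.real (T j ∩ E)
        + P.real {ω | ∃ k ∈ S, c - γ / c < Z k ω ∧ X ω ≤ c - y n / c} := by
        refine (measureReal_mono (hcover n) (measure_ne_top _ _)).trans ?_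
        refine (measureReal_union_le _ _).trans ?_
        gcongr
        refine (measureReal_union_le _ _).trans ?_
        gcongr
        exact measureReal_biUnion_finset_le _ _
    _ ≤ (Real.exp (y 0) + e) * ψ + ∑ j ∈ Finset.range n,
          ((Real.exp (y (j + 1)) - Real.exp (y j)) * excProb ν S (j * h)
          + e * (Real.exp (y (j + 1)) - Real.exp (y j)) + 4 * e) * ψ + e' * ψ := by
        have := Finset.sum_le_sum hbin
        linarith
    _ = (Real.exp (y 0) + e + (Real.exp γ * ∑ j ∈ Finset.range n,
          (Real.exp ((j + 2) * h) - Real.exp ((j + 1) * h)) * excProb ν S (j * h)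
          + e * (Real.exp (y n) - Real.exp (y 0)) + n * (4 * e)) + e') * ψ := by
        rw [← Finset.sum_mul, Finset.sum_add_distrib, Finset.sum_add_distrib, hexp,
          ← Finset.mul_sum, htel]
        simp; ring
    _ ≤ _ := by
        refine mul_le_mul_of_nonneg_right ?_ hψ
        have h5 := mul_le_mul_of_nonneg_left hsum (Real.exp_pos γ).le
        have h6 : Real.exp γ * (Real.exp (2 * h) * (1 + excMean ν S) - Real.exp h)
            = Real.exp (γ + 2 * h) * (1 + excMean ν S) - Real.exp (γ + h) := by
          rw [Real.exp_add, Real.exp_add]; ring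
        have h7 : excMean ν S = ∫ y in Ioi (0 : ℝ), Real.exp y * excProb ν S y := rfl
        rw [← h7, h6] at h5
        rw [hy0', hyn']
        have h8 : 0 ≤ e * Real.exp (γ + h) := by positivity
        linarith

/-- Only the contribution of the disjoint bins is kept, so no control of X near or far below the
level is needed. The price is that the 1 of the upper bound is missing. -/
lemma le_measureReal_exists_lt (hX : Measurable X) (hZ : ∀ k, Measurable (Z k)) (hc : 0 < c)
    (hψ : 0 ≤ ψ) (hh : 0 < h) (he0 : 0 ≤ e) (he1 : e ≤ 1)
    (hA : ∀ y, 0 ≤ y → excProb ν S y ≤ A * Real.exp (-2 * y))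
    (h1 : ∀ y ∈ Ioc (0 : ℝ) ((n + 1) * h),
      |P.real {ω | c - y / c < X ω} - Real.exp y * ψ| ≤ e * ψ)
    (h2 : ∀ j ∈ Finset.range n, ∀ᵐ ω ∂P, X ω ∈ Ico (c - ((n + 1) * h) / c) c →
      |(P[fun ω' => ramp S hS ((j + 3) * h) h (fun k => c * (Z k ω' - X ω')) |
        MeasurableSpace.comap X inferInstance]) ω - ∫ w, ramp S hS ((j + 3) * h) h w ∂ν| ≤ e) :
    (Real.exp (-2 * h) * (excMean ν S - (Real.exp (3 * h) - 1) - A * Real.exp (-((n + 3) * h)))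
        - e * (4 * n + Real.exp ((n + 1) * h))) * ψ
      ≤ P.real {ω | ∃ k ∈ S, c < Z k ω} := by
  set E := {ω | ∃ k ∈ S, c < Z k ω} with hE
  have hE0 : {ω | ∃ k ∈ S, c - 0 / c < Z k ω} = E := by simp [hE]
  let y : ℕ → ℝ := fun j => (j + 1) * h
  have hy0 : ∀ j, 0 < y j := fun j => by simp only [y]; positivity
  have hymono : ∀ j, y j ≤ y (j + 1) := fun j => by simp only [y]; push_cast; nlinarith
  have hyn : ∀ j, j < n → y (j + 1) ≤ (n + 1) * h := fun j hj => by
    simp only [y]; push_cast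
    have : (j : ℝ) + 1 ≤ n := by exact_mod_cast hj
    nlinarith
  let T : ℕ → Set Ω := fun j => X ⁻¹' Ioc (c - y (j + 1) / c) (c - y j / c)
  have hmE : MeasurableSet E := by
    have := measurableSet_exists_lt hZ S c
    exact this
  have hdisj : (↑(Finset.range n) : Set ℕ).PairwiseDisjoint fun j => T j ∩ E := by
    have hlt : ∀ i j, i < j → Disjoint (T i ∩ E) (T j ∩ E) := by
      intro i j hij
      rw [Set.disjoint_left]
      rintro ω ⟨⟨ha, -⟩, -⟩ ⟨⟨-, hb⟩, -⟩
      have hb : X ω ≤ c - y j / c := hb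
      have ha : c - y (i + 1) / c < X ω := ha
      have : y (i + 1) / c ≤ y j / c := by
        have : y (i + 1) ≤ y j := by
          simp only [y]
          have : ((i + 1 : ℕ) : ℝ) ≤ j := by exact_mod_cast hij
          gcongr
        gcongr
      linarith
    intro i _ j _ hij
    rcases lt_or_gt_of_ne hij with h | h
    · exact hlt i j h
    · exact (hlt j i h).symm
  have hbin : ∀ j ∈ Finset.range n,
      ((Real.exp (y (j + 1)) - Real.exp (y j)) * excProb ν S ((j + 3) * h)
        - e * (Real.exp (y (j + 1)) - Real.exp (y j)) - 4 * e) * ψ ≤ P.real (T j ∩ E) := by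
    intro j hj
    have hjn := Finset.mem_range.1 hj
    have b1 := le_measureReal_bin_inter hX hZ hc ν hS (γ := 0) (y := y j) (y' := y (j + 1))
      (z := (j + 3) * h) (h := h) (e := e) hh (by simp only [y]; push_cast; linarith)
      (B := Ico (c - ((n + 1) * h) / c) c) (fun x hx => by
        refine ⟨le_trans ?_ hx.1.le, hx.2.trans_lt ?_⟩
        · have := hyn j hjn
          gcongr
        · have := div_pos (hy0 j) hc
          linarith) (h2 j hj)
    rw [hE0] at b1
    have b2 := abs_le.1 (abs_measureReal_bin_sub_le hX hc h1 (hy0 j) (hymono j) (hyn j hjn))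
    have hφ0 := excProb_nonneg ν S ((j + 3) * h)
    have hφ1 := excProb_le_one ν S ((j + 3) * h)
    refine le_trans ?_ b1
    have b3 : (Real.exp (y (j + 1)) - Real.exp (y j) - 2 * e) * ψ * excProb ν S ((j + 3) * h)
        ≤ P.real (T j) * excProb ν S ((j + 3) * h) := by
      refine mul_le_mul_of_nonneg_right ?_ hφ0
      linarith [b2.1]
    have b4 : P.real (T j) * e ≤ (Real.exp (y (j + 1)) - Real.exp (y j) + 2 * e) * ψ * e := by
      refine mul_le_mul_of_nonneg_right ?_ he0
      linarith [b2.2]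
    have b5 : 2 * e * (e * ψ) ≤ 2 * 1 * (e * ψ) := by gcongr
    have b6 : 2 * e * ψ * excProb ν S ((j + 3) * h) ≤ 2 * e * ψ * 1 := by gcongr
    change _ ≤ P.real (T j) * _
    nlinarith
  have hsum := le_sum_exp_mul (excProb_antitone ν S) (excProb_nonneg ν S) (excProb_le_one ν S)
    hA hh n
  have htel : ∑ j ∈ Finset.range n, (Real.exp (y (j + 1)) - Real.exp (y j))
      = Real.exp (y n) - Real.exp (y 0) := Finset.sum_range_sub (fun j => Real.exp (y j)) n
  have hexp : ∑ j ∈ Finset.range n,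
      (Real.exp (y (j + 1)) - Real.exp (y j)) * excProb ν S ((j + 3) * h)
      = ∑ j ∈ Finset.range n, (Real.exp ((j + 2) * h) - Real.exp ((j + 1) * h))
        * excProb ν S ((j + 3) * h) := by
    refine Finset.sum_congr rfl fun j _ => ?_
    simp only [y]; push_cast; congr 3; ring
  have hyn' : y n = (n + 1) * h := rfl
  calc _ ≤ ∑ j ∈ Finset.range n,
          ((Real.exp (y (j + 1)) - Real.exp (y j)) * excProb ν S ((j + 3) * h)
          - e * (Real.exp (y (j + 1)) - Real.exp (y j)) - 4 * e) * ψ := by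
        rw [← Finset.sum_mul, Finset.sum_sub_distrib, Finset.sum_sub_distrib, hexp,
          ← Finset.mul_sum, htel]
        refine mul_le_mul_of_nonneg_right ?_ hψ
        simp only [Finset.sum_const, Finset.card_range, nsmul_eq_mul]
        rw [hyn']
        have h7 : excMean ν S = ∫ y in Ioi (0 : ℝ), Real.exp y * excProb ν S y := rfl
        rw [← h7] at hsum
        have h8 : 0 ≤ e * Real.exp (y 0) := by positivity
        linarith
    _ ≤ ∑ j ∈ Finset.range n, P.real (T j ∩ E) := Finset.sum_le_sum hbin
    _ = P.real (⋃ j ∈ Finset.range n, T j ∩ E) :=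
        (measureReal_biUnion_finset hdisj fun j _ => (hX measurableSet_Ioc).inter hmE).symm
    _ ≤ P.real E := measureReal_mono (iUnion₂_subset fun j _ => inter_subset_right)
        (measure_ne_top _ _)

end OneLevel

/-! ### Marginals and tails of the limit field. -/

section LimitField

variable {d : ℕ} {Ω' : Type*} [MeasurableSpace Ω'] {α : ℝ} {ρ : Space d → ℝ}
  {W : Space d → Ω' → ℝ} {Q : Measure Ω'}

/-- The law of `(W(ak))_k`, `0 ≤ kᵢ < m`. -/
noncomputable def gridLaw (W : Space d → Ω' → ℝ) (Q : Measure Ω') (a : ℝ) (m : ℕ) :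
    Measure ((Fin d → Fin m) → ℝ) :=
  Q.map fun ω k => W (gridPoint a k) ω

lemma radial_zero (hα : 0 < α) : radial α ρ 0 = 0 := by
  simp [radial, Real.zero_rpow hα.ne']

lemma IsLimitField.aemeasurable (hW : IsLimitField α ρ W Q) {u : Space d} (hu : u ∈ orthant d) :
    AEMeasurable (W u) Q := hW.gaussian.aemeasurable ⟨u, hu⟩

lemma IsLimitField.aemeasurable_grid (hW : IsLimitField α ρ W Q) {a : ℝ} (ha : 0 ≤ a) (m : ℕ) :
    AEMeasurable (fun ω (k : Fin d → Fin m) => W (gridPoint a k) ω) Q :=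
  aemeasurable_pi_lambda _ fun k => hW.aemeasurable (gridPoint_mem_orthant ha k)

lemma IsLimitField.isProbabilityMeasure_gridLaw [IsProbabilityMeasure Q]
    (hW : IsLimitField α ρ W Q) {a : ℝ} (ha : 0 ≤ a) (m : ℕ) :
    IsProbabilityMeasure (gridLaw W Q a m) :=
  Measure.isProbabilityMeasure_map (hW.aemeasurable_grid ha m)

lemma IsLimitField.excProb_gridLaw (hW : IsLimitField α ρ W Q) {a : ℝ} (ha : 0 ≤ a) {m : ℕ}
    (S : Finset (Fin d → Fin m)) (y : ℝ) :
    excProb (gridLaw W Q a m) S y = Q.real {ω | ∃ k ∈ S, y < W (gridPoint a k) ω} := by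
  rw [excProb, gridLaw, map_measureReal_apply_of_aemeasurable (hW.aemeasurable_grid ha m)
    (measurableSet_exc S y)]
  rfl

lemma IsLimitField.integral_gridLaw (hW : IsLimitField α ρ W Q) {a : ℝ} (ha : 0 ≤ a) {m : ℕ}
    (g : ((Fin d → Fin m) → ℝ) →ᵇ ℝ) :
    ∫ w, g w ∂(gridLaw W Q a m) = ∫ ω, g (fun k => W (gridPoint a k) ω) ∂Q := by
  rw [gridLaw, integral_map (hW.aemeasurable_grid ha m)
    g.continuous.measurable.aestronglyMeasurable]

lemma IsLimitField.variance (hα : 0 < α) (hW : IsLimitField α ρ W Q) {u : Space d}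
    (hu : u ∈ orthant d) : Var[W u; Q] = radial α ρ u := by
  rw [← covariance_self (hW.aemeasurable hu), hW.cov u hu u hu, sub_self, radial_zero hα]
  ring

lemma IsLimitField.radial_nonneg (hα : 0 < α) (hW : IsLimitField α ρ W Q) {u : Space d}
    (hu : u ∈ orthant d) : 0 ≤ radial α ρ u := by
  rw [← hW.variance hα hu]; exact variance_nonneg _ _

lemma IsLimitField.map_eq (hα : 0 < α) (hW : IsLimitField α ρ W Q) {u : Space d}
    (hu : u ∈ orthant d) :
    Q.map (W u) = gaussianReal (-radial α ρ u / 2) (radial α ρ u).toNNReal := by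
  have h := (hW.gaussian.hasGaussianLaw_eval ⟨u, hu⟩).map_eq_gaussianReal
  rw [hW.mean u hu, hW.variance hα hu] at h
  exact h

/-- Exponential Markov inequality with exponent 2: W(u) is normal with mean -σ/2 and variance σ, so
E e^{2W(u)} = e^σ. Exponent 1 would not make e^y P(W(u) > y) integrable. -/
lemma IsLimitField.measureReal_lt_le [IsProbabilityMeasure Q] (hα : 0 < α)
    (hW : IsLimitField α ρ W Q) {u : Space d} (hu : u ∈ orthant d) (y : ℝ) :
    Q.real {ω | y < W u ω} ≤ Real.exp (radial α ρ u) * Real.exp (-2 * y) := by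
  have hmap := hW.map_eq hα hu
  have hint : Integrable (fun ω => Real.exp (2 * W u ω)) Q := by
    have := integrable_exp_mul_gaussianReal (μ := -radial α ρ u / 2)
      (v := (radial α ρ u).toNNReal) 2
    rw [← hmap] at this
    exact (integrable_map_measure (by fun_prop) (hW.aemeasurable hu)).1 this
  have h1 := measure_ge_le_exp_mul_mgf (μ := Q) (X := W u) y (t := 2) (by norm_num) hint
  rw [mgf_gaussianReal hmap, Real.coe_toNNReal _ (hW.radial_nonneg hα hu)] at h1
  have h2 : Q.real {ω | y < W u ω} ≤ Q.real {ω | y ≤ W u ω} :=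
    measureReal_mono (fun ω (h : y < W u ω) => h.le) (measure_ne_top _ _)
  refine h2.trans (h1.trans (le_of_eq ?_))
  rw [mul_comm]
  congr 2
  ring

lemma IsLimitField.excProb_le [IsProbabilityMeasure Q] (hα : 0 < α) (hW : IsLimitField α ρ W Q)
    {a : ℝ} (ha : 0 ≤ a) {m : ℕ} (S : Finset (Fin d → Fin m)) {s : ℝ}
    (hs : ∀ k : Fin d → Fin m, radial α ρ (gridPoint a k) ≤ s) (y : ℝ) :
    excProb (gridLaw W Q a m) S y ≤ S.card * Real.exp s * Real.exp (-2 * y) := by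
  rw [hW.excProb_gridLaw ha]
  have : {ω | ∃ k ∈ S, y < W (gridPoint a k) ω} = ⋃ k ∈ S, {ω | y < W (gridPoint a k) ω} := by
    ext; simp
  rw [this]
  refine (measureReal_biUnion_finset_le _ _).trans ?_
  rw [mul_assoc, ← nsmul_eq_mul]
  refine Finset.sum_le_card_nsmul _ _ _ fun k _ => ?_
  refine (hW.measureReal_lt_le hα (gridPoint_mem_orthant ha k) y).trans ?_
  have := hs k
  gcongr

lemma IsShape.exists_radial_le {r : Space d → Space d → ℝ} {T : Set (Space d)}
    (hr : IsShape r T) (hα : 0 < α) (R : ℝ) :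
    ∃ s, 0 ≤ s ∧ ∀ t ∈ T, ∀ u : Space d, ‖u‖ ≤ R → radial α (r t) u ≤ s := by
  obtain ⟨M, hM⟩ := hr.bdd
  refine ⟨|R| ^ α * |M|, by positivity, fun t ht u hu => ?_⟩
  by_cases h0 : u = 0
  · rw [h0, radial_zero hα]; positivity
  have h1 : ‖u‖⁻¹ • u ∈ Metric.sphere (0 : Space d) 1 := by
    simp [norm_smul, h0]
  have h2 := (hM t ht _ h1).trans (le_abs_self M)
  have h3 := (hr.pos t ht _ h1).le
  have h4 : ‖u‖ ≤ |R| := hu.trans (le_abs_self R)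
  unfold radial
  gcongr

end LimitField

/-! ### Uniform asymptotics of the maximum over a fixed grid. -/

section Grid

variable {d : ℕ} {Ω : ℝ → Type*} [∀ c, MeasurableSpace (Ω c)]
  {P : (c : ℝ) → Measure (Ω c)} {X : (c : ℝ) → Space d → Ω c → ℝ}
  {T T₁ : Set (Space d)} {Δ : ℝ → ℝ}

/-- `T₁` lies in `T` together with a uniform neighbourhood. -/
def IsInner (T₁ T : Set (Space d)) : Prop :=
  ∃ η > 0, ∀ t ∈ T₁, ∀ v : Space d, ‖v‖ < η → t + v ∈ T

lemma IsInner.subset (h : IsInner T₁ T) : T₁ ⊆ T := by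
  obtain ⟨η, hη, h⟩ := h
  intro t ht
  simpa using h t ht 0 (by simpa using hη)

lemma IsInner.eventually_add_mem (h : IsInner T₁ T) (hΔ0 : Tendsto Δ atTop (𝓝 0)) (R : ℝ) :
    ∀ᶠ c in atTop, ∀ t ∈ T₁, ∀ u : Space d, ‖u‖ ≤ R → t + Δ c • u ∈ T := by
  obtain ⟨η, hη, h⟩ := h
  have h1 : Tendsto (fun c => |Δ c| * |R|) atTop (𝓝 0) := by
    simpa using hΔ0.abs.mul_const |R|
  filter_upwards [h1.eventually (gt_mem_nhds hη)] with c hc t ht u hu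
  refine h t ht _ ?_
  rw [norm_smul, Real.norm_eq_abs]
  refine lt_of_le_of_lt ?_ hc
  have : ‖u‖ ≤ |R| := hu.trans (le_abs_self R)
  gcongr

lemma CondA1.eventually_abs_sub_le (hA1 : CondA1 X P T) {M ε : ℝ} (hM : 0 < M) (hε : 0 < ε) :
    ∀ᶠ c in atTop, ∀ t ∈ T, ∀ y ∈ Ioc (0 : ℝ) M,
      |(P c).real {ω | c - y / c < X c t ω} - Real.exp y * psi c| ≤ ε * psi c := by
  -- The relative error of (A1) is scaled by the largest value that ψ(c - y/c)/ψ(c) can take up to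
  -- ε/2, so that it becomes an absolute multiple of ψ(c).
  have he : 0 < ε / 2 / (Real.exp M + ε / 2) := by positivity
  filter_upwards [hA1 M hM _ he, eventually_abs_psi_sub_le M (half_pos hε),
    eventually_gt_atTop 0] with c h1 h2 hc t ht y hy
  have a1 := h1 t ht y hy
  have a2 := h2 y ⟨hy.1.le, hy.2⟩
  have hψ := psi_pos hc
  have h3 : psi (c - y / c) ≤ (Real.exp M + ε / 2) * psi c := by
    have h5 := (abs_le.1 a2).2
    have h4 : Real.exp y * psi c ≤ Real.exp M * psi c := by
      have := Real.exp_le_exp.2 hy.2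
      gcongr
    linarith
  have h4 : ε / 2 / (Real.exp M + ε / 2) * psi (c - y / c) ≤ ε / 2 * psi c := by
    calc _ ≤ ε / 2 / (Real.exp M + ε / 2) * ((Real.exp M + ε / 2) * psi c) := by gcongr
      _ = _ := by field_simp
  calc _ ≤ |(P c).real {ω | c - y / c < X c t ω} - psi (c - y / c)|
        + |psi (c - y / c) - Real.exp y * psi c| := abs_sub_le _ _ _
    _ ≤ ε * psi c := by linarith

end Grid

section Grid

variable {d : ℕ} {Ω : ℝ → Type*} [∀ c, MeasurableSpace (Ω c)]
  {P : (c : ℝ) → Measure (Ω c)}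
  {X : (c : ℝ) → Space d → Ω c → ℝ}
  {Ω' : Space d → Type*} [∀ t, MeasurableSpace (Ω' t)]
  {Q : (t : Space d) → Measure (Ω' t)}
  {W : (t : Space d) → Space d → Ω' t → ℝ}
  {T T₁ : Set (Space d)} {α : ℝ} {Δ : ℝ → ℝ} {r : Space d → Space d → ℝ}

lemma CondA2.eventually_ramp (hA2 : CondA2 X P T Δ W Q) (hΔ0 : Tendsto Δ atTop (𝓝 0))
    (hT : IsInner T₁ T) (hW : ∀ t ∈ T, IsLimitField α (r t) (W t) (Q t))
    {a : ℝ} (ha : 0 < a) {m : ℕ} (hm : 0 < m) (S : Finset (Fin d → Fin m)) (hS : S.Nonempty)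
    (z h : ℝ) {M e : ℝ} (hM : 0 < M) (he : 0 < e) :
    ∀ᶠ c in atTop, ∀ t ∈ T₁, ∀ᵐ ω ∂(P c), X c t ω ∈ Ico (c - M / c) c →
      |((P c)[fun ω' => ramp S hS z h (fun k =>
          c * (X c (t + Δ c • gridPoint a k) ω' - X c t ω')) |
          MeasurableSpace.comap (X c t) inferInstance]) ω
        - ∫ w, ramp S hS z h w ∂(gridLaw (W t) (Q t) a m)| ≤ e := by
  filter_upwards [hA2 a ha m hm (ramp S hS z h) M hM e he,
    hT.eventually_add_mem hΔ0 (d * (a * m))] with c h1 h2 t ht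
  rw [(hW t (hT.subset ht)).integral_gridLaw ha.le]
  exact h1 t (hT.subset ht) fun k => h2 t ht _ (norm_gridPoint_le ha.le k)

variable [∀ t, IsProbabilityMeasure (Q t)]

/-- The tail of the excursion probabilities, uniformly over the base point. -/
lemma exists_excProb_le (hα : 0 < α) (hr : IsShape r T)
    (hW : ∀ t ∈ T, IsLimitField α (r t) (W t) (Q t)) {a : ℝ} (ha : 0 < a) (m : ℕ) :
    ∃ A, 0 ≤ A ∧ ∀ t ∈ T, ∀ (S : Finset (Fin d → Fin m)) (y : ℝ),
      excProb (gridLaw (W t) (Q t) a m) S y ≤ A * Real.exp (-2 * y) := by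
  obtain ⟨s, hs0, hs⟩ := hr.exists_radial_le hα (d * (a * m))
  refine ⟨Fintype.card (Fin d → Fin m) * Real.exp s, by positivity, fun t ht S y => ?_⟩
  refine ((hW t ht).excProb_le hα ha.le S
    (fun k => hs t ht _ (norm_gridPoint_le ha.le k)) y).trans ?_
  have := S.card_le_univ
  gcongr

lemma excMean_nonneg {ι : Type*} (ν : Measure (ι → ℝ)) (S : Finset ι) : 0 ≤ excMean ν S :=
  integral_nonneg fun y => mul_nonneg (Real.exp_pos _).le (excProb_nonneg ν S y)

lemma excMean_le {ι : Type*} {ν : Measure (ι → ℝ)} [IsProbabilityMeasure ν] {S : Finset ι}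
    {A : ℝ} (hA : ∀ y, 0 ≤ y → excProb ν S y ≤ A * Real.exp (-2 * y)) : excMean ν S ≤ A := by
  have := setIntegral_exp_mul_le (excProb_antitone ν S) (excProb_nonneg ν S) hA le_rfl
  simpa [excMean] using this

variable [∀ c, IsProbabilityMeasure (P c)]

lemma CondA3.eventually_tail (hA3 : CondA3 X P T Δ) (hΔ0 : Tendsto Δ atTop (𝓝 0))
    (hT : IsInner T₁ T) {a : ℝ} (ha : 0 < a) {m : ℕ} (S : Finset (Fin d → Fin m))
    {γ : ℝ} (hγ : 0 ≤ γ) {e : ℝ} (he : 0 < e) :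
    ∃ M₀, ∀ M ≥ M₀, ∀ᶠ c in atTop, ∀ t ∈ T₁,
      (P c).real {ω | ∃ k ∈ S, c - γ / c < X c (t + Δ c • gridPoint a k) ω ∧
        X c t ω ≤ c - M / c} ≤ e * psi c := by
  -- (A3) needs a positive depth, whereas γ = 0 is allowed here; γ + 1 enlarges the event and is
  -- harmless.
  choose h hpos hlim hbd using fun k : Fin d → Fin m =>
    hA3 (gridPoint a k) (gridPoint_mem_orthant ha.le k) (γ + 1) (by positivity)
  have h1 : Tendsto (fun y => ∑ k ∈ S, h k y) atTop (𝓝 0) := by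
    simpa using tendsto_finsetSum S fun k _ => hlim k
  obtain ⟨M₀, hM₀⟩ := (h1.eventually (gt_mem_nhds he)).exists_forall_of_atTop
  refine ⟨max M₀ 1, fun M hM => ?_⟩
  have hM1 : 0 < M := lt_of_lt_of_le one_pos ((le_max_right _ _).trans hM)
  filter_upwards [(Finset.eventually_all S).2 fun k _ => hbd k M hM1,
    hT.eventually_add_mem hΔ0 (d * (a * m)), eventually_gt_atTop 0] with c h2 h3 hc t ht
  have hsub : {ω | ∃ k ∈ S, c - γ / c < X c (t + Δ c • gridPoint a k) ω ∧ X c t ω ≤ c - M / c}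
      ⊆ ⋃ k ∈ S, {ω | c - (γ + 1) / c < X c (t + Δ c • gridPoint a k) ω ∧
        X c t ω ≤ c - M / c} := by
    rintro ω ⟨k, hk, h4, h5⟩
    simp only [mem_iUnion]
    refine ⟨k, hk, lt_of_le_of_lt ?_ h4, h5⟩
    gcongr
    linarith
  refine (measureReal_mono hsub (measure_ne_top _ _)).trans
    ((measureReal_biUnion_finset_le _ _).trans ?_)
  calc _ ≤ ∑ k ∈ S, h k M * psi c := Finset.sum_le_sum fun k hk =>
        h2 k hk t (hT.subset ht) (h3 t ht _ (norm_gridPoint_le ha.le k))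
    _ = (∑ k ∈ S, h k M) * psi c := by rw [Finset.sum_mul]
    _ ≤ e * psi c := by
        have := (hM₀ M ((le_max_left _ _).trans hM)).le
        have := psi_pos hc
        gcongr

/-- Asymptotic upper bound for the exceedance probability of the maximum over a grid. -/
lemma eventually_grid_le (hα : 0 < α) (hr : IsShape r T)
    (hW : ∀ t ∈ T, IsLimitField α (r t) (W t) (Q t)) (hX : Standardized X P T)
    (hA1 : CondA1 X P T) (hA2 : CondA2 X P T Δ W Q) (hA3 : CondA3 X P T Δ)
    (hΔ0 : Tendsto Δ atTop (𝓝 0)) (hT : IsInner T₁ T) {a : ℝ} (ha : 0 < a) {m : ℕ} (hm : 0 < m)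
    (S : Finset (Fin d → Fin m)) (hS : S.Nonempty) {γ : ℝ} (hγ : 0 ≤ γ) {ε : ℝ} (hε : 0 < ε) :
    ∀ᶠ c in atTop, ∀ t ∈ T₁,
      (P c).real {ω | ∃ k ∈ S, c - γ / c < X c (t + Δ c • gridPoint a k) ω}
        ≤ (Real.exp γ * (1 + excMean (gridLaw (W t) (Q t) a m) S) + ε) * psi c := by
  obtain ⟨A, hA0, hA⟩ := exists_excProb_le hα hr hW ha m
  -- The order of choices matters: first the mesh `h`, then the number `n` of bins from the tail
  -- condition, and last the tolerance `e`, which has to beat the constant `C` of all n bins.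
  obtain ⟨h, hh, hh'⟩ : ∃ h > 0, (Real.exp (γ + 2 * h) - Real.exp γ) * (1 + A) < ε / 3 := by
    have : Tendsto (fun h : ℝ => (Real.exp (γ + 2 * h) - Real.exp γ) * (1 + A)) (𝓝[>] 0)
        (𝓝 0) := by
      have : Continuous fun h : ℝ => (Real.exp (γ + 2 * h) - Real.exp γ) * (1 + A) := by fun_prop
      have := this.tendsto 0
      simp only [mul_zero, add_zero, sub_self, zero_mul] at this
      exact this.mono_left nhdsWithin_le_nhds
    obtain ⟨h, h1, h2⟩ := ((this.eventually (gt_mem_nhds (by positivity : 0 < ε / 3))).and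
      self_mem_nhdsWithin).exists
    exact ⟨h, h2, h1⟩
  obtain ⟨M₀, hM₀⟩ := hA3.eventually_tail hΔ0 hT ha S hγ (show 0 < ε / 3 by positivity)
  obtain ⟨n, hn⟩ : ∃ n : ℕ, M₀ ≤ γ + (n + 1) * h := by
    obtain ⟨n, hn⟩ := exists_nat_ge (M₀ / h)
    refine ⟨n, ?_⟩
    rw [div_le_iff₀ hh] at hn
    nlinarith
  set M := γ + (n + 1) * h with hM
  have hM0 : 0 < M := by positivity
  set C := 1 + 4 * (n : ℝ) + Real.exp M with hC
  have hC0 : 0 < C := by positivity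
  set e := min 1 (ε / 3 / C) with he
  have he0 : 0 < e := by positivity
  have heC : e * C ≤ ε / 3 := by
    have : e ≤ ε / 3 / C := min_le_right _ _
    rwa [le_div_iff₀ hC0] at this
  filter_upwards [hX, hM₀ M hn, hA1.eventually_abs_sub_le hM0 he0,
    (Finset.eventually_all (Finset.range n)).2 fun j _ => hA2.eventually_ramp hΔ0 hT hW ha hm S hS
      ((j + 1) * h) h hM0 he0, eventually_gt_atTop 0, hT.eventually_add_mem hΔ0 (d * (a * m))]
    with c h1 h2 h3 h4 hc h5 t ht
  have htT := hT.subset ht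
  have := (hW t htT).isProbabilityMeasure_gridLaw ha.le m
  have key := measureReal_exists_lt_le (P := P c) (X := X c t)
    (Z := fun k => X c (t + Δ c • gridPoint a k)) (hS := hS) (n := n) (h := h) (e := e)
    (e' := ε / 3) (h1 t htT).1
    (fun k => (h1 _ (h5 t ht _ (norm_gridPoint_le ha.le k))).1) hc (psi_pos hc).le hγ hh he0.le
    (min_le_left _ _) (fun y _ => hA t htT S y) (h3 t htT) (fun j hj => h4 j hj t ht) (h2 t ht)
  refine key.trans (mul_le_mul_of_nonneg_right ?_ (psi_pos hc).le)
  have hΦ := excMean_le (fun y _ => hA t htT S y)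
  have h6 : (Real.exp (γ + 2 * h) - Real.exp γ) * (1 + excMean (gridLaw (W t) (Q t) a m) S)
      ≤ (Real.exp (γ + 2 * h) - Real.exp γ) * (1 + A) := by
    have : Real.exp γ ≤ Real.exp (γ + 2 * h) := Real.exp_le_exp.2 (by linarith)
    refine mul_le_mul_of_nonneg_left (by linarith) (by linarith)
  linarith

/-- Asymptotic lower bound for the exceedance probability of the maximum over a grid. -/
lemma eventually_le_grid (hα : 0 < α) (hr : IsShape r T)
    (hW : ∀ t ∈ T, IsLimitField α (r t) (W t) (Q t)) (hX : Standardized X P T)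
    (hA1 : CondA1 X P T) (hA2 : CondA2 X P T Δ W Q)
    (hΔ0 : Tendsto Δ atTop (𝓝 0)) (hT : IsInner T₁ T) {a : ℝ} (ha : 0 < a) {m : ℕ} (hm : 0 < m)
    (S : Finset (Fin d → Fin m)) (hS : S.Nonempty) {ε : ℝ} (hε : 0 < ε) :
    ∀ᶠ c in atTop, ∀ t ∈ T₁,
      (excMean (gridLaw (W t) (Q t) a m) S - ε) * psi c
        ≤ (P c).real {ω | ∃ k ∈ S, c < X c (t + Δ c • gridPoint a k) ω} := by
  obtain ⟨A, hA0, hA⟩ := exists_excProb_le hα hr hW ha m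
  obtain ⟨h, hh, hh'⟩ : ∃ h > 0, (1 - Real.exp (-2 * h)) * A + (Real.exp (3 * h) - 1) < ε / 3 := by
    have : Tendsto (fun h : ℝ => (1 - Real.exp (-2 * h)) * A + (Real.exp (3 * h) - 1)) (𝓝[>] 0)
        (𝓝 0) := by
      have : Continuous fun h : ℝ => (1 - Real.exp (-2 * h)) * A + (Real.exp (3 * h) - 1) := by
        fun_prop
      have := this.tendsto 0
      simp only [mul_zero, Real.exp_zero, sub_self, zero_mul, add_zero] at this
      exact this.mono_left nhdsWithin_le_nhds
    obtain ⟨h, h1, h2⟩ := ((this.eventually (gt_mem_nhds (by positivity : 0 < ε / 3))).and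
      self_mem_nhdsWithin).exists
    exact ⟨h, h2, h1⟩
  -- Here the number of bins is dictated by the tail of the limit law alone, since dropping deep
  -- starting points only decreases the probability.
  obtain ⟨n, hn⟩ : ∃ n : ℕ, A * Real.exp (-((n + 3) * h)) < ε / 3 := by
    have h1 : Tendsto (fun n : ℕ => ((n : ℝ) + 3) * h) atTop atTop :=
      (tendsto_atTop_add_const_right _ _ tendsto_natCast_atTop_atTop).atTop_mul_const hh
    have h2 : Tendsto (fun n : ℕ => A * Real.exp (-((n + 3) * h))) atTop (𝓝 0) := by
      simpa using (Real.tendsto_exp_neg_atTop_nhds_zero.comp h1).const_mul A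
    exact (h2.eventually (gt_mem_nhds (by positivity : 0 < ε / 3))).exists
  set M := (n + 1) * h with hM
  have hM0 : 0 < M := by positivity
  set C := 4 * (n : ℝ) + Real.exp M with hC
  have hC0 : 0 < C := by positivity
  set e := min 1 (ε / 3 / C) with he
  have he0 : 0 < e := by positivity
  have heC : e * C ≤ ε / 3 := by
    have : e ≤ ε / 3 / C := min_le_right _ _
    rwa [le_div_iff₀ hC0] at this
  filter_upwards [hX, hA1.eventually_abs_sub_le hM0 he0,
    (Finset.eventually_all (Finset.range n)).2 fun j _ => hA2.eventually_ramp hΔ0 hT hW ha hm S hS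
      ((j + 3) * h) h hM0 he0, eventually_gt_atTop 0, hT.eventually_add_mem hΔ0 (d * (a * m))]
    with c h1 h3 h4 hc h5 t ht
  have htT := hT.subset ht
  have := (hW t htT).isProbabilityMeasure_gridLaw ha.le m
  have key := le_measureReal_exists_lt (P := P c) (X := X c t)
    (Z := fun k => X c (t + Δ c • gridPoint a k)) (hS := hS) (n := n) (h := h) (e := e)
    (h1 t htT).1
    (fun k => (h1 _ (h5 t ht _ (norm_gridPoint_le ha.le k))).1) hc (psi_pos hc).le hh he0.le
    (min_le_left _ _) (fun y _ => hA t htT S y) (h3 t htT) (fun j hj => h4 j hj t ht)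
  refine le_trans (mul_le_mul_of_nonneg_right ?_ (psi_pos hc).le) key
  have hΦ := excMean_le (fun y _ => hA t htT S y)
  have hΦ0 := excMean_nonneg (gridLaw (W t) (Q t) a m) S
  have he2 : Real.exp (-2 * h) ≤ 1 := Real.exp_le_one_iff.2 (by linarith)
  have h6 : (1 - Real.exp (-2 * h)) * excMean (gridLaw (W t) (Q t) a m) S
      ≤ (1 - Real.exp (-2 * h)) * A := mul_le_mul_of_nonneg_left hΦ (by linarith)
  have h7 : Real.exp (-2 * h) * ((Real.exp (3 * h) - 1) + A * Real.exp (-((n + 3) * h)))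
      ≤ (Real.exp (3 * h) - 1) + A * Real.exp (-((n + 3) * h)) := by
    refine mul_le_of_le_one_left ?_ he2
    have := Real.one_le_exp (show 0 ≤ 3 * h by positivity)
    positivity [sub_nonneg.2 this]
  linarith

end Grid

/-! ### Consequences of (A4) and (A5) for small cells and for pairs of points. -/

section Cells

variable {d : ℕ} {Ω : ℝ → Type*} [∀ c, MeasurableSpace (Ω c)]
  {P : (c : ℝ) → Measure (Ω c)} {X : (c : ℝ) → Space d → Ω c → ℝ}
  {T T₁ : Set (Space d)} {Δ : ℝ → ℝ}

/-- The pair condition with an explicit stretched exponential rate, whose exponent may be any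
positive real number. -/
def HasPairBound (X : (c : ℝ) → Space d → Ω c → ℝ) (P : (c : ℝ) → Measure (Ω c))
    (T : Set (Space d)) (Δ : ℝ → ℝ) : Prop :=
  ∃ p : ℝ, 0 < p ∧ ∃ C : ℝ, 0 < C ∧ ∀ᶠ c in atTop, ∀ γ ∈ Ioc (0 : ℝ) c, ∀ t ∈ T, ∀ u : Space d,
    t + Δ c • u ∈ T →
    (P c).real {ω | c - γ / c < X c t ω ∧ c - γ / c < X c (t + Δ c • u) ω}
      ≤ C * Real.exp (γ - ‖u‖ ^ p) * psi c

/-- Monotonicity of f extends the stretched exponential bound from large arguments to all arguments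
at the cost of a constant, and ψ(c - γ/c) ≤ 2e^γ ψ(c) in the range γ ≤ c. -/
lemma CondA5.hasPairBound (hA5 : CondA5 X P T Δ) : HasPairBound X P T Δ := by
  obtain ⟨f, hanti, hpos, ⟨n, hn, hO⟩, hbd⟩ := hA5
  obtain ⟨p, hp, hO⟩ : ∃ p : ℝ, 0 < p ∧ f =O[atTop] fun x : ℝ => Real.exp (-x ^ p) :=
    ⟨n, by exact_mod_cast hn, by simpa only [Real.rpow_natCast] using hO⟩
  obtain ⟨C₀, hC₀, hO⟩ := hO.exists_pos
  obtain ⟨x₀, hx₀⟩ := hO.bound.exists_forall_of_atTop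
  set C := C₀ + f 0 * Real.exp ((max x₀ 0) ^ p) with hC
  have hf0 : 0 < f 0 := hpos 0 le_rfl
  have hf : ∀ x, 0 ≤ x → f x ≤ C * Real.exp (-x ^ p) := by
    intro x hx
    rcases le_total (max x₀ 0) x with h | h
    · have h1 := hx₀ x ((le_max_left _ _).trans h)
      rw [Real.norm_eq_abs, Real.norm_eq_abs, abs_of_pos (Real.exp_pos _),
        abs_of_pos (hpos x hx)] at h1
      refine h1.trans ?_
      have : 0 < f 0 * Real.exp ((max x₀ 0) ^ p) := by positivity
      gcongr
      linarith
    · have h1 : f x ≤ f 0 := hanti (mem_Ici.2 le_rfl) hx hx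
      have h2 : 1 ≤ Real.exp ((max x₀ 0) ^ p) * Real.exp (-x ^ p) := by
        rw [← Real.exp_add]
        apply Real.one_le_exp
        have : x ^ p ≤ (max x₀ 0) ^ p := by gcongr
        linarith
      calc f x ≤ f 0 * 1 := by linarith
        _ ≤ f 0 * (Real.exp ((max x₀ 0) ^ p) * Real.exp (-x ^ p)) := by gcongr
        _ = f 0 * Real.exp ((max x₀ 0) ^ p) * Real.exp (-x ^ p) := by ring
        _ ≤ C * Real.exp (-x ^ p) := by
            gcongr
            linarith
  refine ⟨p, hp, 2 * C, by positivity, ?_⟩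
  filter_upwards [hbd, eventually_ge_atTop 2] with c h1 hc γ hγ t ht u hu
  have hψ := psi_pos (show 0 < c by linarith)
  calc _ ≤ psi (c - γ / c) * f ‖u‖ := h1 γ hγ t ht u hu
    _ ≤ (2 * Real.exp γ * psi c) * (C * Real.exp (-‖u‖ ^ p)) := by
        have := psi_sub_div_le hc hγ.2
        have := hf ‖u‖ (norm_nonneg u)
        have := (hpos ‖u‖ (norm_nonneg u)).le
        gcongr
    _ = _ := by rw [sub_eq_add_neg, Real.exp_add]; ring

/-- The conditions on one- and two-dimensional distributions force the domain to be bounded. -/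
lemma exists_norm_le_of_cond [∀ c, IsProbabilityMeasure (P c)] (hX : Standardized X P T)
    (hA1 : CondA1 X P T) (hA5 : HasPairBound X P T Δ) (hΔ : ∀ᶠ c in atTop, 0 < Δ c) :
    ∃ R, ∀ t ∈ T, ‖t‖ ≤ R := by
  by_contra! hcon
  obtain ⟨p, hp, C, hC, h5⟩ := hA5
  obtain ⟨c, h5, h1, hX, hΔ, hc⟩ := (h5.and ((hA1.eventually_abs_sub_le one_pos one_pos).and
    (hX.and (hΔ.and (eventually_ge_atTop 2))))).exists
  have hψ := psi_pos (show 0 < c by linarith)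
  -- For one fixed c: in an unbounded domain there are n points at mutual distance at least RΔ_c.
  -- Each exceeds c - 1/c with probability at least ψ(c), because e - 1 ≥ 1, and all pair terms
  -- together stay below 1. Bonferroni then gives nψ(c) < 2, against the choice of n.
  obtain ⟨n, hn⟩ := exists_nat_gt (2 / psi c)
  rw [div_lt_iff₀ hψ] at hn
  obtain ⟨R, hR0, hR⟩ : ∃ R > 0, n * (n * (C * Real.exp (1 - R ^ p) * psi c)) < 1 := by
    have h2 : Tendsto (fun R : ℝ => n * (n * (C * Real.exp (1 - R ^ p) * psi c))) atTop (𝓝 0) := by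
      have : Tendsto (fun R : ℝ => Real.exp (1 - R ^ p)) atTop (𝓝 0) :=
        Real.tendsto_exp_atBot.comp
          (tendsto_atBot_add_const_left _ 1 (tendsto_neg_atTop_atBot.comp (tendsto_rpow_atTop hp)))
      simpa using (((this.const_mul C).mul_const (psi c)).const_mul (n : ℝ)).const_mul (n : ℝ)
    obtain ⟨R, hR1, hR2⟩ := ((h2.eventually (gt_mem_nhds one_pos)).and
      (eventually_gt_atTop 0)).exists
    exact ⟨R, hR2, hR1⟩
  choose g hgT hg using hcon
  -- The points are picked greedily, each norm exceeding the previous one by `R * Δ c`.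
  let x : ℕ → Space d := fun k => Nat.rec (g 0) (fun _ y => g (‖y‖ + R * Δ c)) k
  have hxT : ∀ k, x k ∈ T := by
    intro k; cases k <;> exact hgT _
  have hxstep : ∀ k, ‖x k‖ + R * Δ c ≤ ‖x (k + 1)‖ := fun k => (hg _).le
  have hRΔ : 0 < R * Δ c := by positivity
  have hxlt : ∀ i j, i < j → ‖x i‖ + R * Δ c ≤ ‖x j‖ := by
    intro i j hij
    induction j, hij using Nat.le_induction with
    | base => exact hxstep i
    | succ j _ ih => linarith [hxstep j]
  have hfar : ∀ i j, i ≠ j → R * Δ c ≤ ‖x j - x i‖ := by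
    intro i j hij
    rcases lt_or_gt_of_ne hij with h | h
    · linarith [hxlt i j h, norm_sub_norm_le (x j) (x i)]
    · have := norm_sub_norm_le (x i) (x j)
      rw [norm_sub_rev] at this
      linarith [hxlt j i h]
  let A : ℕ → Set (Ω c) := fun i => {ω | c - 1 / c < X c (x i) ω}
  have hB := sum_measureReal_le_pairs (P c) (Finset.range n) A
    fun i _ => measurableSet_lt measurable_const (hX _ (hxT i)).1
  have hlow : ∀ i, psi c ≤ (P c).real (A i) := by
    intro i
    have := (abs_le.1 (h1 _ (hxT i) 1 ⟨one_pos, le_rfl⟩)).1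
    have h2 : 2 * psi c ≤ Real.exp 1 * psi c := by
      have := Real.add_one_le_exp 1
      gcongr
      linarith
    change psi c ≤ (P c).real {ω | c - 1 / c < X c (x i) ω}
    linarith
  have hpair : ∀ i j, j ≠ i → (P c).real (A i ∩ A j) ≤ C * Real.exp (1 - R ^ p) * psi c := by
    intro i j hij
    have hu : x i + Δ c • ((Δ c)⁻¹ • (x j - x i)) = x j := by
      rw [smul_smul, mul_inv_cancel₀ hΔ.ne', one_smul]; abel
    have := h5 1 ⟨one_pos, by linarith⟩ (x i) (hxT i) ((Δ c)⁻¹ • (x j - x i))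
      (by rw [hu]; exact hxT j)
    rw [hu] at this
    refine this.trans ?_
    have hnorm : R ≤ ‖(Δ c)⁻¹ • (x j - x i)‖ := by
      rw [norm_smul, norm_inv, Real.norm_eq_abs, abs_of_pos hΔ, inv_mul_eq_div, le_div_iff₀ hΔ]
      exact hfar i j hij.symm
    gcongr
  have hs1 : n * psi c ≤ ∑ i ∈ Finset.range n, (P c).real (A i) := by
    have := Finset.card_nsmul_le_sum (Finset.range n) _ _ fun i _ => hlow i
    simpa using this
  have hs2 : ∑ i ∈ Finset.range n, ∑ j ∈ (Finset.range n).erase i, (P c).real (A i ∩ A j)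
      ≤ n * (n * (C * Real.exp (1 - R ^ p) * psi c)) := by
    have hb : 0 ≤ C * Real.exp (1 - R ^ p) * psi c := by positivity
    have : ∀ i ∈ Finset.range n, ∑ j ∈ (Finset.range n).erase i, (P c).real (A i ∩ A j)
        ≤ n * (C * Real.exp (1 - R ^ p) * psi c) := by
      intro i _
      have := Finset.sum_le_card_nsmul ((Finset.range n).erase i) _ _
        fun j hj => hpair i j (Finset.ne_of_mem_erase hj)
      refine this.trans ?_
      rw [nsmul_eq_mul]
      have hcard : (((Finset.range n).erase i).card : ℝ) ≤ n := by
        have := Finset.card_le_card (Finset.erase_subset i (Finset.range n))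
        rw [Finset.card_range] at this
        exact_mod_cast this
      gcongr
    have := Finset.sum_le_card_nsmul (Finset.range n) _ _ this
    simpa using this
  have h3 : (P c).real (⋃ i ∈ Finset.range n, A i) ≤ 1 := measureReal_le_one
  linarith

/-- The event that the field exceeds the level `c` in the closed cell `τ + Δ [0, a]^d`. -/
def cellExc (X : (c : ℝ) → Space d → Ω c → ℝ) (T : Set (Space d)) (Δ : ℝ → ℝ) (a c : ℝ)
    (τ : Space d) : Set (Ω c) :=
  {ω | ∃ w ∈ closedBox d a, τ + Δ c • w ∈ T ∧ c < X c (τ + Δ c • w) ω}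

/-- The small-cell condition, with the asymptotics of `N_a(γ_a)` for small `a`. -/
lemma CondA4.exists_small (hA4 : CondA4 X P T Δ) (hTne : T.Nonempty) {ε : ℝ} (hε : 0 < ε) :
    ∃ a₀ > 0, ∀ a, 0 < a → a < a₀ → ∃ g, 0 < g ∧ g < ε ∧ ∀ᶠ c in atTop, ∀ t ∈ T,
      (P c).real {ω | ω ∈ cellExc X T Δ a c t ∧ X c t ω ≤ c - g / c} ≤ ε * a ^ d * psi c := by
  obtain ⟨N, g, hanti, hg0, hglim, hN, hbd⟩ := hA4
  obtain ⟨hint, hO⟩ := hN 1 one_pos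
  have h1 := hO.bound hε
  have h2 := hglim.eventually (gt_mem_nhds hε)
  have h3 := hint.and (h1.and h2)
  rw [eventually_nhdsWithin_iff, Metric.eventually_nhds_iff] at h3
  obtain ⟨a₀, ha₀, h3⟩ := h3
  refine ⟨a₀, ha₀, fun a ha haa => ?_⟩
  obtain ⟨i1, i2, i3⟩ := h3 (y := a) (by simpa [abs_of_pos ha] using haa) ha
  refine ⟨g a, hg0 a ha, i3, ?_⟩
  obtain ⟨t₀, ht₀⟩ := hTne
  -- `N a γ` dominates a probability at some large c, hence is nonnegative; this is where a point of
  -- the domain is needed. The integral can then be dropped from the o(a^d) condition.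
  have hnn : ∀ γ, g a ≤ γ → 0 ≤ N a γ := by
    intro γ hγ
    obtain ⟨c, h4, h5, h6⟩ := ((hbd a ha).and ((eventually_ge_atTop γ).and
      (eventually_gt_atTop 0))).exists
    have h7 := measureReal_nonneg.trans (h4 t₀ ht₀ γ ⟨hγ, h5⟩)
    exact nonneg_of_mul_nonneg_left h7 (psi_pos h6)
  have hint0 : 0 ≤ ∫ x in Ioi (1 : ℝ), x ^ (1 : ℝ) * N a (g a + x) := by
    refine setIntegral_nonneg measurableSet_Ioi fun x hx => ?_
    have hx : (1 : ℝ) < x := hx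
    have := hnn (g a + x) (by linarith)
    positivity
  have hNle : N a (g a) ≤ ε * a ^ d := by
    rw [Real.norm_eq_abs, Real.norm_eq_abs, abs_of_nonneg (by positivity : (0 : ℝ) ≤ a ^ d)] at i2
    linarith [le_abs_self (N a (g a) + ∫ x in Ioi (1 : ℝ), x ^ (1 : ℝ) * N a (g a + x))]
  filter_upwards [hbd a ha, eventually_ge_atTop (g a), eventually_gt_atTop 0] with c h4 h5 h6 t ht
  refine (h4 t ht (g a) ⟨le_rfl, h5⟩).trans ?_
  have := psi_pos h6
  gcongr

/-- The small-cell condition for one fixed cell size, with a polynomial rate. -/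
lemma CondA4.exists_pow_bound (hA4 : CondA4 X P T Δ) (hTne : T.Nonempty) (M : ℕ) (hM : 0 < M) :
    ∃ a > 0, ∃ g > 0, ∃ C > 0, ∀ᶠ c in atTop, ∀ t ∈ T,
      (P c).real {ω | ω ∈ cellExc X T Δ a c t ∧ X c t ω ≤ c - g / c} ≤ C * psi c ∧
      ∀ x > 0, g + x ≤ c →
        (P c).real {ω | ω ∈ cellExc X T Δ a c t ∧ X c t ω ≤ c - (g + x) / c}
          ≤ C * (x ^ M)⁻¹ * psi c := by
  obtain ⟨N, g, hanti, hg0, hglim, hN, hbd⟩ := hA4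
  obtain ⟨hint, -⟩ := hN M (by exact_mod_cast hM)
  obtain ⟨a, hint, ha⟩ := (hint.and self_mem_nhdsWithin).exists
  have ha : 0 < a := ha
  obtain ⟨t₀, ht₀⟩ := hTne
  have hnn : ∀ γ, g a ≤ γ → 0 ≤ N a γ := by
    intro γ hγ
    obtain ⟨c, h4, h5, h6⟩ := ((hbd a ha).and ((eventually_ge_atTop γ).and
      (eventually_gt_atTop 0))).exists
    have h7 := measureReal_nonneg.trans (h4 t₀ ht₀ γ ⟨hγ, h5⟩)
    exact nonneg_of_mul_nonneg_left h7 (psi_pos h6)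
  set I := ∫ x in Ioi (1 : ℝ), x ^ (M : ℝ) * N a (g a + x) with hI
  have hnn' : ∀ x ∈ Ioi (1 : ℝ), 0 ≤ x ^ (M : ℝ) * N a (g a + x) := by
    intro x hx
    have hx : (1 : ℝ) < x := hx
    have := hnn (g a + x) (by linarith)
    positivity
  have hI0 : 0 ≤ I := setIntegral_nonneg measurableSet_Ioi hnn'
  have hmono : ∀ x y, 0 ≤ x → x ≤ y → N a (g a + y) ≤ N a (g a + x) := fun x y hx hxy =>
    hanti a ha (by have := hg0 a ha; simp only [mem_Ioi]; linarith)
      (by have := hg0 a ha; simp only [mem_Ioi]; linarith) (by linarith)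
  have hNg := hnn (g a) le_rfl
  set C := (I + N a (g a) + 1) * 2 ^ M with hC
  have hC1 : N a (g a) + 1 ≤ C := by
    have : (1 : ℝ) ≤ 2 ^ M := one_le_pow₀ (by norm_num)
    nlinarith
  -- For x ≥ 2 the moment integral over (x/2, x] is at least (x/2)^M N(g + x), by monotonicity of N
  -- and because the interval has length at least 1. For x ≤ 2 monotonicity alone suffices.
  have hdecay : ∀ x > 0, N a (g a + x) ≤ C * (x ^ M)⁻¹ := by
    intro x hx
    have hpow : (2 : ℝ) ^ M * (x ^ M)⁻¹ = (2 / x) ^ M := by rw [div_pow, div_eq_mul_inv]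
    rw [hC, mul_assoc, hpow]
    rcases le_total x 2 with h | h
    · have h1 : N a (g a + x) ≤ N a (g a) := by simpa using hmono 0 x le_rfl hx.le
      have h2 : 1 ≤ (2 / x) ^ M := one_le_pow₀ (by rwa [one_le_div hx])
      nlinarith
    · have h1 : ∫ y in Ioc (x / 2) x, (x / 2) ^ M * N a (g a + x) ≤ I := by
        calc _ ≤ ∫ y in Ioc (x / 2) x, y ^ (M : ℝ) * N a (g a + y) := by
              refine setIntegral_mono_on (integrable_const _) (hint.mono_set fun y hy => ?_)
                measurableSet_Ioc fun y hy => ?_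
              · simp only [mem_Ioi]; linarith [hy.1]
              · have h3 := hmono y x (by linarith [hy.1]) hy.2
                have h4 := hnn (g a + x) (by linarith)
                rw [Real.rpow_natCast]
                have h5 := hy.1.le
                have h6 : 0 ≤ y := by linarith
                gcongr
          _ ≤ I := setIntegral_mono_set hint
              ((ae_restrict_iff' measurableSet_Ioi).2 (Eventually.of_forall hnn'))
              (Eventually.of_forall fun y (hy : y ∈ Ioc (x / 2) x) =>
                show (1 : ℝ) < y by linarith [hy.1])
      simp only [integral_const, MeasurableSet.univ, measureReal_restrict_apply, univ_inter,
        Real.volume_real_Ioc, smul_eq_mul] at h1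
      rw [max_eq_left (by linarith)] at h1
      have h4 := hnn (g a + x) (by linarith)
      have h5 : (x / 2) ^ M * N a (g a + x) ≤ I := by
        have : 0 ≤ (x / 2) ^ M * N a (g a + x) := by positivity
        nlinarith
      have h6 : (2 / x) ^ M * (x / 2) ^ M = 1 := by
        rw [← mul_pow]; rw [show 2 / x * (x / 2) = 1 by field_simp, one_pow]
      calc N a (g a + x) = (2 / x) ^ M * (x / 2) ^ M * N a (g a + x) := by rw [h6, one_mul]
        _ = (2 / x) ^ M * ((x / 2) ^ M * N a (g a + x)) := by ring
        _ ≤ (2 / x) ^ M * I := by gcongr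
        _ ≤ (I + N a (g a) + 1) * (2 / x) ^ M := by
            have : 0 < (2 / x) ^ M := by positivity
            nlinarith
  refine ⟨a, ha, g a, hg0 a ha, C, by linarith, ?_⟩
  filter_upwards [hbd a ha, eventually_ge_atTop (g a), eventually_gt_atTop 0] with c h4 h5 h6 t ht
  have hψ := psi_pos h6
  refine ⟨(h4 t ht (g a) ⟨le_rfl, h5⟩).trans ?_, fun x hx hxc => ?_⟩
  · gcongr; linarith
  · refine (h4 t ht (g a + x) ⟨by linarith, hxc⟩).trans ?_
    have := hdecay x hx
    gcongr

end Cells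

/-! ### Exceedances in two distinct cells. -/

section Pairs

variable {d : ℕ} {Ω : ℝ → Type*} [∀ c, MeasurableSpace (Ω c)]
  {P : (c : ℝ) → Measure (Ω c)} {X : (c : ℝ) → Space d → Ω c → ℝ}
  {T T₁ : Set (Space d)} {Δ : ℝ → ℝ}

lemma exp_neg_le_factorial_mul_inv {y : ℝ} (hy : 0 < y) (n : ℕ) :
    Real.exp (-y) ≤ n.factorial * (y ^ n)⁻¹ := by
  have := Real.pow_div_factorial_le_exp y hy.le n
  rw [Real.exp_neg, ← div_eq_mul_inv, ← inv_div]
  exact inv_anti₀ (by positivity) this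

/-- Powers of `(a x)^p / 2` dominate powers of `1 + x` for `x ≥ 1`. -/
lemma inv_half_rpow_pow_le {a p : ℝ} (ha : 0 < a) {M n : ℕ} (hM : n ≤ p * M) {x : ℝ}
    (hx : 1 ≤ x) :
    (((a * x) ^ p / 2) ^ M)⁻¹ ≤ 2 ^ M * 2 ^ n * (a ^ (p * M))⁻¹ * ((1 + x) ^ n)⁻¹ := by
  have h1 : ((a * x) ^ p / 2) ^ M = (2 ^ M)⁻¹ * a ^ (p * M) * x ^ (p * M) := by
    rw [div_pow, Real.mul_rpow ha.le (by linarith), mul_pow, ← Real.rpow_natCast (a ^ p),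
      ← Real.rpow_natCast (x ^ p), ← Real.rpow_mul ha.le, ← Real.rpow_mul (by linarith)]
    ring
  have h2 : (2 ^ n)⁻¹ * (1 + x) ^ n ≤ x ^ (p * M) := by
    calc (2 ^ n)⁻¹ * (1 + x) ^ n = ((1 + x) / 2) ^ n := by rw [div_pow]; ring
      _ ≤ x ^ n := by gcongr; linarith
      _ = x ^ (n : ℝ) := (Real.rpow_natCast _ _).symm
      _ ≤ x ^ (p * M) := Real.rpow_le_rpow_of_exponent_le hx hM
  have h3 : (2 ^ M * 2 ^ n * (a ^ (p * M))⁻¹ * ((1 + x) ^ n)⁻¹)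
      = ((2 ^ M)⁻¹ * a ^ (p * M) * ((2 ^ n)⁻¹ * (1 + x) ^ n))⁻¹ := by
    have : 0 < a ^ (p * M) := by positivity
    have : (1 + x) ^ n ≠ 0 := by positivity
    field_simp
  rw [h1, h3]
  have : 0 < a ^ (p * M) := by positivity
  apply inv_anti₀ (by positivity)
  gcongr

variable [∀ c, IsProbabilityMeasure (P c)]

/-- Exceedance probabilities for one cell and for two distinct cells. -/
lemma exists_cell_bounds (hA1 : CondA1 X P T) (hA4 : CondA4 X P T Δ) (hA5 : HasPairBound X P T Δ)
    (hTne : T.Nonempty) (n q : ℕ) :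
    ∃ a > 0, ∃ C > 0, ∀ᶠ c in atTop, ∀ τ ∈ T,
      (P c).real (cellExc X T Δ a c τ) ≤ C * psi c ∧
      ∀ k : Fin d → ℤ, k ≠ 0 → τ + Δ c • latticePoint a k ∈ T →
        (P c).real (cellExc X T Δ a c τ ∩ cellExc X T Δ a c (τ + Δ c • latticePoint a k))
          ≤ C * (((1 + ‖k‖) ^ n)⁻¹ + (c ^ q)⁻¹) * psi c := by
  obtain ⟨p, hp, C₅, hC₅, h5⟩ := hA5
  -- `M` is the power of decay taken from (A4): `p * M ≥ n` yields decay of order n in the distance,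
  -- and `M ≥ q` yields decay of order q in c.
  obtain ⟨M, hM⟩ := exists_nat_ge (max (max ((n : ℝ) / p) q) 1)
  have hM1 : 1 ≤ M := by exact_mod_cast (le_max_right _ _).trans hM
  have hMq : q ≤ M := by exact_mod_cast ((le_max_right _ _).trans (le_max_left _ _)).trans hM
  have hMn : n ≤ p * M := by
    have := ((le_max_left _ _).trans (le_max_left _ _)).trans hM
    rwa [div_le_iff₀' hp] at this
  obtain ⟨a, ha, g, hg, C₄, hC₄, h4⟩ := hA4.exists_pow_bound hTne M hM1
  set D := (2 : ℝ) ^ M * 2 ^ n * (a ^ (p * M))⁻¹ with hD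
  have hD0 : 0 < D := by positivity
  set C := Real.exp g + 1 + C₄ + 2 * C₄ * D + 2 * C₄ * 2 ^ M
    + C₅ * Real.exp g * M.factorial * D with hC
  refine ⟨a, ha, C, by positivity, ?_⟩
  filter_upwards [h4, h5, hA1.eventually_abs_sub_le hg one_pos, eventually_ge_atTop 2,
    eventually_ge_atTop (2 * g)] with c h4 h5 h1 hc hcg τ hτ
  have hψ := psi_pos (show 0 < c by linarith)
  constructor
  · have hsub : cellExc X T Δ a c τ ⊆ {ω | c - g / c < X c τ ω}
        ∪ {ω | ω ∈ cellExc X T Δ a c τ ∧ X c τ ω ≤ c - g / c} := by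
      intro ω hω
      rcases lt_or_ge (c - g / c) (X c τ ω) with h | h
      · exact Or.inl h
      · exact Or.inr ⟨hω, h⟩
    refine (measureReal_mono hsub (measure_ne_top _ _)).trans
      ((measureReal_union_le _ _).trans ?_)
    have e1 := (abs_le.1 (h1 τ hτ g ⟨hg, le_rfl⟩)).2
    have e2 := (h4 τ hτ).1
    have e3 : (Real.exp g + 1 + C₄) * psi c ≤ C * psi c := by
      gcongr
      rw [hC]
      have : 0 ≤ 2 * C₄ * D + 2 * C₄ * 2 ^ M + C₅ * Real.exp g * M.factorial * D := by positivity
      linarith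
    linarith
  intro k hk hkT
  have hk1 : 1 ≤ ‖k‖ := by
    obtain ⟨i, hi⟩ := Function.ne_iff.1 hk
    refine le_trans ?_ (norm_le_pi_norm k i)
    rw [Int.norm_eq_abs]
    exact_mod_cast Int.one_le_abs hi
  set τ' := τ + Δ c • latticePoint a k
  -- If both cells contain an exceedance, then either one corner lies below c - (g+x)/c, which is
  -- rare by (A4), or both corners lie above it, which by (A5) costs the factor e^{g + x - |ak|^p}.
  -- Taking x at most half of the stretched distance makes both small.
  set y := (a * ‖k‖) ^ p / 2 with hy
  have hy0 : 0 < y := by positivity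
  have hyD : (y ^ M)⁻¹ ≤ D * ((1 + ‖k‖) ^ n)⁻¹ := inv_half_rpow_pow_le ha hMn hk1
  -- The conditions hold only for depths up to c. The truncation at c - g is the source of the
  -- additional term `(c ^ q)⁻¹`.
  set x := min y (c - g) with hx
  have hx0 : 0 < x := lt_min hy0 (by linarith)
  have hxM : (x ^ M)⁻¹ ≤ D * ((1 + ‖k‖) ^ n)⁻¹ + 2 ^ M * (c ^ q)⁻¹ := by
    rcases min_choice y (c - g) with h | h
    · rw [hx, h]
      have : 0 ≤ 2 ^ M * (c ^ q)⁻¹ := by positivity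
      linarith
    · rw [hx, h]
      have h6 : ((c - g) ^ M)⁻¹ ≤ ((c / 2) ^ M)⁻¹ := by
        apply inv_anti₀ (by positivity)
        gcongr
        linarith
      have h7 : ((c / 2) ^ M)⁻¹ = 2 ^ M * (c ^ M)⁻¹ := by rw [div_pow]; field_simp
      have h8 : (c ^ M)⁻¹ ≤ (c ^ q)⁻¹ := by
        apply inv_anti₀ (by positivity)
        exact pow_le_pow_right₀ (by linarith) hMq
      have h9 : 0 ≤ D * ((1 + ‖k‖) ^ n)⁻¹ := by positivity
      have h10 : 2 ^ M * (c ^ M)⁻¹ ≤ 2 ^ M * (c ^ q)⁻¹ := by gcongr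
      linarith
  have hxc : g + x ≤ c := by linarith [min_le_right y (c - g)]
  have hsub : cellExc X T Δ a c τ ∩ cellExc X T Δ a c τ' ⊆
      ({ω | ω ∈ cellExc X T Δ a c τ ∧ X c τ ω ≤ c - (g + x) / c}
        ∪ {ω | ω ∈ cellExc X T Δ a c τ' ∧ X c τ' ω ≤ c - (g + x) / c})
        ∪ {ω | c - (g + x) / c < X c τ ω ∧ c - (g + x) / c < X c τ' ω} := by
    rintro ω ⟨hω, hω'⟩
    rcases lt_or_ge (c - (g + x) / c) (X c τ ω) with h | h
    · rcases lt_or_ge (c - (g + x) / c) (X c τ' ω) with h' | h'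
      · exact Or.inr ⟨h, h'⟩
      · exact Or.inl (Or.inr ⟨hω', h'⟩)
    · exact Or.inl (Or.inl ⟨hω, h⟩)
  refine (measureReal_mono hsub (measure_ne_top _ _)).trans
    ((measureReal_union_le _ _).trans ?_)
  have e0 := measureReal_union_le (μ := P c)
    {ω | ω ∈ cellExc X T Δ a c τ ∧ X c τ ω ≤ c - (g + x) / c}
    {ω | ω ∈ cellExc X T Δ a c τ' ∧ X c τ' ω ≤ c - (g + x) / c}
  have e1 := (h4 τ hτ).2 x hx0 hxc
  have e2 := (h4 τ' hkT).2 x hx0 hxc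
  have e3 := h5 (g + x) ⟨by linarith, hxc⟩ τ hτ (latticePoint a k) hkT
  have e4 : Real.exp (g + x - ‖latticePoint a k‖ ^ p)
      ≤ Real.exp g * (M.factorial * (D * ((1 + ‖k‖) ^ n)⁻¹)) := by
    have h6 : (a * ‖k‖) ^ p ≤ ‖latticePoint a k‖ ^ p :=
      Real.rpow_le_rpow (by positivity) (mul_norm_le_norm_latticePoint ha.le k) hp.le
    have h7 : x ≤ y := min_le_left _ _
    have h8 : g + x - ‖latticePoint a k‖ ^ p ≤ g + -y := by
      have : (a * ‖k‖) ^ p = 2 * y := by rw [hy]; ring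
      linarith
    calc _ ≤ Real.exp (g + -y) := Real.exp_le_exp.2 h8
      _ = Real.exp g * Real.exp (-y) := Real.exp_add _ _
      _ ≤ Real.exp g * (M.factorial * (y ^ M)⁻¹) := by
          gcongr
          exact exp_neg_le_factorial_mul_inv hy0 M
      _ ≤ _ := by gcongr
  have e5 : C₄ * (x ^ M)⁻¹ * psi c
      ≤ C₄ * (D * ((1 + ‖k‖) ^ n)⁻¹ + 2 ^ M * (c ^ q)⁻¹) * psi c := by gcongr
  have e6 : C₅ * Real.exp (g + x - ‖latticePoint a k‖ ^ p) * psi c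
      ≤ C₅ * (Real.exp g * (M.factorial * (D * ((1 + ‖k‖) ^ n)⁻¹))) * psi c := by gcongr
  set U := ((1 + ‖k‖) ^ n)⁻¹
  set V := (c ^ q)⁻¹
  have hU : 0 ≤ U := by positivity
  have hV : 0 ≤ V := by positivity
  have e7 : 2 * (C₄ * (D * U + 2 ^ M * V)) + C₅ * (Real.exp g * (M.factorial * (D * U)))
      ≤ C * (U + V) := by
    have r1 : (2 * C₄ * D + C₅ * Real.exp g * M.factorial * D) * U ≤ C * U := by
      gcongr
      rw [hC]
      have : 0 ≤ Real.exp g + 1 + C₄ + 2 * C₄ * 2 ^ M := by positivity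
      linarith
    have r2 : 2 * C₄ * 2 ^ M * V ≤ C * V := by
      gcongr
      rw [hC]
      have : 0 ≤ Real.exp g + 1 + C₄ + 2 * C₄ * D + C₅ * Real.exp g * M.factorial * D := by
        positivity
      linarith
    linarith
  have e8 := mul_le_mul_of_nonneg_right e7 hψ.le
  linarith

/-- The number of cells of a cube with a coordinate close to the boundary. -/
lemma card_shell_le (m J : ℕ) :
    (((Fintype.piFinset fun _ : Fin d => Finset.Ico (0 : ℤ) m).filter
      fun k : Fin d → ℤ => ∃ i, k i < (J : ℤ) ∨ (m : ℤ) - J ≤ k i).card : ℝ)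
      ≤ d * (2 * J * m ^ (d - 1)) := by
  classical
  have hsub : ((Fintype.piFinset fun _ : Fin d => Finset.Ico (0 : ℤ) m).filter
      fun k : Fin d → ℤ => ∃ i, k i < (J : ℤ) ∨ (m : ℤ) - J ≤ k i)
        ⊆ Finset.univ.biUnion fun i : Fin d =>
        Fintype.piFinset (Function.update (fun _ : Fin d => Finset.Ico (0 : ℤ) m) i
          (Finset.Ico (0 : ℤ) J ∪ Finset.Ico ((m : ℤ) - J) m)) := by
    intro k hk
    rw [Finset.mem_filter, Fintype.mem_piFinset] at hk
    obtain ⟨hk, i, hi⟩ := hk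
    rw [Finset.mem_biUnion]
    refine ⟨i, Finset.mem_univ i, Fintype.mem_piFinset.2 fun j => ?_⟩
    by_cases hji : j = i
    · subst hji
      rw [Function.update_self, Finset.mem_union, Finset.mem_Ico, Finset.mem_Ico]
      have := Finset.mem_Ico.1 (hk j)
      rcases hi with h | h
      · exact Or.inl ⟨this.1, h⟩
      · exact Or.inr ⟨h, this.2⟩
    · rw [Function.update_of_ne hji]; exact hk j
  have hcard : ∀ i : Fin d, (Fintype.piFinset (Function.update
      (fun _ : Fin d => Finset.Ico (0 : ℤ) m) i
      (Finset.Ico (0 : ℤ) J ∪ Finset.Ico ((m : ℤ) - J) m))).card ≤ 2 * J * m ^ (d - 1) := by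
    intro i
    rw [Fintype.card_piFinset]
    have : ∀ j, (Function.update (fun _ : Fin d => Finset.Ico (0 : ℤ) m) i
        (Finset.Ico (0 : ℤ) J ∪ Finset.Ico ((m : ℤ) - J) m) j).card
        = Function.update (fun _ : Fin d => m) i
          (Finset.Ico (0 : ℤ) J ∪ Finset.Ico ((m : ℤ) - J) m).card j := by
      intro j
      by_cases hji : j = i
      · subst hji; simp
      · simp [Function.update_of_ne hji]
    -- One coordinate is confined to two strips of width J, the d - 1 others are free.
    rw [Finset.prod_congr rfl fun j _ => this j, Finset.prod_update_of_mem (Finset.mem_univ i)]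
    have h1 : (Finset.Ico (0 : ℤ) J ∪ Finset.Ico ((m : ℤ) - J) m).card ≤ 2 * J := by
      refine (Finset.card_union_le _ _).trans ?_
      simp; omega
    have h2 : ∏ _x ∈ Finset.univ \ {i}, m = m ^ (d - 1) := by
      rw [Finset.prod_const, Finset.card_sdiff_of_subset (by simp)]; simp
    rw [h2]
    gcongr
  have := (Finset.card_le_card hsub).trans (Finset.card_biUnion_le_card_mul _ _ _
    fun i _ => hcard i)
  rw [Finset.card_univ, Fintype.card_fin] at this
  exact_mod_cast this

end Pairs

/-! ### Exceedances both inside and outside a cube. -/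

section PairBound

variable {d : ℕ} {Ω : ℝ → Type*} [∀ c, MeasurableSpace (Ω c)]
  {P : (c : ℝ) → Measure (Ω c)} {X : (c : ℝ) → Space d → Ω c → ℝ}
  {T T₁ : Set (Space d)} {Δ : ℝ → ℝ}

/-- The index of the cell `t + Δ (a k + [0, a)^d)` that contains `v`. -/
noncomputable def cellIndex (D a : ℝ) (t v : Space d) (i : Fin d) : ℤ :=
  ⌊(v i - t i) / (D * a)⌋

lemma mem_cellExc {Ω : ℝ → Type*} {X : (c : ℝ) → Space d → Ω c → ℝ} {a c : ℝ}
    (ha : 0 < a) (hD : 0 < Δ c) {t v : Space d} (hv : v ∈ T) {ω : Ω c}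
    (hω : c < X c v ω) :
    ω ∈ cellExc X T Δ a c (t + Δ c • latticePoint a (cellIndex (Δ c) a t v)) := by
  obtain ⟨w, hw, hvw⟩ := exists_cell ha hD t v
  refine ⟨w, fun i => ⟨(hw i).1, (hw i).2.le⟩, ?_⟩
  have : t + Δ c • latticePoint a (cellIndex (Δ c) a t v) + Δ c • w = v := hvw.symm
  rw [this]
  exact ⟨hv, hω⟩

lemma add_smul_cellIndex_mem {a D η : ℝ} (ha : 0 < a) (hD : 0 < D)
    (hη : ∀ t ∈ T₁, ∀ v : Space d, ‖v‖ < η → t + v ∈ T) (h : d * (D * a) < η) (t : Space d)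
    {v : Space d} (hv : v ∈ T₁) : t + D • latticePoint a (cellIndex D a t v) ∈ T := by
  obtain ⟨w, hw, hvw⟩ := exists_cell ha hD t v
  have h1 : t + D • latticePoint a (cellIndex D a t v) = v + -(D • w) := by
    nth_rewrite 2 [hvw]
    unfold cellIndex
    abel
  rw [h1]
  refine hη v hv _ (lt_of_le_of_lt ?_ h)
  rw [norm_neg]
  refine norm_le_mul_of_abs_le fun i => ?_
  rw [PiLp.smul_apply, smul_eq_mul, abs_mul, abs_of_pos hD, abs_of_nonneg (hw i).1]
  have := (hw i).2.le
  gcongr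

lemma cellIndex_mem_Ico {K D a : ℝ} (ha : 0 < a) (hD : 0 < D) {t u : Space d}
    (hu : u ∈ cube t (K * D)) (i : Fin d) :
    cellIndex D a t u i ∈ Finset.Ico (0 : ℤ) ⌈K / a⌉₊ := by
  have h1 := hu i
  rw [Finset.mem_Ico, cellIndex]
  constructor
  · exact Int.floor_nonneg.2 (div_nonneg (by linarith) (by positivity))
  · rw [Int.floor_lt]
    refine lt_of_lt_of_le ?_ (Nat.le_ceil (K / a))
    rw [div_lt_div_iff₀ (by positivity) ha]
    nlinarith

/-- The cube need not be a union of cells: the last of the ⌈K/a⌉ layers may stick out of it, so a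
point outside may have index ⌈K/a⌉ - 1. Hence the subtraction of 1. -/
lemma cellIndex_of_notMem_cube {K D a : ℝ} (hK : 0 ≤ K) (ha : 0 < a) (hD : 0 < D)
    {t v : Space d} (hv : v ∉ cube t (K * D)) :
    ∃ i, cellIndex D a t v i < 0 ∨ (⌈K / a⌉₊ : ℤ) - 1 ≤ cellIndex D a t v i := by
  simp only [cube, mem_ofPred_eq, not_forall, not_and_or, not_le, not_lt] at hv
  obtain ⟨i, hi | hi⟩ := hv
  · refine ⟨i, Or.inl ?_⟩
    rw [cellIndex, Int.floor_lt]
    simpa using div_neg_of_neg_of_pos (by linarith) (by positivity)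
  · refine ⟨i, Or.inr ?_⟩
    rw [cellIndex, Int.le_floor]
    have h2 : K / a ≤ (v i - t i) / (D * a) := by
      rw [div_le_div_iff₀ ha (by positivity)]
      nlinarith
    have h1 := Nat.ceil_lt_add_one (show 0 ≤ K / a by positivity)
    push_cast
    linarith

variable [∀ c, IsProbabilityMeasure (P c)]

/-- The probability of exceedances both inside and outside a cube of side `K Δ` is small compared
with `K^d ψ(c)`, uniformly over large `K`. -/
lemma eventually_pair_le (hX : Standardized X P T) (hA1 : CondA1 X P T) (hA4 : CondA4 X P T Δ)
    (hA5 : HasPairBound X P T Δ) (hd : 0 < d) (hTne : T.Nonempty) (hT : IsInner T₁ T)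
    (hΔ : ∀ᶠ c in atTop, 0 < Δ c) (hΔ0 : Tendsto Δ atTop (𝓝 0))
    (hκ : ∃ κ : ℕ, ∀ᶠ c in atTop, (Δ c)⁻¹ ≤ c ^ κ) {ε : ℝ} (hε : 0 < ε) :
    ∃ K₀ > 0, ∃ η > 0, ∀ᶠ c in atTop, ∀ K ≥ K₀, K * Δ c ≤ η → ∀ t ∈ T₁, ∀ B ⊆ T₁,
      (P c).real {ω | (∃ u ∈ cube t (K * Δ c), c < X c u ω) ∧
        ∃ v ∈ B \ cube t (K * Δ c), c < X c v ω} ≤ ε * (K ^ d * psi c) := by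
  classical
  obtain ⟨κ, hκ⟩ := hκ
  obtain ⟨R, hR⟩ := exists_norm_le_of_cond hX hA1 hA5 hΔ
  obtain ⟨t₀, ht₀⟩ := hTne
  have hR0 : 0 ≤ R := (norm_nonneg _).trans (hR t₀ ht₀)
  -- Decay of order 2d + 1 makes the far lattice sum O(1/J). There are O(c^{κd}) cells in all, so
  -- one power of c beyond κd makes the second term of the pair estimate vanish in the limit.
  obtain ⟨a, ha, C, hC, hcell⟩ := exists_cell_bounds hA1 hA4 hA5 ⟨t₀, ht₀⟩ (2 * d + 1) (κ * d + 1)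
  have hTsub := hT.subset
  obtain ⟨η₀, hη₀, hin⟩ := hT
  set b := 2 / a with hb
  have hb0 : 0 < b := by positivity
  -- The separation `J` is fixed first, to make pairs of distant cells negligible. Then `K₀` is
  -- taken so large that the cells within J of the boundary of the cube are negligible as well.
  obtain ⟨J, hJ1, hJ⟩ : ∃ J : ℕ, 1 ≤ J ∧ b ^ d * (C * (4 ^ d + 1)) / (1 + J) ≤ ε / 2 := by
    obtain ⟨J, hJ⟩ := exists_nat_ge (max 1 (b ^ d * (C * (4 ^ d + 1)) / (ε / 2)))
    refine ⟨J, by exact_mod_cast (le_max_left _ _).trans hJ, ?_⟩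
    have := (le_max_right _ _).trans hJ
    rw [div_le_iff₀ (by positivity)] at this ⊢
    nlinarith
  set K₀ := max a (b ^ d * (C * (d * (2 * J))) * a / (ε / 2)) with hK₀
  have hK₀pos : 0 < K₀ := lt_of_lt_of_le ha (le_max_left _ _)
  -- Chosen so that 2N + 1 ≤ A c^κ for the index range N below: 4R/a comes from the diameter, 5 from
  -- the roundings.
  set A := 4 * R / a + 5 with hA
  have hlim : Tendsto (fun c : ℝ => A ^ d * c⁻¹) atTop (𝓝 0) := by
    simpa using tendsto_inv_atTop_zero.const_mul (A ^ d)
  have hlim2 : Tendsto (fun c : ℝ => (d : ℝ) * (Δ c * a)) atTop (𝓝 0) := by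
    simpa using (hΔ0.mul_const a).const_mul (d : ℝ)
  refine ⟨K₀, hK₀pos, η₀ / (2 * (d + 1)), by positivity, ?_⟩
  filter_upwards [hcell, hκ, hΔ, eventually_ge_atTop 1,
    hlim.eventually (gt_mem_nhds (show 0 < (1 : ℝ) / (1 + J) by positivity)),
    hlim2.eventually (gt_mem_nhds (half_pos hη₀))] with c hcell hκ hΔc hc1 hsmall hηc
    K hK hKη t ht B hB
  have hψ := psi_pos (show 0 < c by linarith)
  have hKa : a ≤ K := (le_max_left _ _).trans hK
  have hK0 : 0 < K := by linarith
  set m := ⌈K / a⌉₊ with hm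
  have hm1 : K / a ≤ m := Nat.le_ceil _
  have hm2 : (m : ℝ) < K / a + 1 := Nat.ceil_lt_add_one (by positivity)
  have hdKΔ : d * (K * Δ c) < η₀ / 2 := by
    rw [le_div_iff₀ (by positivity)] at hKη
    have h1 : 0 < K * Δ c := by positivity
    nlinarith
  set N := ⌈2 * R / (Δ c * a)⌉₊ + 1 with hN
  set I₁ := Fintype.piFinset fun _ : Fin d => Finset.Ico (0 : ℤ) m with hI₁
  set I₂ := Fintype.piFinset fun _ : Fin d => Finset.Icc (-(N : ℤ)) N with hI₂
  set τ : (Fin d → ℤ) → Space d := fun k => t + Δ c • latticePoint a k with hτ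
  have hτadd : ∀ k k', τ k' = τ k + Δ c • latticePoint a (k' - k) := by
    intro k k'
    simp only [hτ, latticePoint_sub, smul_sub]
    abel
  have hτ1 : ∀ k ∈ I₁, τ k ∈ T := by
    intro k hk
    refine hin t ht _ (lt_of_le_of_lt (norm_le_mul_of_abs_le (R := Δ c * (a * m)) fun i => ?_) ?_)
    · have hki := Finset.mem_Ico.1 (Fintype.mem_piFinset.1 hk i)
      rw [PiLp.smul_apply, latticePoint_apply, smul_eq_mul, abs_mul, abs_mul, abs_of_pos hΔc,
        abs_of_pos ha]
      have : |(k i : ℝ)| ≤ m := by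
        rw [abs_of_nonneg (by exact_mod_cast hki.1)]
        exact_mod_cast hki.2.le
      gcongr
    · have h1 : a * m ≤ K + a := by
        have : a * m ≤ a * (K / a + 1) := by gcongr
        have h2 : a * (K / a + 1) = K + a := by field_simp
        linarith
      have h3 : d * (Δ c * (a * m)) ≤ d * (Δ c * (K + a)) := by gcongr
      linarith
  set Sh := I₁.filter fun k : Fin d → ℤ => ∃ i, k i < (J : ℤ) ∨ (m : ℤ) - J ≤ k i with hSh
  let F : (Fin d → ℤ) → Finset (Fin d → ℤ) := fun k =>
    I₂.filter fun k' => (J : ℝ) ≤ ‖k' - k‖ ∧ τ k' ∈ T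
  let E : (Fin d → ℤ) → Set (Ω c) := fun k => cellExc X T Δ a c (τ k)
  have hsub : {ω | (∃ u ∈ cube t (K * Δ c), c < X c u ω) ∧
        ∃ v ∈ B \ cube t (K * Δ c), c < X c v ω}
      ⊆ (⋃ k ∈ Sh, E k) ∪ ⋃ k ∈ I₁, ⋃ k' ∈ F k, E k ∩ E k' := by
    rintro ω ⟨⟨u, hu, hωu⟩, v, ⟨hvB, hv⟩, hωv⟩
    have huT : u ∈ T := by
      have : u = t + (u - t) := by abel
      rw [this]
      refine hin t ht _ (lt_of_le_of_lt (norm_le_mul_of_abs_le (R := K * Δ c) fun i => ?_)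
        (by linarith))
      rw [PiLp.sub_apply, abs_of_nonneg (by linarith [(hu i).1])]
      linarith [(hu i).2]
    have hvT : v ∈ T := hTsub (hB hvB)
    set k := cellIndex (Δ c) a t u with hk
    set k' := cellIndex (Δ c) a t v with hk'
    have hkI : k ∈ I₁ := Fintype.mem_piFinset.2 fun i => cellIndex_mem_Ico ha hΔc hu i
    have hEk : ω ∈ E k := mem_cellExc ha hΔc huT hωu
    have hEk' : ω ∈ E k' := mem_cellExc ha hΔc hvT hωv
    -- An outside cell closer than J to an inside cell puts the inside cell into the boundary shell,
    -- where it is counted alone; otherwise the pair is counted.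
    rcases lt_or_ge ‖k' - k‖ J with h | h
    · refine Or.inl ?_
      simp only [mem_iUnion]
      refine ⟨k, ?_, hEk⟩
      rw [hSh, Finset.mem_filter]
      refine ⟨hkI, ?_⟩
      obtain ⟨i, hi⟩ := cellIndex_of_notMem_cube hK0.le ha hΔc hv
      have h1 := (norm_le_pi_norm (k' - k) i).trans_lt h
      rw [Int.norm_eq_abs] at h1
      have h2 : |k' i - k i| < (J : ℤ) := by exact_mod_cast h1
      rw [abs_lt] at h2
      refine ⟨i, ?_⟩
      rw [← hk', ← hm] at hi
      omega
    · refine Or.inr ?_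
      simp only [mem_iUnion]
      refine ⟨k, hkI, k', ?_, hEk, hEk'⟩
      rw [Finset.mem_filter]
      refine ⟨Fintype.mem_piFinset.2 fun i => ?_, h, ?_⟩
      · have h1 : |v i - t i| ≤ 2 * R := by
          have := abs_apply_le_norm (v - t) i
          rw [PiLp.sub_apply] at this
          have := norm_sub_le v t
          linarith [hR v hvT, hR t (hTsub ht)]
        have h2 : |(v i - t i) / (Δ c * a)| ≤ ⌈2 * R / (Δ c * a)⌉₊ := by
          rw [abs_div, abs_of_pos (show 0 < Δ c * a by positivity)]
          exact le_trans (by gcongr) (Nat.le_ceil _)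
        rw [abs_le] at h2
        rw [Finset.mem_Icc, hk', cellIndex, hN]
        constructor
        · rw [Int.le_floor]; push_cast; linarith
        · rw [← Int.lt_add_one_iff, Int.floor_lt]; push_cast; linarith
      · exact add_smul_cellIndex_mem ha hΔc hin (by linarith) t (hB hvB)
  have hfar : ∀ k ∈ I₁, ∑ k' ∈ F k, (P c).real (E k ∩ E k')
      ≤ C * (4 ^ d + 1) / (1 + J) * psi c := by
    intro k hk
    have h1 : ∀ k' ∈ F k, (P c).real (E k ∩ E k')
        ≤ C * (((1 + ‖k' - k‖) ^ (2 * d + 1))⁻¹ + (c ^ (κ * d + 1))⁻¹) * psi c := by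
      intro k' hk'
      obtain ⟨-, hJk, hk'T⟩ := Finset.mem_filter.1 hk'
      have hne : k' - k ≠ 0 := by
        intro h0
        rw [h0, norm_zero] at hJk
        have : (1 : ℝ) ≤ J := by exact_mod_cast hJ1
        linarith
      have := (hcell (τ k) (hτ1 k hk)).2 (k' - k) hne (by rw [← hτadd]; exact hk'T)
      rwa [← hτadd] at this
    have h2 : ∑ k' ∈ F k, ((1 + ‖k' - k‖) ^ (2 * d + 1))⁻¹ ≤ 4 ^ d * (1 + (J : ℝ))⁻¹ := by
      have h3 := sum_inv_one_add_norm_pow_le ((F k).image fun k' => k' - k) (J := J)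
        (by positivity) (by
          intro x hx
          obtain ⟨k', hk', rfl⟩ := Finset.mem_image.1 hx
          exact (Finset.mem_filter.1 hk').2.1)
      rwa [Finset.sum_image fun x _ y _ hxy => sub_left_injective hxy] at h3
    have h4 : ((F k).card : ℝ) * (c ^ (κ * d + 1))⁻¹ ≤ 1 / (1 + J) := by
      have hcard : ((F k).card : ℝ) ≤ (2 * N + 1) ^ d := by
        have h5 := Finset.card_le_card (Finset.filter_subset
          (fun k' => (J : ℝ) ≤ ‖k' - k‖ ∧ τ k' ∈ T) I₂)
        have h6 : I₂.card = (2 * N + 1) ^ d := by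
          rw [hI₂, Fintype.card_piFinset]
          simp only [Int.card_Icc, Finset.prod_const, Finset.card_univ, Fintype.card_fin]
          congr 1
          omega
        rw [h6] at h5
        exact_mod_cast h5
      have hN' : (2 * N + 1 : ℝ) ≤ A * c ^ κ := by
        have h5 := Nat.ceil_lt_add_one (show 0 ≤ 2 * R / (Δ c * a) by positivity)
        have h6 : 2 * R / (Δ c * a) ≤ 2 * R / a * c ^ κ := by
          have : 2 * R / (Δ c * a) = 2 * R / a * (Δ c)⁻¹ := by field_simp
          rw [this]
          gcongr
        have h7 : 1 ≤ c ^ κ := one_le_pow₀ hc1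
        rw [hN, hA]
        push_cast
        have h8 : 4 * R / a = 2 * (2 * R / a) := by ring
        rw [h8]
        nlinarith
      calc ((F k).card : ℝ) * (c ^ (κ * d + 1))⁻¹
          ≤ (A * c ^ κ) ^ d * (c ^ (κ * d + 1))⁻¹ := by
            gcongr
            exact hcard.trans (by gcongr)
        _ = A ^ d * c⁻¹ := by
            rw [mul_pow, ← pow_mul, pow_succ]
            field_simp
        _ ≤ _ := hsmall.le
    calc _ ≤ ∑ k' ∈ F k, C * (((1 + ‖k' - k‖) ^ (2 * d + 1))⁻¹
            + (c ^ (κ * d + 1))⁻¹) * psi c := Finset.sum_le_sum h1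
      _ = C * (∑ k' ∈ F k, ((1 + ‖k' - k‖) ^ (2 * d + 1))⁻¹
            + (F k).card * (c ^ (κ * d + 1))⁻¹) * psi c := by
          rw [← Finset.sum_mul, ← Finset.mul_sum, Finset.sum_add_distrib]
          simp
      _ ≤ C * (4 ^ d * (1 + (J : ℝ))⁻¹ + 1 / (1 + J)) * psi c := by gcongr
      _ = _ := by field_simp
  have hI₁card : (I₁.card : ℝ) = m ^ d := by
    rw [hI₁, Fintype.card_piFinset]; simp
  have hshell := card_shell_le (d := d) m J
  have hm0 : 0 < (m : ℝ) := lt_of_lt_of_le (by positivity) hm1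
  have hmb : (m : ℝ) ≤ b * K := by
    have : 1 ≤ K / a := by rwa [one_le_div ha]
    have h2 : b * K = 2 * (K / a) := by rw [hb]; ring
    linarith
  have hmd : (m : ℝ) ^ d ≤ b ^ d * K ^ d := by rw [← mul_pow]; gcongr
  have hmd1 : (m : ℝ) ^ (d - 1) ≤ b ^ d * K ^ d * (a / K) := by
    have h1 : (m : ℝ) ^ (d - 1) * m = m ^ d := by rw [← pow_succ]; congr 1; omega
    have h2 : (m : ℝ) ^ (d - 1) = m ^ d / m := by field_simp; exact h1
    rw [h2, div_eq_mul_inv]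
    have h3 : (m : ℝ)⁻¹ ≤ a / K := by
      rw [← inv_div]
      exact inv_anti₀ (by positivity) hm1
    gcongr
  refine (measureReal_mono hsub (measure_ne_top _ _)).trans
    ((measureReal_union_le _ _).trans ?_)
  have p1 : (P c).real (⋃ k ∈ Sh, E k) ≤ ε / 2 * (K ^ d * psi c) := by
    calc _ ≤ ∑ k ∈ Sh, (P c).real (E k) := measureReal_biUnion_finset_le _ _
      _ ≤ Sh.card • (C * psi c) := Finset.sum_le_card_nsmul _ _ _ fun k hk =>
          (hcell (τ k) (hτ1 k (Finset.mem_filter.1 hk).1)).1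
      _ ≤ (d * (2 * J * (b ^ d * K ^ d * (a / K)))) * (C * psi c) := by
          rw [nsmul_eq_mul]
          gcongr
          exact hshell.trans (by gcongr)
      _ = b ^ d * (C * (d * (2 * J))) * a / K * (K ^ d * psi c) := by ring
      _ ≤ ε / 2 * (K ^ d * psi c) := by
          refine mul_le_mul_of_nonneg_right ?_ (by positivity)
          have := (le_max_right _ _).trans hK
          rw [div_le_iff₀ (by positivity)] at this
          rw [div_le_iff₀ hK0]
          linarith
  have p2 : (P c).real (⋃ k ∈ I₁, ⋃ k' ∈ F k, E k ∩ E k') ≤ ε / 2 * (K ^ d * psi c) := by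
    calc _ ≤ ∑ k ∈ I₁, (P c).real (⋃ k' ∈ F k, E k ∩ E k') := measureReal_biUnion_finset_le _ _
      _ ≤ ∑ k ∈ I₁, C * (4 ^ d + 1) / (1 + J) * psi c := Finset.sum_le_sum fun k hk =>
          (measureReal_biUnion_finset_le _ _).trans (hfar k hk)
      _ = m ^ d * (C * (4 ^ d + 1) / (1 + J) * psi c) := by
          rw [Finset.sum_const, nsmul_eq_mul, hI₁card]
      _ ≤ (b ^ d * K ^ d) * (C * (4 ^ d + 1) / (1 + J) * psi c) := by gcongr
      _ = b ^ d * (C * (4 ^ d + 1)) / (1 + J) * (K ^ d * psi c) := by ring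
      _ ≤ ε / 2 * (K ^ d * psi c) := by gcongr
  linarith

end PairBound

/-! ### The functional `HK` as a limit of dyadic grid functionals. -/

section HK

variable {d : ℕ} {Ω' : Type*} [MeasurableSpace Ω'] {α : ℝ} {ρ : Space d → ℝ}
  {W : Space d → Ω' → ℝ} {Q : Measure Ω'}

lemma gridPoint_mem_closedBox {a K : ℝ} (ha : 0 ≤ a) {m : ℕ} (h : a * m ≤ K)
    (k : Fin d → Fin m) : gridPoint a k ∈ closedBox d K := by
  intro i
  rw [gridPoint_apply]
  have : ((k i : ℕ) : ℝ) ≤ m := by exact_mod_cast (k i).2.le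
  exact ⟨by positivity, le_trans (by gcongr) h⟩

lemma closedBox_subset_orthant (K : ℝ) : closedBox d K ⊆ orthant d := fun _ h i => (h i).1

/-- The dyadic grid of mesh `K 2^{-j}` in `[0, K)^d` approximates the points of `[0, K]^d`. -/
lemma exists_gridPoint_near {K : ℝ} (hK : 0 < K) {u : Space d} (hu : u ∈ closedBox d K) (j : ℕ) :
    ∃ k : Fin d → Fin (2 ^ j), ‖gridPoint (K / 2 ^ j) k - u‖ ≤ d * (K / 2 ^ j) := by
  have hpos : 0 < 2 ^ j := by positivity
  -- The cap 2^j - 1 takes care of the face u i = K, which the grid does not contain.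
  refine ⟨fun i => ⟨min ⌊u i / (K / 2 ^ j)⌋₊ (2 ^ j - 1), by omega⟩, ?_⟩
  refine norm_le_mul_of_abs_le fun i => ?_
  set b := K / 2 ^ j with hb
  have hb0 : 0 < b := by positivity
  have hbK : b * 2 ^ j = K := by rw [hb]; field_simp
  have h1 := Nat.floor_le (show 0 ≤ u i / b from div_nonneg (hu i).1 hb0.le)
  have h2 := Nat.lt_floor_add_one (u i / b)
  rw [le_div_iff₀ hb0] at h1
  rw [div_lt_iff₀ hb0] at h2
  have h3 := (hu i).2
  rw [PiLp.sub_apply, gridPoint_apply, abs_le]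
  simp only [Nat.cast_min]
  have h4 : ((2 ^ j - 1 : ℕ) : ℝ) = 2 ^ j - 1 := by
    rw [Nat.cast_sub hpos]; simp
  rw [h4]
  rcases min_choice ((⌊u i / b⌋₊ : ℝ)) (2 ^ j - 1) with h | h
  · rw [h]
    constructor <;> linarith
  · have h5 := min_le_left ((⌊u i / b⌋₊ : ℝ)) (2 ^ j - 1)
    rw [h] at h5 ⊢
    have h6 : b * (2 ^ j - 1) ≤ b * ⌊u i / b⌋₊ := by gcongr
    constructor <;> linarith

lemma measure_exceed_eq_ofReal [IsProbabilityMeasure Q] (hW : IsLimitField α ρ W Q) {a : ℝ}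
    (ha : 0 ≤ a) {m : ℕ} (S : Finset (Fin d → Fin m)) (y : ℝ) :
    Q {ω | ∃ k ∈ S, y < W (gridPoint a k) ω} = ENNReal.ofReal (excProb (gridLaw W Q a m) S y) := by
  rw [hW.excProb_gridLaw ha, ofReal_measureReal]

lemma ofReal_excMean_eq [IsProbabilityMeasure Q] (hα : 0 < α) (hW : IsLimitField α ρ W Q) {a : ℝ}
    (ha : 0 ≤ a) {m : ℕ} (S : Finset (Fin d → Fin m)) :
    ENNReal.ofReal (excMean (gridLaw W Q a m) S) = ∫⁻ y in Ioi (0 : ℝ),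
      ENNReal.ofReal (Real.exp y) * Q {ω | ∃ k ∈ S, y < W (gridPoint a k) ω} := by
  have := hW.isProbabilityMeasure_gridLaw ha m
  obtain ⟨s, hs⟩ : ∃ s, ∀ k : Fin d → Fin m, radial α ρ (gridPoint a k) ≤ s := by
    obtain ⟨s, hs⟩ := (Set.finite_range fun k : Fin d → Fin m =>
      radial α ρ (gridPoint a k)).bddAbove
    exact ⟨s, fun k => hs ⟨k, rfl⟩⟩
  have hint := integrableOn_exp_mul (excProb_antitone (gridLaw W Q a m) S)
    (excProb_nonneg _ S) (fun y _ => hW.excProb_le hα ha S hs y)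
  rw [excMean, ofReal_integral_eq_lintegral_ofReal hint (Eventually.of_forall fun y =>
    mul_nonneg (Real.exp_pos _).le (excProb_nonneg _ S y))]
  refine lintegral_congr fun y => ?_
  rw [ENNReal.ofReal_mul (Real.exp_pos _).le, measure_exceed_eq_ofReal hW ha]

lemma ofReal_excMean_le_HK [IsProbabilityMeasure Q] (hα : 0 < α) (hW : IsLimitField α ρ W Q)
    {a K : ℝ} (ha : 0 ≤ a) {m : ℕ} (h : a * m ≤ K) (S : Finset (Fin d → Fin m)) :
    ENNReal.ofReal (excMean (gridLaw W Q a m) S) ≤ HK W Q K := by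
  rw [ofReal_excMean_eq hα hW ha]
  refine lintegral_mono fun y => ?_
  gcongr
  rintro ⟨k, -, hk⟩
  exact ⟨gridPoint a k, gridPoint_mem_closedBox ha h k, hk⟩

/-- `H_K` is bounded by any common bound of its dyadic approximations. -/
lemma HK_le_of_dyadic_le [IsProbabilityMeasure Q] (hα : 0 < α) (hW : IsLimitField α ρ W Q)
    {K : ℝ} (hK : 0 < K) {B : ℝ}
    (hB : ∀ j : ℕ, excMean (gridLaw W Q (K / 2 ^ j) (2 ^ j)) Finset.univ ≤ B) :
    HK W Q K ≤ ENNReal.ofReal B := by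
  let A : ℝ → ℕ → Set Ω' := fun y j => {ω | ∃ k ∈ (Finset.univ : Finset (Fin d → Fin (2 ^ j))),
    y < W (gridPoint (K / 2 ^ j) k) ω}
  -- The dyadic grids are nested: the index k of one level is the index 2k of the next.
  have hmono : ∀ y, Monotone (A y) := by
    intro y
    refine monotone_nat_of_le_succ fun j => ?_
    rintro ω ⟨k, -, hk⟩
    refine ⟨fun i => ⟨2 * k i, by have := (k i).2; rw [pow_succ]; omega⟩, Finset.mem_univ _, ?_⟩
    have : gridPoint (K / 2 ^ (j + 1)) (fun i => (⟨2 * k i, by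
        have := (k i).2; rw [pow_succ]; omega⟩ : Fin (2 ^ (j + 1)))) = gridPoint (K / 2 ^ j) k := by
      ext i
      rw [gridPoint_apply, gridPoint_apply, pow_succ]
      push_cast
      field_simp
    rwa [this]
  -- Continuity of paths: a strict exceedance at u persists at nearby dyadic points. Monotone
  -- convergence then passes to the integral.
  have hle : ∀ y, Q {ω | ∃ u ∈ closedBox d K, y < W u ω} ≤ ⨆ j, Q (A y j) := by
    intro y
    rw [← (hmono y).measure_iUnion]
    refine measure_mono_ae ?_
    filter_upwards [hW.continuous] with ω hω
    rintro ⟨u, hu, hyu⟩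
    choose k hk using exists_gridPoint_near hK hu
    have hlim : Tendsto (fun j => gridPoint (K / 2 ^ j) (k j)) atTop (𝓝 u) := by
      rw [tendsto_iff_norm_sub_tendsto_zero]
      refine squeeze_zero (fun _ => norm_nonneg _) hk ?_
      have : Tendsto (fun j : ℕ => K * (1 / 2 : ℝ) ^ j) atTop (𝓝 0) := by
        simpa using (tendsto_pow_atTop_nhds_zero_of_lt_one (by norm_num)
          (by norm_num : (1 / 2 : ℝ) < 1)).const_mul K
      have := this.const_mul (d : ℝ)
      rw [mul_zero] at this
      refine this.congr fun j => ?_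
      rw [one_div, inv_pow, div_eq_mul_inv]
    have hlim' : Tendsto (fun j => gridPoint (K / 2 ^ j) (k j)) atTop (𝓝[orthant d] u) :=
      tendsto_nhdsWithin_iff.2 ⟨hlim, Eventually.of_forall fun j =>
        gridPoint_mem_orthant (by positivity) _⟩
    have hc := (hω u (closedBox_subset_orthant K hu)).tendsto.comp hlim'
    obtain ⟨j, hj⟩ := (hc.eventually (lt_mem_nhds hyu)).exists
    exact mem_iUnion.2 ⟨j, k j, Finset.mem_univ _, hj⟩
  have hmeas : ∀ j, Measurable fun y => ENNReal.ofReal (Real.exp y) * Q (A y j) := by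
    intro j
    refine Measurable.mul (by fun_prop) (Antitone.measurable fun y y' h => ?_)
    exact measure_mono fun ω ⟨k, hk, hlt⟩ => ⟨k, hk, h.trans_lt hlt⟩
  calc HK W Q K
      ≤ ∫⁻ y in Ioi (0 : ℝ), ⨆ j, ENNReal.ofReal (Real.exp y) * Q (A y j) := by
        refine lintegral_mono fun y => ?_
        rw [← ENNReal.mul_iSup]
        gcongr
        exact hle y
    _ = ⨆ j, ∫⁻ y in Ioi (0 : ℝ), ENNReal.ofReal (Real.exp y) * Q (A y j) := by
        refine lintegral_iSup hmeas fun i j hij y => ?_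
        simp only
        gcongr
        exact hmono y hij
    _ ≤ ENNReal.ofReal B := by
        refine iSup_le fun j => ?_
        rw [← ofReal_excMean_eq hα hW (by positivity)]
        exact ENNReal.ofReal_le_ofReal (hB j)

end HK

/-! ### From a grid to a cube of fixed scaled side. -/

section Cube

variable {d : ℕ} {Ω : ℝ → Type*} [∀ c, MeasurableSpace (Ω c)]
  {P : (c : ℝ) → Measure (Ω c)} [∀ c, IsProbabilityMeasure (P c)]
  {X : (c : ℝ) → Space d → Ω c → ℝ}
  {Ω' : Space d → Type*} [∀ t, MeasurableSpace (Ω' t)]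
  {Q : (t : Space d) → Measure (Ω' t)} [∀ t, IsProbabilityMeasure (Q t)]
  {W : (t : Space d) → Space d → Ω' t → ℝ}
  {T T₁ : Set (Space d)} {α : ℝ} {Δ : ℝ → ℝ} {r : Space d → Space d → ℝ}

lemma univ_fin_fun_nonempty {m : ℕ} (hm : 0 < m) :
    (Finset.univ : Finset (Fin d → Fin m)).Nonempty :=
  ⟨fun _ => ⟨0, hm⟩, Finset.mem_univ _⟩

/-- Upper bound for the exceedance probability over a cube in terms of a fine grid. -/
lemma exists_eventually_cube_le (hα : 0 < α) (hr : IsShape r T)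
    (hW : ∀ t ∈ T, IsLimitField α (r t) (W t) (Q t)) (hX : Standardized X P T)
    (hA1 : CondA1 X P T) (hA2 : CondA2 X P T Δ W Q) (hA3 : CondA3 X P T Δ)
    (hA4 : CondA4 X P T Δ) (hTne : T.Nonempty) (hΔ : ∀ᶠ c in atTop, 0 < Δ c)
    (hΔ0 : Tendsto Δ atTop (𝓝 0)) (hT : IsInner T₁ T) {K : ℝ} (hK : 0 < K) {ε : ℝ} (hε : 0 < ε) :
    ∃ m : ℕ, 0 < m ∧ ∀ᶠ c in atTop, ∀ t ∈ T₁,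
      (P c).real {ω | ∃ u ∈ cube t (K * Δ c), c < X c u ω}
        ≤ (Real.exp ε * (1 + excMean (gridLaw (W t) (Q t) (K / m) m) Finset.univ) + ε)
          * psi c := by
  -- The m^d = (K/a)^d cells contribute at most ε₁a^dψ(c) each, in total ε₁K^dψ(c). The bound by ε
  -- serves the level shift `g`.
  set ε₁ := min ε (ε / 2 / K ^ d) with hε₁
  have hε₁0 : 0 < ε₁ := by positivity
  obtain ⟨a₀, ha₀, hsmall⟩ := hA4.exists_small hTne hε₁0
  obtain ⟨m, hm⟩ := exists_nat_gt (max 1 (K / a₀))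
  have hm0 : (0 : ℝ) < m := lt_trans (by positivity) hm
  have hmN : 0 < m := by exact_mod_cast hm0
  set a := K / m with ha
  have ha0 : 0 < a := by positivity
  have haK : a * m = K := by rw [ha]; field_simp
  have haa₀ : a < a₀ := by
    have := (le_max_right _ _).trans_lt hm
    rw [div_lt_iff₀ ha₀] at this
    rw [ha, div_lt_iff₀ hm0]
    linarith
  obtain ⟨g, hg0, hgε, hcell⟩ := hsmall a ha0 haa₀
  refine ⟨m, hmN, ?_⟩
  filter_upwards [hcell, eventually_grid_le hα hr hW hX hA1 hA2 hA3 hΔ0 hT ha0 hmN Finset.univ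
    (univ_fin_fun_nonempty hmN) hg0.le (half_pos hε), hΔ, eventually_gt_atTop 0,
    hT.eventually_add_mem hΔ0 (d * K)] with c hcell hgrid hΔc hc hadd t ht
  have hψ := psi_pos hc
  set τ : (Fin d → Fin m) → Space d := fun k => t + Δ c • gridPoint a k
  have hτT : ∀ k, τ k ∈ T := fun k => hadd t ht _ (by
    have := norm_gridPoint_le ha0.le k; rwa [haK] at this)
  have hsub : {ω | ∃ u ∈ cube t (K * Δ c), c < X c u ω}
      ⊆ {ω | ∃ k ∈ Finset.univ, c - g / c < X c (τ k) ω}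
        ∪ ⋃ k ∈ (Finset.univ : Finset (Fin d → Fin m)),
          {ω | ω ∈ cellExc X T Δ a c (τ k) ∧ X c (τ k) ω ≤ c - g / c} := by
    rintro ω ⟨u, hu, hω⟩
    have huT : u ∈ T := by
      have h1 : u = t + Δ c • ((Δ c)⁻¹ • (u - t)) := by
        rw [smul_smul, mul_inv_cancel₀ hΔc.ne', one_smul]; abel
      rw [h1]
      refine hadd t ht _ (norm_le_mul_of_abs_le fun i => ?_)
      rw [PiLp.smul_apply, PiLp.sub_apply, smul_eq_mul, abs_mul, abs_inv, abs_of_pos hΔc,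
        abs_of_nonneg (by linarith [(hu i).1]), inv_mul_eq_div, div_le_iff₀ hΔc]
      linarith [(hu i).2]
    have hidx : ∀ i, cellIndex (Δ c) a t u i ∈ Finset.Ico (0 : ℤ) m := by
      intro i
      have := cellIndex_mem_Ico ha0 hΔc hu i
      have h2 : K / a = m := by rw [ha]; field_simp
      rwa [h2, Nat.ceil_natCast] at this
    simp only [Finset.mem_Ico] at hidx
    let k : Fin d → Fin m := fun i => ⟨(cellIndex (Δ c) a t u i).toNat, by
      have := hidx i; omega⟩
    have hkτ : t + Δ c • latticePoint a (cellIndex (Δ c) a t u) = τ k := by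
      simp only [τ, gridPoint_eq_latticePoint]
      congr 3
      ext i
      exact (Int.toNat_of_nonneg (hidx i).1).symm
    have hE := mem_cellExc (t := t) ha0 hΔc huT hω
    rw [hkτ] at hE
    rcases lt_or_ge (c - g / c) (X c (τ k) ω) with h | h
    · exact Or.inl ⟨k, Finset.mem_univ _, h⟩
    · refine Or.inr ?_
      simp only [mem_iUnion]
      exact ⟨k, Finset.mem_univ _, hE, h⟩
  refine (measureReal_mono hsub (measure_ne_top _ _)).trans
    ((measureReal_union_le _ _).trans ?_)
  have h1 := hgrid t ht
  have h2 : (P c).real (⋃ k ∈ (Finset.univ : Finset (Fin d → Fin m)),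
      {ω | ω ∈ cellExc X T Δ a c (τ k) ∧ X c (τ k) ω ≤ c - g / c}) ≤ ε / 2 * psi c := by
    calc _ ≤ ∑ k : Fin d → Fin m, (P c).real
          {ω | ω ∈ cellExc X T Δ a c (τ k) ∧ X c (τ k) ω ≤ c - g / c} :=
            measureReal_biUnion_finset_le _ _
      _ ≤ (Finset.univ : Finset (Fin d → Fin m)).card • (ε₁ * a ^ d * psi c) :=
          Finset.sum_le_card_nsmul _ _ _ fun k _ => hcell (τ k) (hτT k)
      _ = ε₁ * K ^ d * psi c := by
          rw [nsmul_eq_mul, Finset.card_univ, Fintype.card_fun, Fintype.card_fin,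
            Fintype.card_fin, ← haK, mul_pow]
          push_cast
          ring
      _ ≤ ε / 2 * psi c := by
          refine mul_le_mul_of_nonneg_right ?_ hψ.le
          have : ε₁ ≤ ε / 2 / K ^ d := min_le_right _ _
          rwa [le_div_iff₀ (by positivity)] at this
  have h3 : Real.exp g * (1 + excMean (gridLaw (W t) (Q t) a m) Finset.univ)
      ≤ Real.exp ε * (1 + excMean (gridLaw (W t) (Q t) a m) Finset.univ) := by
    have h4 := excMean_nonneg (gridLaw (W t) (Q t) a m) Finset.univ
    have h5 : g ≤ ε := hgε.le.trans (min_le_left _ _)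
    gcongr
  have h4 := mul_le_mul_of_nonneg_right h3 hψ.le
  linarith

lemma exists_grid_subset_cube {Ω : ℝ → Type*} {X : (c : ℝ) → Space d → Ω c → ℝ}
    {c : ℝ} (hΔ : 0 < Δ c) {a K : ℝ} (ha : 0 < a) {m : ℕ}
    (h : a * m = K) (t : Space d) :
    {ω | ∃ k ∈ (Finset.univ : Finset (Fin d → Fin m)), c < X c (t + Δ c • gridPoint a k) ω}
      ⊆ {ω | ∃ u ∈ cube t (K * Δ c), c < X c u ω} := by
  rintro ω ⟨k, -, hk⟩
  refine ⟨_, fun i => ?_, hk⟩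
  have h1 : ((k i : ℕ) : ℝ) < m := by exact_mod_cast (k i).2
  rw [PiLp.add_apply, PiLp.smul_apply, gridPoint_apply, smul_eq_mul]
  constructor
  · have : 0 ≤ Δ c * (a * (k i : ℝ)) := by positivity
    linarith
  · have : Δ c * (a * (k i : ℝ)) < Δ c * (a * m) := by gcongr
    rw [← h]
    linarith

/-- Asymptotics, up to a bounded multiple of `ψ(c)`, of the exceedance probability over a cube of
fixed scaled side, and comparison with a fixed grid. -/
lemma exists_cube_asymptotics (hα : 0 < α) (hr : IsShape r T)
    (hW : ∀ t ∈ T, IsLimitField α (r t) (W t) (Q t)) (hX : Standardized X P T)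
    (hA1 : CondA1 X P T) (hA2 : CondA2 X P T Δ W Q) (hA3 : CondA3 X P T Δ)
    (hA4 : CondA4 X P T Δ) (hTne : T.Nonempty) (hΔ : ∀ᶠ c in atTop, 0 < Δ c)
    (hΔ0 : Tendsto Δ atTop (𝓝 0)) (hT : IsInner T₁ T) {K : ℝ} (hK : 0 < K) :
    ∃ B : ℝ, ∃ m : ℕ, 0 < m ∧
      (∀ t ∈ T₁, HK (W t) (Q t) K ≠ ⊤ ∧ (HK (W t) (Q t) K).toReal ≤ B ∧
        |(HK (W t) (Q t) K).toReal - excMean (gridLaw (W t) (Q t) (K / m) m) Finset.univ| ≤ 2) ∧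
      ∀ᶠ c in atTop, ∀ t ∈ T₁,
        ((HK (W t) (Q t) K).toReal - 3) * psi c
          ≤ (P c).real {ω | ∃ k ∈ (Finset.univ : Finset (Fin d → Fin m)),
              c < X c (t + Δ c • gridPoint (K / m) k) ω} ∧
        (P c).real {ω | ∃ u ∈ cube t (K * Δ c), c < X c u ω}
          ≤ ((HK (W t) (Q t) K).toReal + 3) * psi c := by
  have hT' := hT.subset
  -- At one large c, a dyadic grid bounds the cube probability from below and the fixed grid bounds
  -- it from above. Dividing by ψ(c) leaves an inequality between limit functionals, uniform in the
  -- dyadic level, which therefore bounds `HK`.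
  have hdom : ∀ ε > 0, ∀ m : ℕ, 0 < m → (∀ᶠ c in atTop, ∀ t ∈ T₁,
      (P c).real {ω | ∃ u ∈ cube t (K * Δ c), c < X c u ω}
        ≤ (Real.exp ε * (1 + excMean (gridLaw (W t) (Q t) (K / m) m) Finset.univ) + ε)
          * psi c) → ∀ t ∈ T₁, HK (W t) (Q t) K ≤ ENNReal.ofReal
        (Real.exp ε * (1 + excMean (gridLaw (W t) (Q t) (K / m) m) Finset.univ) + 2 * ε) := by
    intro ε hε m hm hev t ht
    refine HK_le_of_dyadic_le hα (hW t (hT' ht)) hK fun j => ?_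
    obtain ⟨c, h1, h2, h3, hc⟩ := (hev.and ((eventually_le_grid hα hr hW hX hA1 hA2 hΔ0 hT
      (show 0 < K / 2 ^ j by positivity) (show 0 < 2 ^ j by positivity) Finset.univ
      (univ_fin_fun_nonempty (by positivity)) hε).and
      (hΔ.and (eventually_gt_atTop 0)))).exists
    have hψ := psi_pos hc
    have h4 := (h2 t ht).trans ((measureReal_mono (exists_grid_subset_cube (X := X) h3
      (show 0 < K / 2 ^ j by positivity) (K := K) (by push_cast; field_simp) t)
      (measure_ne_top _ _)).trans (h1 t ht))
    have h5 := le_of_mul_le_mul_right h4 hψ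
    linarith
  -- A first pass with ε = 1 gives a bound `B` for H_K uniform in t. The second pass takes ε small
  -- against `B`, so that the factor e^ε costs only an absolute constant.
  obtain ⟨m₀, hm₀, hev₀⟩ := exists_eventually_cube_le hα hr hW hX hA1 hA2 hA3 hA4 hTne hΔ hΔ0 hT
    hK one_pos
  obtain ⟨A, hA0, hA⟩ := exists_excProb_le (Q := Q) (W := W) hα hr hW
    (show 0 < K / m₀ by positivity) m₀
  set B := Real.exp 1 * (1 + A) + 2 * 1 with hB
  have hB0 : 0 < B := by positivity
  have hHB : ∀ t ∈ T₁, HK (W t) (Q t) K ≤ ENNReal.ofReal B := by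
    intro t ht
    refine (hdom 1 one_pos m₀ hm₀ hev₀ t ht).trans (ENNReal.ofReal_le_ofReal ?_)
    have := (hW t (hT' ht)).isProbabilityMeasure_gridLaw (show 0 ≤ K / m₀ by positivity) m₀
    have := excMean_le fun y _ => hA t (hT' ht) Finset.univ y
    rw [hB]
    gcongr
  obtain ⟨ε, hε, hε4, hεB⟩ : ∃ ε : ℝ, 0 < ε ∧ ε ≤ 1 / 4 ∧ (Real.exp ε - 1) * (1 + B) ≤ 1 / 2 := by
    have hlim : Tendsto (fun ε : ℝ => (Real.exp ε - 1) * (1 + B)) (𝓝[>] 0) (𝓝 0) := by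
      have hcont : Continuous fun ε : ℝ => (Real.exp ε - 1) * (1 + B) := by fun_prop
      have := hcont.tendsto 0
      simp only [Real.exp_zero, sub_self, zero_mul] at this
      exact this.mono_left nhdsWithin_le_nhds
    obtain ⟨ε, h1, h2, h3⟩ := ((hlim.eventually (gt_mem_nhds (show (0 : ℝ) < 1 / 2 by
      norm_num))).and (Ioo_mem_nhdsGT (show (0 : ℝ) < 1 / 4 by norm_num))).exists
    exact ⟨ε, h2, h3.le, h1.le⟩
  obtain ⟨m, hm, hev⟩ := exists_eventually_cube_le hα hr hW hX hA1 hA2 hA3 hA4 hTne hΔ hΔ0 hT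
    hK hε
  have ha : 0 < K / m := by positivity
  have haK : K / m * m = K := by field_simp
  have hfin : ∀ t ∈ T₁, HK (W t) (Q t) K ≠ ⊤ := fun t ht =>
    ((hHB t ht).trans_lt ENNReal.ofReal_lt_top).ne
  have hle : ∀ t ∈ T₁, excMean (gridLaw (W t) (Q t) (K / m) m) Finset.univ
      ≤ (HK (W t) (Q t) K).toReal := fun t ht =>
    (ENNReal.ofReal_le_iff_le_toReal (hfin t ht)).1
      (ofReal_excMean_le_HK hα (hW t (hT' ht)) ha.le haK.le Finset.univ)
  have hHB' : ∀ t ∈ T₁, (HK (W t) (Q t) K).toReal ≤ B := fun t ht =>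
    ENNReal.toReal_le_of_le_ofReal hB0.le (hHB t ht)
  have hexp : ∀ t ∈ T₁,
      Real.exp ε * (1 + excMean (gridLaw (W t) (Q t) (K / m) m) Finset.univ)
        ≤ 1 + excMean (gridLaw (W t) (Q t) (K / m) m) Finset.univ + 1 / 2 := by
    intro t ht
    have h1 := (hle t ht).trans (hHB' t ht)
    have h2 : 0 ≤ Real.exp ε - 1 := by linarith [Real.one_le_exp hε.le]
    have h3 := mul_le_mul_of_nonneg_left h1 h2
    linarith
  have hge : ∀ t ∈ T₁, (HK (W t) (Q t) K).toReal
      ≤ excMean (gridLaw (W t) (Q t) (K / m) m) Finset.univ + 2 := by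
    intro t ht
    have h1 := hexp t ht
    have h0 := excMean_nonneg (gridLaw (W t) (Q t) (K / m) m) Finset.univ
    refine (ENNReal.toReal_le_of_le_ofReal ?_ (hdom ε hε m hm hev t ht)).trans (by linarith)
    positivity
  refine ⟨B, m, hm, fun t ht => ⟨hfin t ht, hHB' t ht, ?_⟩, ?_⟩
  · rw [abs_le]
    constructor <;> linarith [hle t ht, hge t ht]
  filter_upwards [hev, eventually_le_grid hα hr hW hX hA1 hA2 hΔ0 hT ha hm Finset.univ
      (univ_fin_fun_nonempty hm) hε, eventually_gt_atTop 0] with c h1 h2 hc t ht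
  have hψ := psi_pos hc
  constructor
  · refine le_trans (mul_le_mul_of_nonneg_right ?_ hψ.le) (h2 t ht)
    linarith [hge t ht]
  · refine (h1 t ht).trans (mul_le_mul_of_nonneg_right ?_ hψ.le)
    linarith [hexp t ht, hle t ht]

end Cube

/-! ### Comparison of Gaussian vectors with close parameters. -/

section GaussianVector

variable {ι : Type*} [Fintype ι] [DecidableEq ι]

lemma multivariateGaussian_conv (m m' : EuclideanSpace ℝ ι) {S S' : Matrix ι ι ℝ}
    (hS : S.PosSemidef) (hS' : S'.PosSemidef) :
    (multivariateGaussian m S) ∗ (multivariateGaussian m' S')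
      = multivariateGaussian (m + m') (S + S') := by
  refine Measure.ext_of_charFun ?_
  ext t
  rw [charFun_conv, charFun_multivariateGaussian hS, charFun_multivariateGaussian hS',
    charFun_multivariateGaussian (hS.add hS'), ← Complex.exp_add, inner_add_right,
    Matrix.add_mulVec, dotProduct_add]
  congr 1
  push_cast
  ring

/-- The quadratic form of E is at least -η(∑|x_i|)², and Cauchy–Schwarz bounds (∑|x_i|)² by the
dimension times |x|². -/
lemma posSemidef_of_abs_le {E : Matrix ι ι ℝ} (hE : E.IsHermitian) {η : ℝ}
    (h : ∀ i j, |E i j| ≤ η) : (E + (Fintype.card ι * η) • (1 : Matrix ι ι ℝ)).PosSemidef := by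
  rcases isEmpty_or_nonempty ι with hι | hι
  · rw [Subsingleton.elim (E + (Fintype.card ι * η) • (1 : Matrix ι ι ℝ)) 0]
    exact Matrix.PosSemidef.zero
  have hη : 0 ≤ η := (abs_nonneg _).trans (h (Classical.arbitrary ι) (Classical.arbitrary ι))
  refine Matrix.PosSemidef.of_dotProduct_mulVec_nonneg
    (hE.add (by simp [Matrix.IsHermitian])) fun x => ?_
  have h1 : -(η * (∑ i, |x i|) ^ 2) ≤ x ⬝ᵥ E.mulVec x := by
    have : |x ⬝ᵥ E.mulVec x| ≤ η * (∑ i, |x i|) ^ 2 := by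
      simp only [dotProduct, Matrix.mulVec]
      calc _ ≤ ∑ i, |x i * ∑ j, E i j * x j| := Finset.abs_sum_le_sum_abs _ _
        _ ≤ ∑ i, |x i| * (η * ∑ j, |x j|) := by
            refine Finset.sum_le_sum fun i _ => ?_
            rw [abs_mul]
            refine mul_le_mul_of_nonneg_left ?_ (abs_nonneg _)
            rw [Finset.mul_sum]
            refine (Finset.abs_sum_le_sum_abs _ _).trans (Finset.sum_le_sum fun j _ => ?_)
            rw [abs_mul]
            exact mul_le_mul_of_nonneg_right (h i j) (abs_nonneg _)
        _ = _ := by rw [← Finset.sum_mul]; ring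
    exact neg_le_of_abs_le this
  have h2 : (∑ i, |x i|) ^ 2 ≤ Fintype.card ι * (x ⬝ᵥ x) := by
    have := sq_sum_le_card_mul_sum_sq (s := Finset.univ) (f := fun i => |x i|)
    simpa [dotProduct, sq_abs, pow_two] using this
  have h3 := mul_le_mul_of_nonneg_left h2 hη
  simp only [star_trivial, Matrix.add_mulVec, Matrix.smul_mulVec, Matrix.one_mulVec,
    dotProduct_add, dotProduct_smul, smul_eq_mul]
  linarith

lemma multivariateGaussian_exists_abs_le {m : EuclideanSpace ℝ ι} {S : Matrix ι ι ℝ}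
    (hS : S.PosSemidef) {θ v : ℝ} (hθ : 0 < θ) (hm : ∀ k, |m k| ≤ θ / 2) (hv : ∀ k, S k k ≤ v) :
    (multivariateGaussian m S).real {x | ∃ k, θ ≤ |x k|}
      ≤ Fintype.card ι * (v / (θ / 2) ^ 2) := by
  have h0 : {x : EuclideanSpace ℝ ι | ∃ k, θ ≤ |x k|}
      = ⋃ k ∈ (Finset.univ : Finset ι), {x | θ ≤ |x k|} := by ext; simp
  rw [h0]
  refine (measureReal_biUnion_finset_le _ _).trans ?_
  rw [← nsmul_eq_mul]
  refine Finset.sum_le_card_nsmul _ _ _ fun k _ => ?_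
  have hmem : MemLp (fun x : EuclideanSpace ℝ ι => x k) 2 (multivariateGaussian m S) :=
    (HasGaussianLaw.map_fun IsGaussian.hasGaussianLaw_id (EuclideanSpace.proj k)).memLp_two
  have hmean : ∫ x : EuclideanSpace ℝ ι, x k ∂(multivariateGaussian m S) = m k := by
    have := (EuclideanSpace.proj (𝕜 := ℝ) k).integral_comp_comm
      (IsGaussian.integrable_fun_id (μ := multivariateGaussian m S))
    rw [integral_id_multivariateGaussian] at this
    exact this
  have hc := meas_ge_le_variance_div_sq hmem (half_pos hθ)
  rw [variance_eval_multivariateGaussian hS, hmean] at hc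
  have h1 : (multivariateGaussian m S).real {x | θ / 2 ≤ |x k - m k|} ≤ S k k / (θ / 2) ^ 2 :=
    ENNReal.toReal_le_of_le_ofReal (div_nonneg hS.diag_nonneg (by positivity)) hc
  have hsub : {x : EuclideanSpace ℝ ι | θ ≤ |x k|} ⊆ {x | θ / 2 ≤ |x k - m k|} := by
    intro x (hx : θ ≤ |x k|)
    have h2 := abs_sub_abs_le_abs_sub (x k) (m k)
    have h3 := hm k
    change θ / 2 ≤ |x k - m k|
    linarith
  exact (measureReal_mono hsub (measure_ne_top _ _)).trans (h1.trans (by have := hv k; gcongr))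

lemma measurableSet_exists_mem_lt {ι : Type*} (S : Finset ι) (y : ℝ) :
    MeasurableSet {x : EuclideanSpace ℝ ι | ∃ k ∈ S, y < x k} := by
  have : {x : EuclideanSpace ℝ ι | ∃ k ∈ S, y < x k} = ⋃ k ∈ S, {x | y < x k} := by ext; simp
  rw [this]
  exact Finset.measurableSet_biUnion _ fun k _ => measurableSet_lt measurable_const (by fun_prop)

lemma conv_exists_lt_le {ι : Type*} [Fintype ι] {μ ν : Measure (EuclideanSpace ℝ ι)}
    [IsProbabilityMeasure μ] [IsProbabilityMeasure ν] (S : Finset ι) (y θ : ℝ) :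
    (μ ∗ ν).real {x | ∃ k ∈ S, y < x k}
      ≤ μ.real {x | ∃ k ∈ S, y - θ < x k} + ν.real {x | ∃ k, θ ≤ |x k|} := by
  rw [Measure.conv, map_measureReal_apply (by fun_prop) (measurableSet_exists_mem_lt S y)]
  have h1 : μ.real {x | ∃ k ∈ S, y - θ < x k}
      = (μ.prod ν).real ({x | ∃ k ∈ S, y - θ < x k} ×ˢ univ) := by
    rw [measureReal_prod_prod]; simp
  have h2 : ν.real {x | ∃ k, θ ≤ |x k|}
      = (μ.prod ν).real (univ ×ˢ {x | ∃ k, θ ≤ |x k|}) := by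
    rw [measureReal_prod_prod]; simp
  rw [h1, h2]
  refine (measureReal_mono ?_ (measure_ne_top _ _)).trans (measureReal_union_le _ _)
  rintro ⟨x, z⟩ ⟨k, hk, hy⟩
  by_cases hz : θ ≤ |z k|
  · exact Or.inr ⟨mem_univ _, k, hz⟩
  · refine Or.inl ⟨⟨k, hk, ?_⟩, mem_univ _⟩
    have h3 := le_abs_self (z k)
    have h4 : y < x k + z k := hy
    change y - θ < x k
    linarith

/-- Adding independent noise changes the maximum by less than θ unless some noise coordinate reaches
θ in absolute value; this is the converse direction of `conv_exists_lt_le`. -/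
lemma exists_lt_le_conv {ι : Type*} [Fintype ι] {μ ν : Measure (EuclideanSpace ℝ ι)}
    [IsProbabilityMeasure μ] [IsProbabilityMeasure ν] (S : Finset ι) (y θ : ℝ) :
    μ.real {x | ∃ k ∈ S, y < x k}
      ≤ (μ ∗ ν).real {x | ∃ k ∈ S, y - θ < x k} + ν.real {x | ∃ k, θ ≤ |x k|} := by
  rw [Measure.conv, map_measureReal_apply (by fun_prop) (measurableSet_exists_mem_lt S (y - θ))]
  have h1 : μ.real {x | ∃ k ∈ S, y < x k}
      = (μ.prod ν).real ({x | ∃ k ∈ S, y < x k} ×ˢ univ) := by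
    rw [measureReal_prod_prod]; simp
  have h2 : ν.real {x | ∃ k, θ ≤ |x k|}
      = (μ.prod ν).real (univ ×ˢ {x | ∃ k, θ ≤ |x k|}) := by
    rw [measureReal_prod_prod]; simp
  rw [h1, h2]
  refine (measureReal_mono ?_ (measure_ne_top _ _)).trans (measureReal_union_le _ _)
  rintro ⟨x, z⟩ ⟨⟨k, hk, hy⟩, -⟩
  by_cases hz : θ ≤ |z k|
  · exact Or.inr ⟨mem_univ _, k, hz⟩
  · refine Or.inl ⟨k, hk, ?_⟩
    have h3 := neg_abs_le (z k)
    change y - θ < x k + z k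
    have h4 : y < x k := hy
    linarith

/-- Gaussian vectors with close parameters have close exceedance probabilities. -/
lemma multivariateGaussian_exists_lt_le {m m' : EuclideanSpace ℝ ι} {S S' : Matrix ι ι ℝ}
    (hS : S.PosSemidef) (hS' : S'.PosSemidef) {η θ : ℝ} (hη : 0 ≤ η) (hθ : 0 < θ)
    (hηθ : η ≤ θ / 2)
    (hm : ∀ k, |m' k - m k| ≤ η) (hSS : ∀ i j, |S' i j - S i j| ≤ η) (A : Finset ι) (y : ℝ) :
    (multivariateGaussian m' S').real {x | ∃ k ∈ A, y < x k}
      ≤ (multivariateGaussian m S).real {x | ∃ k ∈ A, y - 2 * θ < x k}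
        + 2 * (Fintype.card ι * ((Fintype.card ι + 1) * η / (θ / 2) ^ 2)) := by
  set N : ℝ := (Fintype.card ι : ℝ)
  have hN : 0 ≤ N := Nat.cast_nonneg _
  have hI : ((N * η) • (1 : Matrix ι ι ℝ)).PosSemidef :=
    Matrix.PosSemidef.one.smul (by positivity)
  have hE : ((S' - S) + (N * η) • (1 : Matrix ι ι ℝ)).PosSemidef :=
    posSemidef_of_abs_le (hS'.isHermitian.sub hS.isHermitian) hSS
  -- S' + NηI = S + (S' - S + NηI), and both added matrices are positive semidefinite and small. The
  -- two Gaussian laws thus become equal after convolution with small independent noise; each of the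
  -- two convolutions costs one θ in the level.
  have hconv : (multivariateGaussian m' S') ∗ (multivariateGaussian 0 ((N * η) • 1))
      = (multivariateGaussian m S) ∗
        (multivariateGaussian (m' - m) ((S' - S) + (N * η) • (1 : Matrix ι ι ℝ))) := by
    rw [multivariateGaussian_conv _ _ hS' hI, multivariateGaussian_conv _ _ hS hE]
    congr 1 <;> abel
  have h1 := exists_lt_le_conv (μ := multivariateGaussian m' S')
    (ν := multivariateGaussian 0 ((N * η) • 1)) A y θ
  rw [hconv] at h1
  have h2 := conv_exists_lt_le (μ := multivariateGaussian m S)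
    (ν := multivariateGaussian (m' - m) ((S' - S) + (N * η) • (1 : Matrix ι ι ℝ))) A (y - θ) θ
  have h3 := multivariateGaussian_exists_abs_le (m := 0) hI hθ (v := (N + 1) * η)
    (fun k => by simpa using (half_pos hθ).le) (fun k => by simp; linarith)
  have h4 := multivariateGaussian_exists_abs_le (m := m' - m) hE hθ (v := (N + 1) * η)
    (fun k => (hm k).trans hηθ) (fun k => by
      have := (le_abs_self _).trans (hSS k k)
      simp; linarith)
  have h5 : y - θ - θ = y - 2 * θ := by ring
  rw [h5] at h2
  linarith

end GaussianVector

/-! ### Stability of `excMean` under a shift of the level. -/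

section ExcMean

variable {ι : Type*} {ν ν' : Measure (ι → ℝ)} [IsProbabilityMeasure ν] [IsProbabilityMeasure ν']

/-- The comparison is integrated up to M, and the exponential tail is used beyond. Undoing the shift
by 2θ multiplies by e^{2θ} and brings in the interval [-2θ, 0], whose contribution is at most 1. -/
lemma excMean_le_of_excProb_le {S : Finset ι} {A β θ M : ℝ} (hM : 0 ≤ M) (hθ : 0 ≤ θ) (hβ : 0 ≤ β)
    (hA : ∀ y, 0 ≤ y → excProb ν S y ≤ A * Real.exp (-2 * y))
    (hA' : ∀ y, 0 ≤ y → excProb ν' S y ≤ A * Real.exp (-2 * y))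
    (h : ∀ y, excProb ν' S y ≤ excProb ν S (y - 2 * θ) + β) :
    excMean ν' S ≤ Real.exp (2 * θ) * (1 + excMean ν S) + β * Real.exp M
      + A * Real.exp (-M) := by
  have hanti := excProb_antitone ν S
  have hanti' := excProb_antitone ν' S
  have h0 := excProb_nonneg ν S
  have h0' := excProb_nonneg ν' S
  rw [excMean, setIntegral_exp_mul_eq hanti' h0' hA' hM]
  have h1 := setIntegral_exp_mul_le hanti' h0' hA' hM
  have hshift : Antitone fun y => excProb ν S (y - 2 * θ) := fun a b hab =>
    hanti (by linarith)
  have h2 : ∫ y in (0 : ℝ)..M, Real.exp y * excProb ν' S y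
      ≤ (∫ y in (0 : ℝ)..M, Real.exp y * excProb ν S (y - 2 * θ)) + β * Real.exp M := by
    have h3 : ∫ y in (0 : ℝ)..M, Real.exp y * excProb ν' S y
        ≤ ∫ y in (0 : ℝ)..M, (Real.exp y * excProb ν S (y - 2 * θ) + Real.exp y * β) := by
      refine intervalIntegral.integral_mono_on hM (intervalIntegrable_exp_mul hanti' 0 M)
        ((intervalIntegrable_exp_mul hshift 0 M).add
          ((Real.continuous_exp.mul continuous_const).intervalIntegrable _ _)) fun y _ => ?_
      rw [← mul_add]
      exact mul_le_mul_of_nonneg_left (h y) (Real.exp_pos _).le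
    rw [intervalIntegral.integral_add (intervalIntegrable_exp_mul hshift 0 M)
      (Continuous.intervalIntegrable (by fun_prop) _ _),
      intervalIntegral.integral_mul_const, integral_exp, Real.exp_zero] at h3
    nlinarith
  have h4 : ∫ y in (0 : ℝ)..M, Real.exp y * excProb ν S (y - 2 * θ)
      ≤ Real.exp (2 * θ) * (1 + excMean ν S) := by
    have h5 : ∀ y, Real.exp y * excProb ν S (y - 2 * θ)
        = Real.exp (2 * θ) * (Real.exp (y - 2 * θ) * excProb ν S (y - 2 * θ)) := by
      intro y
      rw [← mul_assoc, ← Real.exp_add]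
      congr 2; ring
    simp_rw [h5]
    rw [intervalIntegral.integral_const_mul]
    refine mul_le_mul_of_nonneg_left ?_ (Real.exp_pos _).le
    rw [intervalIntegral.integral_comp_sub_right
      (fun y => Real.exp y * excProb ν S y) (2 * θ), zero_sub]
    have h6 : ∫ y in (-(2 * θ))..(M - 2 * θ), Real.exp y * excProb ν S y
        ≤ ∫ y in (-(2 * θ))..M, Real.exp y * excProb ν S y := by
      rw [← intervalIntegral.integral_add_adjacent_intervals
        (intervalIntegrable_exp_mul hanti (-(2 * θ)) (M - 2 * θ))
        (intervalIntegrable_exp_mul hanti (M - 2 * θ) M)]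
      have := intervalIntegral.integral_nonneg (μ := volume) (show M - 2 * θ ≤ M by linarith)
        fun y _ => mul_nonneg (Real.exp_pos y).le (h0 y)
      linarith
    rw [← intervalIntegral.integral_add_adjacent_intervals
        (intervalIntegrable_exp_mul hanti (-(2 * θ)) 0)
        (intervalIntegrable_exp_mul hanti 0 M)] at h6
    have h7 : ∫ y in (-(2 * θ))..0, Real.exp y * excProb ν S y ≤ 1 := by
      refine (integral_exp_mul_le hanti (by linarith)).trans ?_
      have := excProb_le_one ν S (-(2 * θ))
      have h9 := h0 (-(2 * θ))
      have h8 : Real.exp 0 - Real.exp (-(2 * θ)) ≤ 1 := by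
        rw [Real.exp_zero]; linarith [Real.exp_pos (-(2 * θ))]
      nlinarith
    have h8 : excMean ν S = (∫ y in (0 : ℝ)..M, Real.exp y * excProb ν S y)
        + ∫ y in Ioi M, Real.exp y * excProb ν S y := setIntegral_exp_mul_eq hanti h0 hA hM
    have h9 : 0 ≤ ∫ y in Ioi M, Real.exp y * excProb ν S y :=
      integral_nonneg fun y => mul_nonneg (Real.exp_pos y).le (h0 y)
    linarith
  linarith

end ExcMean

/-! ### The limit field on a grid as a Gaussian vector. -/

section GridLaw

variable {d : ℕ} {Ω' : Type*} [MeasurableSpace Ω'] {α : ℝ} {ρ : Space d → ℝ}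
  {W : Space d → Ω' → ℝ} {Q : Measure Ω'}

/-- Mean of the limit field on a grid. -/
noncomputable def gridMean (α : ℝ) (ρ : Space d → ℝ) (a : ℝ) (m : ℕ) :
    EuclideanSpace ℝ (Fin d → Fin m) :=
  WithLp.toLp 2 fun k => -radial α ρ (gridPoint a k) / 2

/-- Covariance of the limit field on a grid. -/
noncomputable def gridCov (α : ℝ) (ρ : Space d → ℝ) (a : ℝ) (m : ℕ) :
    Matrix (Fin d → Fin m) (Fin d → Fin m) ℝ :=
  Matrix.of fun k j => (radial α ρ (gridPoint a k) + radial α ρ (gridPoint a j)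
    - radial α ρ (gridPoint a k - gridPoint a j)) / 2

/-- A Gaussian law is determined by its mean and covariance form. Semidefiniteness needs no
computation: the matrix is the covariance of an actual vector. -/
lemma IsLimitField.gridLaw_spec [IsProbabilityMeasure Q] (hW : IsLimitField α ρ W Q) {a : ℝ}
    (ha : 0 ≤ a) (m : ℕ) :
    (gridCov α ρ a m).PosSemidef ∧
      Q.map (fun ω => WithLp.toLp 2 fun k : Fin d → Fin m => W (gridPoint a k) ω)
        = multivariateGaussian (gridMean α ρ a m) (gridCov α ρ a m) := by
  have hae := hW.aemeasurable_grid ha m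
  have hgp : IsGaussianProcess (fun k : Fin d → Fin m => W (gridPoint a k)) Q :=
    hW.gaussian.comp_right fun k : Fin d → Fin m =>
      (⟨gridPoint a k, gridPoint_mem_orthant ha k⟩ : orthant d)
  have hg : HasGaussianLaw (fun ω (k : Fin d → Fin m) => W (gridPoint a k) ω) Q :=
    (hgp.hasGaussianLaw Finset.univ).map_fun (ContinuousLinearMap.pi fun k =>
      ContinuousLinearMap.proj (⟨k, Finset.mem_univ k⟩ : (Finset.univ : Finset (Fin d → Fin m))))
  have hL := hg.toLp_pi 2
  have hmem : ∀ k : Fin d → Fin m, MemLp (W (gridPoint a k)) 2 Q := fun k =>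
    (hg.eval k).memLp_two
  have hentry : ∀ k j : Fin d → Fin m,
      covariance (W (gridPoint a k)) (W (gridPoint a j)) Q = gridCov α ρ a m k j := fun k j =>
    hW.cov _ (gridPoint_mem_orthant ha k) _ (gridPoint_mem_orthant ha j)
  have hcov : ∀ x y : EuclideanSpace ℝ (Fin d → Fin m),
      covarianceBilin (Q.map fun ω => WithLp.toLp 2 fun k : Fin d → Fin m =>
        W (gridPoint a k) ω) x y = x ⬝ᵥ (gridCov α ρ a m).mulVec y := by
    intro x y
    rw [covarianceBilin_apply_pi hmem]
    simp only [dotProduct, Matrix.mulVec, Finset.mul_sum]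
    refine Finset.sum_congr rfl fun i _ => Finset.sum_congr rfl fun j _ => ?_
    rw [hentry]
    ring
  have hpsd : (gridCov α ρ a m).PosSemidef := by
    refine Matrix.PosSemidef.of_dotProduct_mulVec_nonneg ?_ fun x => ?_
    · ext k j
      rw [Matrix.conjTranspose_apply, star_trivial, ← hentry, ← hentry, covariance_comm]
    · have := covarianceBilin_self_nonneg (μ := Q.map fun ω =>
        WithLp.toLp 2 fun k : Fin d → Fin m => W (gridPoint a k) ω) (WithLp.toLp 2 x)
      rw [hcov] at this
      simpa using this
  refine ⟨hpsd, ?_⟩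
  have := hL.isGaussian_map
  refine IsGaussian.ext ?_ ?_
  · ext k
    have h1 := (EuclideanSpace.proj (𝕜 := ℝ) k).integral_comp_comm
      (IsGaussian.integrable_id (μ := Q.map fun ω =>
        WithLp.toLp 2 fun k : Fin d → Fin m => W (gridPoint a k) ω))
    rw [integral_map hL.aemeasurable (by fun_prop)] at h1
    rw [integral_id_multivariateGaussian']
    refine h1.symm.trans ?_
    exact hW.mean _ (gridPoint_mem_orthant ha k)
  · ext x y
    rw [hcov, covarianceBilin_multivariateGaussian hpsd]

lemma IsLimitField.excProb_eq_multivariateGaussian [IsProbabilityMeasure Q]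
    (hW : IsLimitField α ρ W Q) {a : ℝ} (ha : 0 ≤ a) {m : ℕ} (S : Finset (Fin d → Fin m)) (y : ℝ) :
    excProb (gridLaw W Q a m) S y
      = (multivariateGaussian (gridMean α ρ a m) (gridCov α ρ a m)).real
          {x | ∃ k ∈ S, y < x k} := by
  have hae := hW.aemeasurable_grid ha m
  rw [hW.excProb_gridLaw ha, ← (hW.gridLaw_spec ha m).2, map_measureReal_apply_of_aemeasurable
    ((WithLp.measurable_toLp 2 _).comp_aemeasurable' hae) (measurableSet_exists_mem_lt S y)]
  rfl

lemma IsShape.exists_abs_radial_sub_le {r : Space d → Space d → ℝ} {T : Set (Space d)}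
    (hr : IsShape r T) (hα : 0 < α) (R : ℝ) {η : ℝ} (hη : 0 < η) :
    ∃ ε > 0, ∀ t ∈ T, ∀ s ∈ T, ‖s - t‖ < ε → ∀ u : Space d, ‖u‖ ≤ R →
      |radial α (r t) u - radial α (r s) u| ≤ η := by
  obtain ⟨ε, hε, h⟩ := hr.unif (η / (|R| ^ α + 1)) (by positivity)
  refine ⟨ε, hε, fun t ht s hs hst u hu => ?_⟩
  by_cases h0 : u = 0
  · rw [h0, radial_zero hα, radial_zero hα]; simpa using hη.le
  have h1 : ‖u‖⁻¹ • u ∈ Metric.sphere (0 : Space d) 1 := by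
    simp [norm_smul, h0]
  have h2 := h t ht s hs hst _ h1
  have h4 : ‖u‖ ≤ |R| := hu.trans (le_abs_self R)
  unfold radial
  rw [← mul_sub, abs_mul, abs_of_nonneg (by positivity : 0 ≤ ‖u‖ ^ α)]
  calc _ ≤ |R| ^ α * (η / (|R| ^ α + 1)) := by gcongr
    _ ≤ (|R| ^ α + 1) * (η / (|R| ^ α + 1)) := by gcongr; linarith
    _ = η := by field_simp

end GridLaw

/-! ### Dependence of the functionals on the base point. -/

section Continuity

variable {d : ℕ} {Ω' : Space d → Type*} [∀ t, MeasurableSpace (Ω' t)] {α : ℝ}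
  {r : Space d → Space d → ℝ} {T : Set (Space d)} {W : (t : Space d) → Space d → Ω' t → ℝ}
  {Q : (t : Space d) → Measure (Ω' t)} [∀ t, IsProbabilityMeasure (Q t)]

/-- The functional `∫₀^∞ e^y P(max_k W_t(ak) > y) dy` varies slowly in `t`. -/
lemma exists_excMean_le_add_four (hα : 0 < α) (hr : IsShape r T)
    (hW : ∀ t ∈ T, IsLimitField α (r t) (W t) (Q t)) {a : ℝ} (ha : 0 < a) (m : ℕ) :
    ∃ ε > 0, ∀ t ∈ T, ∀ s ∈ T, ‖s - t‖ < ε →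
      excMean (gridLaw (W s) (Q s) a m) Finset.univ
        ≤ excMean (gridLaw (W t) (Q t) a m) Finset.univ + 4 := by
  obtain ⟨A, hA0, hA⟩ := exists_excProb_le (Q := Q) (W := W) hα hr hW ha m
  obtain ⟨M, hM, hMA⟩ : ∃ M : ℝ, 0 ≤ M ∧ A * Real.exp (-M) ≤ 1 := by
    have h1 : Tendsto (fun M : ℝ => A * Real.exp (-M)) atTop (𝓝 0) := by
      simpa using Real.tendsto_exp_neg_atTop_nhds_zero.const_mul A
    obtain ⟨M, h2, h3⟩ := ((h1.eventually (gt_mem_nhds one_pos)).and (eventually_ge_atTop 0)).exists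
    exact ⟨M, h3, h2.le⟩
  obtain ⟨θ, hθ, hθA⟩ : ∃ θ : ℝ, 0 < θ ∧ (Real.exp (2 * θ) - 1) * (1 + A) ≤ 1 := by
    have hlim : Tendsto (fun θ : ℝ => (Real.exp (2 * θ) - 1) * (1 + A)) (𝓝[>] 0) (𝓝 0) := by
      have hcont : Continuous fun θ : ℝ => (Real.exp (2 * θ) - 1) * (1 + A) := by fun_prop
      have := hcont.tendsto 0
      simp only [mul_zero, Real.exp_zero, sub_self, zero_mul] at this
      exact this.mono_left nhdsWithin_le_nhds
    obtain ⟨θ, h1, h2⟩ := ((hlim.eventually (gt_mem_nhds one_pos)).and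
      self_mem_nhdsWithin).exists
    exact ⟨θ, h2, h1.le⟩
  set N : ℝ := (Fintype.card (Fin d → Fin m) : ℝ)
  have hN : 0 ≤ N := Nat.cast_nonneg _
  obtain ⟨η, hη, hηθ, hηM⟩ : ∃ η : ℝ, 0 < η ∧ η ≤ θ / 2 ∧
      2 * (N * ((N + 1) * η / (θ / 2) ^ 2)) * Real.exp M ≤ 1 := by
    have hlim : Tendsto (fun η : ℝ => 2 * (N * ((N + 1) * η / (θ / 2) ^ 2)) * Real.exp M)
        (𝓝[>] 0) (𝓝 0) := by
      have hcont : Continuous fun η : ℝ =>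
          2 * (N * ((N + 1) * η / (θ / 2) ^ 2)) * Real.exp M := by fun_prop
      have := hcont.tendsto 0
      simp only [mul_zero, zero_mul, zero_div] at this
      exact this.mono_left nhdsWithin_le_nhds
    obtain ⟨η, h1, h2, h3⟩ := ((hlim.eventually (gt_mem_nhds one_pos)).and
      (Ioo_mem_nhdsGT (half_pos hθ))).exists
    exact ⟨η, h2, h3.le, h1.le⟩
  -- A covariance entry is half a combination of three radial values, so an error of 2η/3 in each
  -- gives η. The radius is doubled because differences of grid points occur.
  obtain ⟨ε, hε, h⟩ := hr.exists_abs_radial_sub_le hα (2 * (d * (a * m)))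
    (show 0 < 2 / 3 * η by positivity)
  refine ⟨ε, hε, fun t ht s hs hst => ?_⟩
  have hWt := hW t ht
  have hWs := hW s hs
  have := hWt.isProbabilityMeasure_gridLaw ha.le m
  have := hWs.isProbabilityMeasure_gridLaw ha.le m
  have hle : ∀ k : Fin d → Fin m, |radial α (r t) (gridPoint a k)
      - radial α (r s) (gridPoint a k)| ≤ 2 / 3 * η := fun k =>
    h t ht s hs hst _ (by
      have := norm_gridPoint_le ha.le k
      have := norm_nonneg (gridPoint a k)
      linarith)
  have hle2 : ∀ k j : Fin d → Fin m, |radial α (r t) (gridPoint a k - gridPoint a j)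
      - radial α (r s) (gridPoint a k - gridPoint a j)| ≤ 2 / 3 * η := fun k j =>
    h t ht s hs hst _ (by
      have := norm_gridPoint_le ha.le k
      have := norm_gridPoint_le ha.le j
      have := norm_sub_le (gridPoint a k) (gridPoint a j)
      linarith)
  have hprob : ∀ y, excProb (gridLaw (W s) (Q s) a m) Finset.univ y
      ≤ excProb (gridLaw (W t) (Q t) a m) Finset.univ (y - 2 * θ)
        + 2 * (N * ((N + 1) * η / (θ / 2) ^ 2)) := by
    intro y
    rw [hWs.excProb_eq_multivariateGaussian ha.le, hWt.excProb_eq_multivariateGaussian ha.le]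
    refine multivariateGaussian_exists_lt_le (hWt.gridLaw_spec ha.le m).1
      (hWs.gridLaw_spec ha.le m).1 hη.le hθ hηθ (fun k => ?_) (fun k j => ?_) _ _
    · have := abs_le.1 (hle k)
      simp only [gridMean]
      rw [abs_le]
      constructor <;> linarith
    · have h1 := abs_le.1 (hle k)
      have h2 := abs_le.1 (hle j)
      have h3 := abs_le.1 (hle2 k j)
      simp only [gridCov, Matrix.of_apply]
      rw [abs_le]
      constructor <;> linarith
  -- The four units: the additive 1 of this bound, the factor e^{2θ}, the Gaussian comparison error
  -- up to M, and the tail beyond M.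
  have hmain := excMean_le_of_excProb_le hM hθ.le (by positivity)
    (fun y _ => hA t ht Finset.univ y) (fun y _ => hA s hs Finset.univ y) hprob
  have h1 := excMean_le fun y _ => hA t ht Finset.univ y
  have h2 : 0 ≤ Real.exp (2 * θ) - 1 := by linarith [Real.one_le_exp (show 0 ≤ 2 * θ by linarith)]
  have h3 := mul_le_mul_of_nonneg_left h1 h2
  linarith

/-- At a fixed scale, `H_K` varies slowly in `t`, as soon as it is well approximated on a grid. -/
lemma exists_abs_HK_sub_le (hα : 0 < α) (hr : IsShape r T)
    (hW : ∀ t ∈ T, IsLimitField α (r t) (W t) (Q t)) {T₁ : Set (Space d)} (hT : T₁ ⊆ T)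
    {K : ℝ} (hK : 0 < K) {m : ℕ} (hm : 0 < m)
    (h : ∀ t ∈ T₁, |(HK (W t) (Q t) K).toReal
      - excMean (gridLaw (W t) (Q t) (K / m) m) Finset.univ| ≤ 2) :
    ∃ ε > 0, ∀ t ∈ T₁, ∀ s ∈ T₁, ‖s - t‖ < ε →
      |(HK (W s) (Q s) K).toReal - (HK (W t) (Q t) K).toReal| ≤ 8 := by
  obtain ⟨ε, hε, hmain⟩ := exists_excMean_le_add_four hα hr hW
    (show 0 < K / m by positivity) m
  refine ⟨ε, hε, fun t ht s hs hst => ?_⟩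
  -- The total 8 is 2 + 4 + 2: pass to the grid at both points and move the base point in between.
  have h1 := hmain t (hT ht) s (hT hs) hst
  have h2 := hmain s (hT hs) t (hT ht) (by rwa [norm_sub_rev])
  have h3 := abs_le.1 (h t ht)
  have h4 := abs_le.1 (h s hs)
  rw [abs_le]
  constructor <;> linarith

end Continuity

/-- Base points get shifted by small vectors; the estimates must be available at the shifted points,
which calls for an intermediate domain. -/
lemma IsInner.exists_between {d : ℕ} {T₁ T : Set (Space d)} (h : IsInner T₁ T) :
    ∃ T₂, IsInner T₁ T₂ ∧ IsInner T₂ T := by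
  obtain ⟨η, hη, h⟩ := h
  refine ⟨{x | ∃ t ∈ T₁, ‖x - t‖ < η / 2}, ⟨η / 2, half_pos hη, fun t ht v hv =>
    ⟨t, ht, by simpa using hv⟩⟩, η / 2, half_pos hη, ?_⟩
  rintro x ⟨t, ht, hx⟩ v hv
  have h1 : x + v = t + (x - t + v) := by abel
  rw [h1]
  refine h t ht _ ((norm_add_le _ _).trans_lt (by linarith))

/-- After standardisation the threshold is (1 + σ/2)/√σ, at most R on the given range, so a standard
normal tail serves for all σ at once. -/
lemma exists_le_gaussianReal_Ioi {s S : ℝ} (hs : 0 < s) :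
    ∃ κ > 0, ∀ σ ∈ Icc s S, κ ≤ (gaussianReal (-σ / 2) σ.toNNReal).real (Ioi 1) := by
  set R := (1 + S / 2) / √s
  have hpos : 0 < (gaussianReal 0 1).real (Ioi R) := by
    rw [measureReal_def, ENNReal.toReal_pos_iff]
    refine ⟨pos_iff_ne_zero.2 fun h => ?_, measure_lt_top _ _⟩
    have := gaussianReal_absolutelyContinuous' 0 one_ne_zero h
    simp at this
  refine ⟨_, hpos, fun σ hσ => ?_⟩
  have hσ0 : 0 < σ := hs.trans_le hσ.1
  have hmap : (gaussianReal 0 1).map (fun x => -σ / 2 + √σ * x)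
      = gaussianReal (-σ / 2) σ.toNNReal := by
    have h1 := gaussianReal_map_const_mul (μ := 0) (v := 1) (√σ)
    have h2 := gaussianReal_map_const_add (μ := √σ * 0)
      (v := .mk (√σ ^ 2) (sq_nonneg _) * 1) (-σ / 2)
    rw [← h1, Measure.map_map (by fun_prop) (by fun_prop)] at h2
    refine h2.trans ?_
    congr 1
    · ring
    · ext
      simp [Real.sq_sqrt hσ0.le, hσ0.le]
  rw [← hmap, map_measureReal_apply (by fun_prop) measurableSet_Ioi]
  refine measureReal_mono (fun x (hx : R < x) => ?_) (measure_ne_top _ _)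
  change 1 < -σ / 2 + √σ * x
  have h1 : √s ≤ √σ := Real.sqrt_le_sqrt hσ.1
  have h2 : 0 < √s := Real.sqrt_pos.2 hs
  have hS : 0 ≤ S := hσ0.le.trans hσ.2
  have h3 : 1 + S / 2 < √s * x := by
    have := (div_lt_iff₀ h2).1 hx
    linarith
  have h4 : 0 < x := lt_of_le_of_lt (by positivity) hx
  have h5 : √s * x ≤ √σ * x := by gcongr
  have := hσ.2
  linarith

/-! ### Lower bounds of the right order. -/

section Positivity

variable {d : ℕ} {Ω : ℝ → Type*} [∀ c, MeasurableSpace (Ω c)]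
  {P : (c : ℝ) → Measure (Ω c)} [∀ c, IsProbabilityMeasure (P c)]
  {X : (c : ℝ) → Space d → Ω c → ℝ}
  {Ω' : Space d → Type*} [∀ t, MeasurableSpace (Ω' t)]
  {Q : (t : Space d) → Measure (Ω' t)} [∀ t, IsProbabilityMeasure (Q t)]
  {W : (t : Space d) → Space d → Ω' t → ℝ}
  {T T₁ : Set (Space d)} {α : ℝ} {Δ : ℝ → ℝ} {r : Space d → Space d → ℝ}

/-- The variance of the limit field is bounded below, uniformly in `t`, at a suitable point. -/
lemma exists_le_radial (hα : 0 < α) (hd : 0 < d)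
    (hW : ∀ t ∈ T, IsLimitField α (r t) (W t) (Q t)) (hX : Standardized X P T)
    (hA1 : CondA1 X P T) (hA2 : CondA2 X P T Δ W Q) (hA5 : HasPairBound X P T Δ)
    (hΔ0 : Tendsto Δ atTop (𝓝 0)) (hT : IsInner T₁ T) :
    ∃ a > 0, ∀ t ∈ T₁, 1 / 64 ≤ radial α (r t) (gridPoint a fun _ : Fin d => (1 : Fin 2)) := by
  obtain ⟨p, hp, C, hC, h5⟩ := hA5
  obtain ⟨a, ha, haC⟩ : ∃ a : ℝ, 0 < a ∧ C * Real.exp (2 - a ^ p) ≤ 1 / 16 := by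
    have h1 : Tendsto (fun a : ℝ => C * (Real.exp 2 * Real.exp (-a ^ p))) atTop (𝓝 0) := by
      simpa using ((Real.tendsto_exp_neg_atTop_nhds_zero.comp
        (tendsto_rpow_atTop hp)).const_mul (Real.exp 2)).const_mul C
    obtain ⟨a, h2, h3⟩ := ((h1.eventually (gt_mem_nhds (show (0 : ℝ) < 1 / 16 by norm_num))).and
      (eventually_gt_atTop 0)).exists
    refine ⟨a, h3, ?_⟩
    rw [sub_eq_add_neg, Real.exp_add]
    exact h2.le
  refine ⟨a, ha, fun t ht => ?_⟩
  set k : Fin d → Fin 2 := fun _ => 1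
  set u := gridPoint a k with hu
  have hWt := hW t (hT.subset ht)
  have hu0 : u ∈ orthant d := gridPoint_mem_orthant ha.le k
  have hnorm : a ≤ ‖u‖ := by
    have h1 := abs_apply_le_norm u ⟨0, hd⟩
    rw [hu, gridPoint_apply] at h1
    simpa [k, abs_of_pos ha] using h1
  have := hWt.isProbabilityMeasure_gridLaw ha.le 2
  obtain ⟨c, h1, h2, h3, h5, h6, hc⟩ := ((hA1.eventually_abs_sub_le one_pos
    (show (0 : ℝ) < 1 / 32 by norm_num)).and ((hA2.eventually_ramp hΔ0 hT hW ha two_pos {k}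
      (Finset.singleton_nonempty k) (-(1 / 2)) (1 / 2) one_pos
      (show (0 : ℝ) < 1 / 4 by norm_num)).and (hX.and (h5.and
      ((hT.eventually_add_mem hΔ0 (d * (a * (2 : ℕ)))).and (eventually_ge_atTop 2)))))).exists
  have hc0 : 0 < c := by linarith
  have hψ := psi_pos hc0
  have htT := hT.subset ht
  have hmem : ∀ j : Fin d → Fin 2, t + Δ c • gridPoint a j ∈ T := fun j =>
    h6 t ht _ (norm_gridPoint_le ha.le j)
  have hbin := (abs_le.1 (abs_measureReal_bin_sub_le (h3 t htT).1 hc0 (h1 t htT)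
    (show (0 : ℝ) < 1 / 2 by norm_num) (show (1 / 2 : ℝ) ≤ 1 by norm_num) le_rfl)).1
  have hlow := le_measureReal_bin_inter (P := P c) (X := X c t)
    (Z := fun j : Fin d → Fin 2 => X c (t + Δ c • gridPoint a j))
    (h3 t htT).1 (fun j => (h3 _ (hmem j)).1) hc0
    (gridLaw (W t) (Q t) a 2) (S := {k}) (Finset.singleton_nonempty k) (γ := 2) (y := 1 / 2)
    (y' := 1) (z := -(1 / 2)) (h := 1 / 2) (e := 1 / 4) (by norm_num) (by norm_num)
    (B := Ico (c - 1 / c) c)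
    (fun x hx => ⟨hx.1.le, hx.2.trans_lt (sub_lt_self _ (by positivity))⟩) (h2 t ht)
  have hpair := h5 2 ⟨by norm_num, hc⟩ t htT u (hmem k)
  have hsub : (P c).real (X c t ⁻¹' Ioc (c - 1 / c) (c - 1 / 2 / c) ∩
      {ω | ∃ j ∈ ({k} : Finset (Fin d → Fin 2)), c - 2 / c < X c (t + Δ c • gridPoint a j) ω})
      ≤ C * Real.exp (2 - ‖u‖ ^ p) * psi c := by
    refine (measureReal_mono ?_ (measure_ne_top _ _)).trans hpair
    rintro ω ⟨hω1, j, hj, hω2⟩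
    rw [Finset.mem_singleton] at hj
    subst hj
    refine ⟨lt_of_le_of_lt ?_ hω1.1, hω2⟩
    have : 1 / c ≤ 2 / c := by gcongr; norm_num
    linarith
  have hpow : C * Real.exp (2 - ‖u‖ ^ p) ≤ 1 / 16 := by
    refine le_trans ?_ haC
    gcongr
  have hexp : Real.exp (1 / 2) + 1 / 2 + 1 / 16 ≤ Real.exp 1 := by
    have h7 : Real.exp 1 = Real.exp (1 / 2) ^ 2 := by
      rw [← Real.exp_nat_mul]; norm_num
    have h8 := Real.exp_one_gt_d9
    have h9 := Real.exp_pos (1 / 2)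
    nlinarith
  -- If W_t(u) > -1/2 were likely, then X starting between c - 1/c and c - 1/(2c), an event of
  -- probability at least ψ(c)/2, would often stay above c - 2/c at the distant point. The pair
  -- bound allows this only with probability ψ(c)/16.
  have hprob : excProb (gridLaw (W t) (Q t) a 2) {k} (-(1 / 2)) ≤ 3 / 8 := by
    by_contra! hcon
    have h7 : 1 / 2 * psi c ≤ (P c).real (X c t ⁻¹' Ioc (c - 1 / c) (c - 1 / 2 / c)) := by
      nlinarith
    have h8 : 1 / 16 * psi c < 1 / 2 * psi c *
        (excProb (gridLaw (W t) (Q t) a 2) {k} (-(1 / 2)) - 1 / 4) := by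
      nlinarith
    have h9 : 1 / 2 * psi c * (excProb (gridLaw (W t) (Q t) a 2) {k} (-(1 / 2)) - 1 / 4)
        ≤ (P c).real (X c t ⁻¹' Ioc (c - 1 / c) (c - 1 / 2 / c)) *
          (excProb (gridLaw (W t) (Q t) a 2) {k} (-(1 / 2)) - 1 / 4) :=
      mul_le_mul_of_nonneg_right h7 (by linarith)
    have h10 := mul_le_mul_of_nonneg_right hpow hψ.le
    linarith
  -- With variance below 1/64 the mean lies above -1/128, and Chebyshev's inequality gives W_t(u) ≤
  -- -1/2 probability less than 1/4. Together with 3/8 this does not reach 1.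
  by_contra! hσ
  have hmemLp : MemLp (W t u) 2 (Q t) := (hWt.gaussian.hasGaussianLaw_eval ⟨u, hu0⟩).memLp_two
  have hcheb := meas_ge_le_variance_div_sq hmemLp (show (0 : ℝ) < 1 / 4 by norm_num)
  rw [hWt.variance hα hu0, hWt.mean u hu0] at hcheb
  have hσ0 := hWt.radial_nonneg hα hu0
  have h7 : (Q t).real {ω | 1 / 4 ≤ |W t u ω - -radial α (r t) u / 2|}
      ≤ radial α (r t) u / (1 / 4) ^ 2 :=
    ENNReal.toReal_le_of_le_ofReal (by positivity) hcheb
  rw [hWt.excProb_gridLaw ha.le] at hprob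
  have h8 : (1 : ℝ) ≤ (Q t).real {ω | ∃ j ∈ ({k} : Finset (Fin d → Fin 2)),
      -(1 / 2) < W t (gridPoint a j) ω}
      + (Q t).real {ω | 1 / 4 ≤ |W t u ω - -radial α (r t) u / 2|} := by
    have h9 : (Q t).real univ = 1 := by simp
    refine h9.symm.le.trans ((measureReal_mono (fun ω _ => ?_) (measure_ne_top _ _)).trans
      (measureReal_union_le _ _))
    by_cases hω : -(1 / 2) < W t u ω
    · exact Or.inl ⟨k, Finset.mem_singleton_self k, hω⟩
    · refine Or.inr ?_
      change 1 / 4 ≤ |W t u ω - -radial α (r t) u / 2|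
      rw [le_abs]
      right
      linarith
  have h9 : radial α (r t) u / (1 / 4) ^ 2 = 16 * radial α (r t) u := by ring
  rw [h9] at h7
  have h10 := h8.trans (add_le_add hprob h7)
  linarith

/-- A lower bound for the exceedance probability at a point. -/
lemma exists_le_measureReal_lt (hα : 0 < α) (hd : 0 < d) (hr : IsShape r T)
    (hW : ∀ t ∈ T, IsLimitField α (r t) (W t) (Q t)) (hX : Standardized X P T)
    (hA1 : CondA1 X P T) (hA2 : CondA2 X P T Δ W Q) (hA5 : HasPairBound X P T Δ)
    (hΔ0 : Tendsto Δ atTop (𝓝 0)) (hT : IsInner T₁ T) :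
    ∃ κ > 0, ∀ᶠ c in atTop, ∀ t ∈ T₁, κ * psi c ≤ (P c).real {ω | c < X c t ω} := by
  obtain ⟨T₂, hT₁₂, hT₂⟩ := hT.exists_between
  obtain ⟨a, ha, hrad⟩ := exists_le_radial hα hd hW hX hA1 hA2 hA5 hΔ0 hT₂
  set k : Fin d → Fin 2 := fun _ => 1
  set u := gridPoint a k with hu
  have hu0 : u ∈ orthant d := gridPoint_mem_orthant ha.le k
  obtain ⟨s, hs0, hs⟩ := hr.exists_radial_le hα ‖u‖
  obtain ⟨κ, hκ, hgauss⟩ := exists_le_gaussianReal_Ioi (s := 1 / 64) (S := s) (by norm_num)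
  obtain ⟨A, hA0, hA⟩ := exists_excProb_le (Q := Q) (W := W) hα hr hW ha 2
  have hmean : ∀ t ∈ T₂, κ ≤ excMean (gridLaw (W t) (Q t) a 2) {k} := by
    intro t ht
    have htT := hT₂.subset ht
    have hWt := hW t htT
    have := hWt.isProbabilityMeasure_gridLaw ha.le 2
    have h1 : κ ≤ excProb (gridLaw (W t) (Q t) a 2) {k} 1 := by
      refine (hgauss _ ⟨hrad t ht, hs t htT u le_rfl⟩).trans (le_of_eq ?_)
      rw [← hWt.map_eq hα hu0, map_measureReal_apply_of_aemeasurable (hWt.aemeasurable hu0)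
        measurableSet_Ioi, hWt.excProb_gridLaw ha.le]
      congr 1
      ext ω
      simp [← hu]
    have hanti := excProb_antitone (gridLaw (W t) (Q t) a 2) {k}
    have h0 := excProb_nonneg (gridLaw (W t) (Q t) a 2) {k}
    rw [excMean, setIntegral_exp_mul_eq hanti h0 (fun y _ => hA t htT {k} y) zero_le_one]
    have h2 := le_integral_exp_mul hanti (zero_le_one' ℝ)
    have h3 : 0 ≤ ∫ y in Ioi (1 : ℝ), Real.exp y * excProb (gridLaw (W t) (Q t) a 2) {k} y :=
      integral_nonneg fun y => mul_nonneg (Real.exp_pos y).le (h0 y)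
    rw [Real.exp_zero] at h2
    have h4 := Real.add_one_le_exp 1
    nlinarith [h0 1]
  refine ⟨κ / 2, half_pos hκ, ?_⟩
  filter_upwards [eventually_le_grid hα hr hW hX hA1 hA2 hΔ0 hT₂ ha two_pos {k}
    (Finset.singleton_nonempty k) (half_pos hκ), hT₁₂.eventually_add_mem hΔ0 ‖u‖,
    eventually_gt_atTop 0] with c h1 h2 hc t ht
  have hψ := psi_pos hc
  -- The grid estimate is applied at the base point t - Δu with the single grid point u, so that the
  -- grid point lands on t. Unlike (A1), this concerns the level c itself.
  have h3 : t - Δ c • u ∈ T₂ := by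
    have := h2 t ht (-u) (by simp)
    simpa [sub_eq_add_neg] using this
  have h4 := h1 _ h3
  have h5 := hmean _ h3
  refine le_trans (mul_le_mul_of_nonneg_right ?_ hψ.le)
    (h4.trans (measureReal_mono ?_ (measure_ne_top _ _)))
  · linarith
  · rintro ω ⟨j, hj, hω⟩
    rw [Finset.mem_singleton] at hj
    subst hj
    simpa [← hu] using hω

/-- The stretched exponential is dominated by a summable power of 1 + ‖k‖ with a constant of order
b^{-pM}, which tends to 0 as the spacing b grows. -/
lemma exists_sum_exp_neg_le (d : ℕ) {p ε : ℝ} (hp : 0 < p) (hε : 0 < ε) :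
    ∃ b : ℝ, 0 < b ∧ ∀ F : Finset (Fin d → ℤ), 0 ∉ F →
      ∑ k ∈ F, Real.exp (-(b * ‖k‖) ^ p) ≤ ε := by
  set n := 2 * d + 1
  obtain ⟨M, hM⟩ := exists_nat_ge ((n : ℝ) / p)
  have hM' : (n : ℝ) ≤ p * M := by rw [div_le_iff₀ hp] at hM; linarith
  have hpM : 0 < p * M := lt_of_lt_of_le (by positivity) hM'
  set c₀ : ℝ := M.factorial * (2 ^ M * 2 ^ n) * 4 ^ d
  obtain ⟨b, hb, hbε⟩ : ∃ b : ℝ, 0 < b ∧ c₀ * (b ^ (p * M))⁻¹ ≤ ε := by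
    have h1 : Tendsto (fun b : ℝ => c₀ * (b ^ (p * M))⁻¹) atTop (𝓝 0) := by
      simpa using (tendsto_rpow_atTop hpM).inv_tendsto_atTop.const_mul c₀
    obtain ⟨b, h2, h3⟩ := ((h1.eventually (gt_mem_nhds hε)).and (eventually_gt_atTop 0)).exists
    exact ⟨b, h3, h2.le⟩
  refine ⟨b, hb, fun F hF => ?_⟩
  have hone : ∀ k ∈ F, (1 : ℝ) ≤ ‖k‖ := by
    intro k hk
    have h0 : k ≠ 0 := fun h => hF (h ▸ hk)
    obtain ⟨i, hi⟩ := Function.ne_iff.1 h0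
    refine le_trans ?_ (norm_le_pi_norm k i)
    rw [Int.norm_eq_abs]
    exact_mod_cast Int.one_le_abs hi
  calc ∑ k ∈ F, Real.exp (-(b * ‖k‖) ^ p)
      ≤ ∑ k ∈ F, M.factorial * (2 ^ M * 2 ^ n * (b ^ (p * M))⁻¹) * ((1 + ‖k‖) ^ n)⁻¹ := by
        refine Finset.sum_le_sum fun k hk => ?_
        have hk1 := hone k hk
        have hy : 0 < (b * ‖k‖) ^ p / 2 := by positivity
        calc Real.exp (-(b * ‖k‖) ^ p) ≤ Real.exp (-((b * ‖k‖) ^ p / 2)) :=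
              Real.exp_le_exp.2 (by linarith)
          _ ≤ M.factorial * (((b * ‖k‖) ^ p / 2) ^ M)⁻¹ := exp_neg_le_factorial_mul_inv hy M
          _ ≤ M.factorial * (2 ^ M * 2 ^ n * (b ^ (p * M))⁻¹ * ((1 + ‖k‖) ^ n)⁻¹) := by
              gcongr
              exact inv_half_rpow_pow_le hb hM' hk1
          _ = _ := by ring
    _ = M.factorial * (2 ^ M * 2 ^ n * (b ^ (p * M))⁻¹) * ∑ k ∈ F, ((1 + ‖k‖) ^ n)⁻¹ := by
        rw [Finset.mul_sum]
    _ ≤ M.factorial * (2 ^ M * 2 ^ n * (b ^ (p * M))⁻¹) * (4 ^ d * (1 + 0)⁻¹) := by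
        gcongr
        exact sum_inv_one_add_norm_pow_le F le_rfl fun k _ => norm_nonneg k
    _ = c₀ * (b ^ (p * M))⁻¹ := by simp only [c₀]; ring
    _ ≤ ε := hbε

/-- A lower bound of the right order for the probability of exceedance on a cube. -/
lemma exists_le_measureReal_cube (hα : 0 < α) (hd : 0 < d) (hr : IsShape r T)
    (hW : ∀ t ∈ T, IsLimitField α (r t) (W t) (Q t)) (hX : Standardized X P T)
    (hA1 : CondA1 X P T) (hA2 : CondA2 X P T Δ W Q) (hA5 : HasPairBound X P T Δ)
    (hΔ : ∀ᶠ c in atTop, 0 < Δ c) (hΔ0 : Tendsto Δ atTop (𝓝 0)) (hT : IsInner T₁ T) :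
    ∃ κ > 0, ∃ η > 0, ∀ᶠ c in atTop, ∀ K > 0, K * Δ c ≤ η → ∀ t ∈ T₁,
      κ * (K ^ d * psi c) ≤ (P c).real {ω | ∃ u ∈ cube t (K * Δ c), c < X c u ω} := by
  classical
  obtain ⟨T₂, hT₁₂, hT₂⟩ := hT.exists_between
  obtain ⟨κ, hκ, hpt⟩ := exists_le_measureReal_lt hα hd hr hW hX hA1 hA2 hA5 hΔ0 hT₂
  obtain ⟨η, hη, hT₁₂⟩ := hT₁₂
  obtain ⟨p, hp, C, hC, h5⟩ := hA5
  -- The spacing is so wide that the pair terms of each point cost at most half of its own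
  -- probability κψ(c). The factor e comes from using the pair bound with γ = 1.
  obtain ⟨b, hb, hsum⟩ := exists_sum_exp_neg_le d hp
    (show 0 < κ / 2 / (C * Real.exp 1) by positivity)
  refine ⟨κ / 2 / b ^ d, by positivity, η / (2 * d), by positivity, ?_⟩
  filter_upwards [hpt, h5, hX, hΔ, eventually_ge_atTop 1] with c hpt h5 hX hΔc hc K hK hKη t ht
  have hψ := psi_pos (show 0 < c by linarith)
  set n := ⌈K / b⌉₊ with hn
  have hn1 : K / b ≤ n := Nat.le_ceil _
  have hn2 : ∀ i : Fin n, b * (i : ℝ) < K := by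
    intro i
    have h1 : ((i : ℕ) : ℝ) + 1 ≤ n := by exact_mod_cast i.2
    have h2 : (n : ℝ) < K / b + 1 := Nat.ceil_lt_add_one (by positivity)
    have h3 : (i : ℝ) < K / b := by linarith
    rw [lt_div_iff₀ hb] at h3
    linarith
  set τ : (Fin d → Fin n) → Space d := fun k => t + Δ c • gridPoint b k with hτ
  have hcube : ∀ k, τ k ∈ cube t (K * Δ c) := by
    intro k i
    have h1 : τ k i = t i + Δ c * (b * (k i : ℝ)) := rfl
    have h2 := hn2 (k i)
    rw [h1]
    constructor
    · have : 0 ≤ Δ c * (b * (k i : ℝ)) := by positivity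
      linarith
    · have := mul_lt_mul_of_pos_left h2 hΔc
      linarith
  have hT₂' : ∀ k, τ k ∈ T₂ := by
    intro k
    refine hT₁₂ t ht _ ?_
    have h1 : ‖Δ c • gridPoint b k‖ ≤ d * (K * Δ c) := by
      refine norm_le_mul_of_abs_le fun i => ?_
      have h2 : (Δ c • gridPoint b k) i = Δ c * (b * (k i : ℝ)) := rfl
      rw [h2, abs_of_nonneg (by positivity)]
      have := mul_lt_mul_of_pos_left (hn2 (k i)) hΔc
      linarith
    have hd' : (0 : ℝ) < d := by exact_mod_cast hd
    have h3 : (d : ℝ) * (K * Δ c) ≤ η / 2 := by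
      calc (d : ℝ) * (K * Δ c) ≤ d * (η / (2 * d)) := by gcongr
        _ = η / 2 := by field_simp
    linarith
  have hTτ : ∀ k, τ k ∈ T := fun k => hT₂.subset (hT₂' k)
  set A : (Fin d → Fin n) → Set (Ω c) := fun k => {ω | c < X c (τ k) ω} with hA
  have hpairs : ∀ k ∈ (Finset.univ : Finset (Fin d → Fin n)),
      ∑ j ∈ Finset.univ.erase k, (P c).real (A k ∩ A j) ≤ κ / 2 * psi c := by
    intro k _
    set diff : (Fin d → Fin n) → (Fin d → ℤ) := fun j i => ((j i : ℕ) : ℤ) - ((k i : ℕ) : ℤ)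
      with hdiff
    have hinj : Function.Injective diff := by
      intro j j' h
      ext i
      have := congrFun h i
      simp only [hdiff] at this
      omega
    have h1 : ∀ j, (P c).real (A k ∩ A j)
        ≤ C * Real.exp 1 * psi c * Real.exp (-(b * ‖diff j‖) ^ p) := by
      intro j
      have h2 : τ j = τ k + Δ c • latticePoint b (diff j) := by
        ext i
        have h3 : τ j i = t i + Δ c * (b * (j i : ℝ)) := rfl
        have h4 : (τ k + Δ c • latticePoint b (diff j)) i
          = t i + Δ c * (b * (k i : ℝ)) + Δ c * (b * (diff j i : ℝ)) := rfl
        rw [h3, h4, hdiff]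
        push_cast
        ring
      have h3 := h5 1 ⟨one_pos, hc⟩ (τ k) (hTτ k) (latticePoint b (diff j)) (h2 ▸ hTτ j)
      rw [← h2] at h3
      have h4 : A k ∩ A j ⊆ {ω | c - 1 / c < X c (τ k) ω ∧ c - 1 / c < X c (τ j) ω} := by
        rintro ω ⟨hω1, hω2⟩
        have h6 : 0 ≤ 1 / c := by positivity
        have h7 : c < X c (τ k) ω := hω1
        have h8 : c < X c (τ j) ω := hω2
        exact ⟨by linarith, by linarith⟩
      refine (measureReal_mono h4 (measure_ne_top _ _)).trans (h3.trans ?_)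
      have h5 : Real.exp (1 - ‖latticePoint b (diff j)‖ ^ p)
          ≤ Real.exp 1 * Real.exp (-(b * ‖diff j‖) ^ p) := by
        rw [← Real.exp_add, ← sub_eq_add_neg]
        have := mul_norm_le_norm_latticePoint hb.le (diff j)
        gcongr
      calc _ ≤ C * (Real.exp 1 * Real.exp (-(b * ‖diff j‖) ^ p)) * psi c := by gcongr
        _ = _ := by ring
    calc ∑ j ∈ Finset.univ.erase k, (P c).real (A k ∩ A j)
        ≤ ∑ j ∈ Finset.univ.erase k,
            C * Real.exp 1 * psi c * Real.exp (-(b * ‖diff j‖) ^ p) :=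
          Finset.sum_le_sum fun j _ => h1 j
      _ = C * Real.exp 1 * psi c * ∑ q ∈ (Finset.univ.erase k).image diff,
            Real.exp (-(b * ‖q‖) ^ p) := by
          rw [Finset.sum_image hinj.injOn, Finset.mul_sum]
      _ ≤ C * Real.exp 1 * psi c * (κ / 2 / (C * Real.exp 1)) := by
          gcongr
          refine hsum _ fun h => ?_
          obtain ⟨j, hj, hj0⟩ := Finset.mem_image.1 h
          refine (Finset.mem_erase.1 hj).1 (hinj ?_)
          rw [hj0]
          ext i
          simp [hdiff]
      _ = κ / 2 * psi c := by field_simp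
  have hbonf := sum_measureReal_le_pairs (P c) Finset.univ A fun k _ =>
    measurableSet_lt measurable_const (hX _ (hTτ k)).1
  have hcard : ((Finset.univ : Finset (Fin d → Fin n)).card : ℝ) = (n : ℝ) ^ d := by
    rw [Finset.card_univ, Fintype.card_fun, Fintype.card_fin, Fintype.card_fin]
    push_cast
    rfl
  have hlow : (n : ℝ) ^ d * (κ * psi c) ≤ ∑ k, (P c).real (A k) := by
    rw [← hcard, ← nsmul_eq_mul]
    exact Finset.card_nsmul_le_sum _ _ _ fun k _ => hpt _ (hT₂' k)
  have hup : ∑ k, ∑ j ∈ Finset.univ.erase k, (P c).real (A k ∩ A j)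
      ≤ (n : ℝ) ^ d * (κ / 2 * psi c) := by
    rw [← hcard, ← nsmul_eq_mul]
    exact Finset.sum_le_card_nsmul _ _ _ hpairs
  have hunion : (P c).real (⋃ k ∈ (Finset.univ : Finset (Fin d → Fin n)), A k)
      ≤ (P c).real {ω | ∃ u ∈ cube t (K * Δ c), c < X c u ω} := by
    refine measureReal_mono (fun ω hω => ?_) (measure_ne_top _ _)
    simp only [mem_iUnion] at hω
    obtain ⟨k, -, hk⟩ := hω
    exact ⟨τ k, hcube k, hk⟩
  have hpow : (K / b) ^ d ≤ (n : ℝ) ^ d := by gcongr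
  calc κ / 2 / b ^ d * (K ^ d * psi c) = (K / b) ^ d * (κ / 2 * psi c) := by
        rw [div_pow]; field_simp
    _ ≤ (n : ℝ) ^ d * (κ / 2 * psi c) := by gcongr
    _ ≤ _ := by linarith

end Positivity

/-! ### Partition of a cube into blocks. -/

section Blocks

variable {d : ℕ} {t : Space d} {K Δ l : ℝ} {n : ℕ}

lemma add_smul_gridPoint_apply (t : Space d) (Δ K : ℝ) (b : Fin d → Fin n) (i : Fin d) :
    (t + Δ • gridPoint K b) i = t i + Δ * (K * (b i : ℝ)) := rfl

lemma exists_mem_cube_block (hK : 0 < K) (hΔ : 0 < Δ) (hn : l / K < n) {v : Space d}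
    (hv : v ∈ cube t (l * Δ)) :
    ∃ b : Fin d → Fin n, v ∈ cube (t + Δ • gridPoint K b) (K * Δ) := by
  have hpos : 0 < K * Δ := by positivity
  have h0 : ∀ i, 0 ≤ (v i - t i) / (K * Δ) := fun i =>
    div_nonneg (by linarith [(hv i).1]) hpos.le
  have hlt : ∀ i, ⌊(v i - t i) / (K * Δ)⌋₊ < n := by
    intro i
    rw [Nat.floor_lt (h0 i)]
    refine lt_of_lt_of_le ?_ hn.le
    rw [div_lt_div_iff₀ hpos hK]
    have := (hv i).2
    nlinarith
  refine ⟨fun i => ⟨_, hlt i⟩, fun i => ?_⟩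
  rw [add_smul_gridPoint_apply]
  have h1 := Nat.floor_le (h0 i)
  have h2 := Nat.lt_floor_add_one ((v i - t i) / (K * Δ))
  rw [le_div_iff₀ hpos] at h1
  rw [div_lt_iff₀ hpos] at h2
  constructor
  · change t i + Δ * (K * (⌊(v i - t i) / (K * Δ)⌋₊ : ℝ)) ≤ v i
    linarith
  · change v i < t i + Δ * (K * (⌊(v i - t i) / (K * Δ)⌋₊ : ℝ)) + K * Δ
    linarith

lemma cube_block_subset (hK : 0 < K) (hΔ : 0 < Δ) (hn : n ≤ l / K) (b : Fin d → Fin n) :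
    cube (t + Δ • gridPoint K b) (K * Δ) ⊆ cube t (l * Δ) := by
  intro v hv i
  have h1 := hv i
  rw [add_smul_gridPoint_apply] at h1
  have h2 : ((b i : ℕ) : ℝ) + 1 ≤ n := by exact_mod_cast (b i).2
  have h3 : K * ((b i : ℝ) + 1) ≤ l := by
    have := h2.trans hn
    rw [le_div_iff₀ hK] at this
    linarith
  have h4 := mul_le_mul_of_nonneg_left h3 hΔ.le
  have h5 : 0 ≤ Δ * (K * (b i : ℝ)) := by positivity
  constructor <;> linarith

/-- Half-open blocks are disjoint, so an exceedance in another block is an exceedance outside the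
present one; the Bonferroni correction thereby takes the form of the pair estimate. -/
lemma eq_of_mem_cube_block (hK : 0 < K) (hΔ : 0 < Δ) {b b' : Fin d → Fin n} {v : Space d}
    (h : v ∈ cube (t + Δ • gridPoint K b) (K * Δ))
    (h' : v ∈ cube (t + Δ • gridPoint K b') (K * Δ)) : b = b' := by
  have key : ∀ (b b' : Fin d → Fin n), v ∈ cube (t + Δ • gridPoint K b) (K * Δ) →
      v ∈ cube (t + Δ • gridPoint K b') (K * Δ) → ∀ i, (b i : ℕ) ≤ b' i := by
    intro b b' h h' i
    have h1 := (h i).1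
    have h2 := (h' i).2
    rw [add_smul_gridPoint_apply] at h1 h2
    have hpos : 0 < K * Δ := by positivity
    have h3 : ((b i : ℕ) : ℝ) < (b' i : ℕ) + 1 := by
      have : (K * Δ) * ((b i : ℕ) : ℝ) < (K * Δ) * ((b' i : ℕ) + 1) := by linarith
      exact lt_of_mul_lt_mul_left this hpos.le
    have h4 : (b i : ℕ) < b' i + 1 := by exact_mod_cast h3
    omega
  ext i
  exact le_antisymm (key b b' h h' i) (key b' b h' h i)

end Blocks

/-! ### Large cubes between upper and lower block sums. -/

section Sandwich

variable {d : ℕ} {Ω : ℝ → Type*} [∀ c, MeasurableSpace (Ω c)]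
  {P : (c : ℝ) → Measure (Ω c)} [∀ c, IsProbabilityMeasure (P c)]
  {X : (c : ℝ) → Space d → Ω c → ℝ}
  {Ω' : Space d → Type*} [∀ t, MeasurableSpace (Ω' t)]
  {Q : (t : Space d) → Measure (Ω' t)} [∀ t, IsProbabilityMeasure (Q t)]
  {W : (t : Space d) → Space d → Ω' t → ℝ}
  {T T₁ : Set (Space d)} {α : ℝ} {Δ l : ℝ → ℝ} {r : Space d → Space d → ℝ}

lemma card_fin_fun (d n : ℕ) :
    ((Finset.univ : Finset (Fin d → Fin n)).card : ℝ) = (n : ℝ) ^ d := by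
  rw [Finset.card_univ, Fintype.card_fun, Fintype.card_fin, Fintype.card_fin]
  push_cast
  rfl

/-- Upper bound by summation over blocks. -/
lemma measureReal_cube_le_of_blocks {c K δ l' F : ℝ} {t : Space d} {n : ℕ} (hK : 0 < K)
    (hδ : 0 < δ) (hn : l' / K < n)
    (h : ∀ b : Fin d → Fin n, (P c).real {ω | ∃ u ∈ cube (t + δ • gridPoint K b) (K * δ),
      c < X c u ω} ≤ F) :
    (P c).real {ω | ∃ u ∈ cube t (l' * δ), c < X c u ω} ≤ (n : ℝ) ^ d * F := by
  have hsub : {ω | ∃ u ∈ cube t (l' * δ), c < X c u ω}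
      ⊆ ⋃ b ∈ (Finset.univ : Finset (Fin d → Fin n)),
        {ω | ∃ u ∈ cube (t + δ • gridPoint K b) (K * δ), c < X c u ω} := by
    rintro ω ⟨u, hu, hω⟩
    obtain ⟨b, hb⟩ := exists_mem_cube_block hK hδ hn hu
    simp only [mem_iUnion]
    exact ⟨b, Finset.mem_univ b, u, hb, hω⟩
  refine (measureReal_mono hsub (measure_ne_top _ _)).trans
    ((measureReal_biUnion_finset_le _ _).trans ?_)
  rw [← card_fin_fun, ← nsmul_eq_mul]
  exact Finset.sum_le_card_nsmul _ _ _ fun b _ => h b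

/-- Lower bound by summation over blocks. -/
lemma le_measureReal_cube_of_blocks {c K δ l' F G : ℝ} {t : Space d} {n : ℕ} (hK : 0 < K)
    (hδ : 0 < δ) (hn : n ≤ l' / K) {A : (Fin d → Fin n) → Set (Ω c)}
    (hA : ∀ b, MeasurableSet (A b))
    (hAsub : ∀ b, A b ⊆ {ω | ∃ u ∈ cube (t + δ • gridPoint K b) (K * δ), c < X c u ω})
    (hF : ∀ b, F ≤ (P c).real (A b))
    (hG : ∀ b : Fin d → Fin n,
      (P c).real {ω | (∃ u ∈ cube (t + δ • gridPoint K b) (K * δ), c < X c u ω) ∧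
        ∃ v ∈ cube t (l' * δ) \ cube (t + δ • gridPoint K b) (K * δ), c < X c v ω} ≤ G) :
    (n : ℝ) ^ d * (F - G) ≤ (P c).real {ω | ∃ u ∈ cube t (l' * δ), c < X c u ω} := by
  have hbonf := sum_measureReal_le (P c) Finset.univ A fun b _ => hA b
  have h1 : (n : ℝ) ^ d * F ≤ ∑ b, (P c).real (A b) := by
    rw [← card_fin_fun, ← nsmul_eq_mul]
    exact Finset.card_nsmul_le_sum _ _ _ fun b _ => hF b
  have h2 : ∑ b, (P c).real (A b ∩ {ω | ∃ j ∈ (Finset.univ : Finset (Fin d → Fin n)),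
      j ≠ b ∧ ω ∈ A j}) ≤ (n : ℝ) ^ d * G := by
    rw [← card_fin_fun, ← nsmul_eq_mul]
    refine Finset.sum_le_card_nsmul _ _ _ fun b _ => ?_
    refine (measureReal_mono ?_ (measure_ne_top _ _)).trans (hG b)
    rintro ω ⟨hω, j, -, hjb, hj⟩
    refine ⟨hAsub b hω, ?_⟩
    obtain ⟨v, hv, hvω⟩ := hAsub j hj
    exact ⟨v, ⟨cube_block_subset hK hδ hn j hv, fun hvb =>
      hjb (eq_of_mem_cube_block hK hδ hv hvb)⟩, hvω⟩
  have h3 : (P c).real (⋃ b ∈ (Finset.univ : Finset (Fin d → Fin n)), A b)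
      ≤ (P c).real {ω | ∃ u ∈ cube t (l' * δ), c < X c u ω} := by
    refine measureReal_mono (fun ω hω => ?_) (measure_ne_top _ _)
    simp only [mem_iUnion] at hω
    obtain ⟨b, -, hb⟩ := hω
    obtain ⟨v, hv, hvω⟩ := hAsub b hb
    exact ⟨v, cube_block_subset hK hδ hn b hv, hvω⟩
  linarith

/-- The exceedance probability over a large cube is asymptotic to `ψ(c) l^d H_K / K^d` up to a
relative error which is small when `K` is large. -/
lemma exists_abs_measureReal_cube_sub_le (hα : 0 < α) (hd : 0 < d) (hr : IsShape r T)
    (hW : ∀ t ∈ T, IsLimitField α (r t) (W t) (Q t)) (hX : Standardized X P T)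
    (hA1 : CondA1 X P T) (hA2 : CondA2 X P T Δ W Q) (hA3 : CondA3 X P T Δ)
    (hA4 : CondA4 X P T Δ) (hA5 : HasPairBound X P T Δ) (hTne : T.Nonempty)
    (hΔ : ∀ᶠ c in atTop, 0 < Δ c) (hΔ0 : Tendsto Δ atTop (𝓝 0))
    (hκ : ∃ κ : ℕ, ∀ᶠ c in atTop, (Δ c)⁻¹ ≤ c ^ κ) (hT : IsInner T₁ T)
    (hl : Tendsto l atTop atTop) (hlΔ : Tendsto (fun c => l c * Δ c) atTop (𝓝 0))
    {ε : ℝ} (hε : 0 < ε) :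
    ∃ K₀ > 0, ∀ K ≥ K₀, (∀ t ∈ T₁, HK (W t) (Q t) K ≠ ⊤) ∧
      (∃ η > 0, ∀ t ∈ T₁, ∀ s ∈ T₁, ‖s - t‖ < η →
        |(HK (W s) (Q s) K).toReal / K ^ d - (HK (W t) (Q t) K).toReal / K ^ d| ≤ ε) ∧
      ∀ᶠ c in atTop, ∀ t ∈ T₁,
        |(P c).real {ω | ∃ u ∈ cube t (l c * Δ c), c < X c u ω}
          - l c ^ d * psi c * ((HK (W t) (Q t) K).toReal / K ^ d)| ≤ ε * (l c ^ d * psi c) := by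
  obtain ⟨T₂, hT₁₂, hT₂⟩ := hT.exists_between
  obtain ⟨Kp, hKp, ηp, hηp, hpair⟩ := eventually_pair_le hX hA1 hA4 hA5 hd hTne hT₂ hΔ hΔ0 hκ
    (show 0 < ε / 4 by positivity)
  -- Each block carries an absolute error 11 = 8 + 3, from the variation of H_K with the base point
  -- and from the cube asymptotics. K ≥ 44/ε and K ≥ 1 give 11 ≤ (ε/4)K^d.
  refine ⟨max (max Kp 1) (44 / ε), by positivity, fun K hKK => ?_⟩
  have hK1 : 1 ≤ K := (le_max_right _ _).trans ((le_max_left _ _).trans hKK)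
  have hKp' : Kp ≤ K := (le_max_left _ _).trans ((le_max_left _ _).trans hKK)
  have hKε : 44 / ε ≤ K := (le_max_right _ _).trans hKK
  have hK : 0 < K := by linarith
  have hKd : 0 < K ^ d := by positivity
  have hKdε : 44 / ε ≤ K ^ d := hKε.trans (le_self_pow₀ hK1 hd.ne')
  have h11 : 11 ≤ ε / 4 * K ^ d := by
    rw [div_le_iff₀ hε] at hKdε
    linarith
  obtain ⟨B, m, hm, hHK, hgrid⟩ := exists_cube_asymptotics hα hr hW hX hA1 hA2 hA3 hA4 hTne hΔ
    hΔ0 hT₂ hK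
  obtain ⟨ρ, hρ, hcont⟩ := exists_abs_HK_sub_le hα hr hW hT₂.subset hK hm
    fun t ht => (hHK t ht).2.2
  refine ⟨fun t ht => (hHK t (hT₁₂.subset ht)).1, ⟨ρ, hρ, fun t ht s hs hst => ?_⟩, ?_⟩
  · have h1 := hcont t (hT₁₂.subset ht) s (hT₁₂.subset hs) hst
    rw [← sub_div, abs_div, abs_of_pos hKd, div_le_iff₀ hKd]
    nlinarith
  obtain ⟨η₁, hη₁, hT₁₂'⟩ := hT₁₂
  have hd' : (0 : ℝ) < d := by exact_mod_cast hd
  have hKl : Tendsto (fun c => K / l c) atTop (𝓝 0) := tendsto_const_nhds.div_atTop hl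
  have hup : Tendsto (fun c => ((1 + K / l c) ^ d - 1) * (|B| + 11)) atTop (𝓝 0) := by
    simpa using (((tendsto_const_nhds (x := (1 : ℝ))).add hKl).pow d).sub_const 1 |>.mul_const
      (|B| + 11)
  have hlow : Tendsto (fun c => (1 - (1 - K / l c) ^ d) * |B|) atTop (𝓝 0) := by
    simpa using ((((tendsto_const_nhds (x := (1 : ℝ))).sub hKl).pow d).const_sub 1).mul_const |B|
  have hsize : Tendsto (fun c => d * ((l c + K) * Δ c)) atTop (𝓝 0) := by
    simpa [add_mul] using (hlΔ.add (hΔ0.const_mul K)).const_mul (d : ℝ)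
  have hKΔ : Tendsto (fun c => K * Δ c) atTop (𝓝 0) := by simpa using hΔ0.const_mul K
  filter_upwards [hpair, hgrid, hX, hΔ, eventually_gt_atTop 0, hl.eventually_ge_atTop K,
    hup.eventually (ge_mem_nhds (show 0 < ε / 4 * K ^ d by positivity)),
    hlow.eventually (ge_mem_nhds (show 0 < ε / 4 * K ^ d by positivity)),
    hsize.eventually (gt_mem_nhds (show 0 < min η₁ ρ by positivity)),
    hKΔ.eventually (ge_mem_nhds hηp)] with c hpair hgrid hX hΔc hc hlK hup hlow hsize hKΔ t ht
  have hψ := psi_pos hc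
  have hlpos : 0 < l c := hK.trans_le hlK
  have htT₂ : t ∈ T₂ := by simpa using hT₁₂' t ht 0 (by simpa using hη₁)
  -- n blocks per side fit inside the cube and n + 1 cover it; the ratio of the two counts tends to
  -- 1 because K is fixed and ℓ_c → ∞.
  set n := ⌊l c / K⌋₊ with hn
  have hn1 : (n : ℝ) ≤ l c / K := Nat.floor_le (by positivity)
  have hn2 : l c / K < (n + 1 : ℕ) := by push_cast; exact Nat.lt_floor_add_one _
  set F := (HK (W t) (Q t) K).toReal with hF
  have hF0 : 0 ≤ F := ENNReal.toReal_nonneg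
  have hFB : F ≤ |B| := ((hHK t htT₂).2.1).trans (le_abs_self B)
  have hnorm : ∀ v ∈ cube t ((l c + K) * Δ c), ‖v - t‖ < min η₁ ρ := by
    intro v hv
    refine lt_of_le_of_lt (norm_le_mul_of_abs_le fun i => ?_) hsize
    have := hv i
    change |v i - t i| ≤ _
    rw [abs_of_nonneg (by linarith)]
    linarith
  have hcubeT₂ : ∀ v ∈ cube t ((l c + K) * Δ c), v ∈ T₂ := by
    intro v hv
    have := hT₁₂' t ht (v - t) ((hnorm v hv).trans_le (min_le_left _ _))
    simpa using this
  have hnode : ∀ b : Fin d → Fin (n + 1), t + Δ c • gridPoint K b ∈ cube t ((l c + K) * Δ c) := by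
    intro b
    refine cube_block_subset hK hΔc (n := n + 1) ?_ b ?_
    · push_cast
      rw [add_div, div_self hK.ne']
      linarith
    · intro i
      have : 0 < K * Δ c := by positivity
      constructor <;> linarith
  have hFs : ∀ b : Fin d → Fin (n + 1),
      |(HK (W (t + Δ c • gridPoint K b)) (Q (t + Δ c • gridPoint K b)) K).toReal - F| ≤ 8 := by
    intro b
    exact hcont t htT₂ _ (hcubeT₂ _ (hnode b)) ((hnorm _ (hnode b)).trans_le (min_le_right _ _))
  have hupper : (P c).real {ω | ∃ u ∈ cube t (l c * Δ c), c < X c u ω}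
      ≤ ((n + 1 : ℕ) : ℝ) ^ d * ((F + 11) * psi c) := by
    refine measureReal_cube_le_of_blocks hK hΔc hn2 fun b => ?_
    refine ((hgrid _ (hcubeT₂ _ (hnode b))).2).trans (mul_le_mul_of_nonneg_right ?_ hψ.le)
    linarith [(abs_le.1 (hFs b)).2]
  have hlower : (n : ℝ) ^ d * ((F - 11) * psi c - ε / 4 * (K ^ d * psi c))
      ≤ (P c).real {ω | ∃ u ∈ cube t (l c * Δ c), c < X c u ω} := by
    have hcast : ∀ b : Fin d → Fin n, t + Δ c • gridPoint K b
        = t + Δ c • gridPoint K (fun i => (b i).castSucc) := fun b => rfl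
    have hsubK : cube t (l c * Δ c) ⊆ cube t ((l c + K) * Δ c) := by
      intro v hv i
      have h1 := hv i
      have : 0 < K * Δ c := by positivity
      constructor <;> linarith
    -- Bonferroni needs measurable events, so each block is represented by the exceedance over its
    -- grid, which has the same asymptotics up to a constant.
    refine le_measureReal_cube_of_blocks hK hΔc hn1
      (A := fun b => {ω | ∃ k ∈ (Finset.univ : Finset (Fin d → Fin m)),
        c < X c (t + Δ c • gridPoint K b + Δ c • gridPoint (K / m) k) ω})
      (fun b => measurableSet_exists_lt (fun k => ?_) _ _)
      (fun b => exists_grid_subset_cube hΔc (by positivity) (by field_simp) _) (fun b => ?_)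
      (fun b => ?_)
    · refine (hX _ (hT₂.subset (hcubeT₂ _ (hsubK
        (cube_block_subset hK hΔc hn1 b fun i => ?_))))).1
      have h1 : ((k i : ℕ) : ℝ) < m := by exact_mod_cast (k i).2
      have h2 : K / m * (k i : ℝ) < K := by
        rw [div_mul_eq_mul_div, div_lt_iff₀ (by positivity)]
        gcongr
      have h3 := mul_lt_mul_of_pos_left h2 hΔc
      have h4 : 0 ≤ Δ c * (K / m * (k i : ℝ)) := by positivity
      rw [add_smul_gridPoint_apply _ _ (K / m)]
      constructor <;> linarith
    · have h1 := (hgrid _ (hcubeT₂ _ (hnode fun i => (b i).castSucc))).1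
      rw [← hcast] at h1
      refine le_trans (mul_le_mul_of_nonneg_right ?_ hψ.le) h1
      have h2 := hFs fun i => (b i).castSucc
      rw [← hcast] at h2
      linarith [(abs_le.1 h2).1]
    · exact hpair K hKp' hKΔ _ (hcubeT₂ _ (hnode fun i => (b i).castSucc)) _
        fun v hv => hcubeT₂ v (hsubK hv)
  have hld : l c ^ d = (l c / K) ^ d * K ^ d := by rw [div_pow]; field_simp
  have hq : 0 < l c / K := by positivity
  have hqd : 0 < (l c / K) ^ d := by positivity
  have hmain : l c ^ d * psi c * (F / K ^ d) = (l c / K) ^ d * F * psi c := by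
    rw [hld]; field_simp
  have herr : ε * (l c ^ d * psi c) = (l c / K) ^ d * (ε * K ^ d) * psi c := by
    rw [hld]; ring
  have hinv : K / l c = (l c / K)⁻¹ := by rw [inv_div]
  rw [hmain, herr, abs_le]
  constructor
  · have h1 : (l c / K) ^ d * (1 - K / l c) ^ d ≤ (n : ℝ) ^ d := by
      rw [← mul_pow, hinv, mul_sub, mul_inv_cancel₀ hq.ne', mul_one]
      have h2 : l c / K - 1 ≤ n := by push_cast at hn2; linarith
      have h3 : 0 ≤ l c / K - 1 := by
        rw [sub_nonneg, le_div_iff₀ hK]; linarith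
      gcongr
    have h2 : (n : ℝ) ^ d ≤ (l c / K) ^ d := by gcongr
    have h3 : (1 - K / l c) ^ d ≤ 1 := pow_le_one₀
      (by rw [sub_nonneg, div_le_one hlpos]; exact hlK)
      (by have : 0 < K / l c := by positivity
          linarith)
    have h4 : (1 - (1 - K / l c) ^ d) * F ≤ ε / 4 * K ^ d :=
      (mul_le_mul_of_nonneg_left hFB (by linarith)).trans hlow
    have h5 : (l c / K) ^ d * (F - ε * K ^ d)
        ≤ (n : ℝ) ^ d * (F - 11 - ε / 4 * K ^ d) := by
      have h6 := mul_le_mul_of_nonneg_left h4 hqd.le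
      have h7 := mul_le_mul_of_nonneg_right h1 hF0
      have h8 : (n : ℝ) ^ d * (11 + ε / 4 * K ^ d) ≤ (l c / K) ^ d * (ε / 2 * K ^ d) := by
        have : 11 + ε / 4 * K ^ d ≤ ε / 2 * K ^ d := by linarith
        have h9 : 0 ≤ ε / 2 * K ^ d := by positivity
        calc _ ≤ (n : ℝ) ^ d * (ε / 2 * K ^ d) := by gcongr
          _ ≤ _ := by gcongr
      have h9 : 0 ≤ (l c / K) ^ d * (ε * K ^ d) := by positivity
      linarith
    have h6 := mul_le_mul_of_nonneg_right h5 hψ.le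
    linarith
  · have h1 : ((n + 1 : ℕ) : ℝ) ^ d ≤ (l c / K) ^ d * (1 + K / l c) ^ d := by
      rw [← mul_pow, hinv, mul_add, mul_inv_cancel₀ hq.ne', mul_one]
      push_cast
      gcongr
    have h2 : ((1 + K / l c) ^ d - 1) * (F + 11) ≤ ε / 4 * K ^ d := by
      refine (mul_le_mul_of_nonneg_left (by linarith) ?_).trans hup
      have h3 : 1 ≤ (1 + K / l c) ^ d := one_le_pow₀ (by
        have : 0 < K / l c := by positivity
        linarith)
      linarith
    have h3 := mul_le_mul_of_nonneg_right h1 (show 0 ≤ F + 11 by linarith)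
    have h4 := mul_le_mul_of_nonneg_left h2 hqd.le
    have h5 := mul_le_mul_of_nonneg_left h11 hqd.le
    have h9 : 0 ≤ (l c / K) ^ d * (ε * K ^ d) := by positivity
    have h6 : ((n + 1 : ℕ) : ℝ) ^ d * (F + 11) ≤ (l c / K) ^ d * (F + ε * K ^ d) := by
      linarith
    have h7 := mul_le_mul_of_nonneg_right h6 hψ.le
    linarith

end Sandwich

/-! ### Existence of the limit. -/

section Limit

variable {d : ℕ} {Ω' : Type*} [MeasurableSpace Ω'] {W : Space d → Ω' → ℝ} {Q : Measure Ω'}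

/-- Completeness gives a finite limit of the real quotients. Eventual finiteness of `HK` transfers
it to extended values, where it identifies the limsup defining `Hlim`. -/
lemma tendsto_HK_of_cauchy
    (h : ∀ ε > 0, ∃ K₀ > 0, ∀ K ≥ K₀, HK W Q K ≠ ⊤ ∧ ∀ K' ≥ K₀,
      |(HK W Q K).toReal / K ^ d - (HK W Q K').toReal / K' ^ d| ≤ ε) :
    Tendsto (fun K : ℝ => HK W Q K / ENNReal.ofReal (K ^ d)) atTop
      (𝓝 (ENNReal.ofReal (Hlim W Q))) ∧
    Tendsto (fun K : ℝ => (HK W Q K).toReal / K ^ d) atTop (𝓝 (Hlim W Q)) := by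
  obtain ⟨L, hL⟩ : ∃ L, Tendsto (fun K : ℝ => (HK W Q K).toReal / K ^ d) atTop (𝓝 L) := by
    refine cauchy_map_iff_exists_tendsto.1 (Metric.cauchy_iff.2 ⟨inferInstance, fun ε hε => ?_⟩)
    obtain ⟨K₀, _, hK₀⟩ := h (ε / 2) (half_pos hε)
    refine ⟨_, image_mem_map (Ici_mem_atTop K₀), ?_⟩
    rintro _ ⟨K, hK, rfl⟩ _ ⟨K', hK', rfl⟩
    rw [Real.dist_eq]
    exact ((hK₀ K hK).2 K' hK').trans_lt (half_lt_self hε)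
  have hL0 : 0 ≤ L := ge_of_tendsto hL (by
    filter_upwards [eventually_gt_atTop 0] with K hK
    positivity)
  have hE : Tendsto (fun K : ℝ => HK W Q K / ENNReal.ofReal (K ^ d)) atTop
      (𝓝 (ENNReal.ofReal L)) := by
    obtain ⟨K₀, hK₀, hfin⟩ := h 1 one_pos
    refine ((ENNReal.continuous_ofReal.tendsto L).comp hL).congr' ?_
    filter_upwards [eventually_ge_atTop K₀] with K hK
    have hKpos : 0 < K := hK₀.trans_le hK
    rw [Function.comp_apply, ENNReal.ofReal_div_of_pos (by positivity),
      ENNReal.ofReal_toReal (hfin K hK).1]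
  have hH : Hlim W Q = L := by rw [Hlim, hE.limsup_eq, ENNReal.toReal_ofReal hL0]
  rw [hH]
  exact ⟨hE, hL⟩

end Limit

/-! ### Assembly. -/

section Main

variable {d : ℕ} {Ω : ℝ → Type*} [∀ c, MeasurableSpace (Ω c)]
  {P : (c : ℝ) → Measure (Ω c)} [∀ c, IsProbabilityMeasure (P c)]
  {X : (c : ℝ) → Space d → Ω c → ℝ}
  {Ω' : Space d → Type*} [∀ t, MeasurableSpace (Ω' t)]
  {Q : (t : Space d) → Measure (Ω' t)} [∀ t, IsProbabilityMeasure (Q t)]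
  {W : (t : Space d) → Space d → Ω' t → ℝ}
  {T T₁ : Set (Space d)} {α : ℝ} {Δ l : ℝ → ℝ} {r : Space d → Space d → ℝ}

/-- `H_K / K^d` converges to `H` uniformly in `t`, and `H` gives the asymptotics of the
exceedance probability. -/
lemma exists_abs_sub_Hlim_le (hα : 0 < α) (hd : 0 < d) (hr : IsShape r T)
    (hW : ∀ t ∈ T, IsLimitField α (r t) (W t) (Q t)) (hX : Standardized X P T)
    (hA1 : CondA1 X P T) (hA2 : CondA2 X P T Δ W Q) (hA3 : CondA3 X P T Δ)
    (hA4 : CondA4 X P T Δ) (hA5 : HasPairBound X P T Δ) (hTne : T.Nonempty)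
    (hΔ : ∀ᶠ c in atTop, 0 < Δ c) (hΔ0 : Tendsto Δ atTop (𝓝 0))
    (hκ : ∃ κ : ℕ, ∀ᶠ c in atTop, (Δ c)⁻¹ ≤ c ^ κ) (hT : IsInner T₁ T)
    (hl : Tendsto l atTop atTop) (hlΔ : Tendsto (fun c => l c * Δ c) atTop (𝓝 0)) :
    (∀ t ∈ T₁, Tendsto (fun K : ℝ => HK (W t) (Q t) K / ENNReal.ofReal (K ^ d)) atTop
      (𝓝 (ENNReal.ofReal (Hlim (W t) (Q t))))) ∧
    UniformContinuousOn (fun t => Hlim (W t) (Q t)) T₁ ∧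
    (∃ b > 0, ∀ t ∈ T₁, b ≤ Hlim (W t) (Q t)) ∧
    ∀ ε > 0, ∀ᶠ c in atTop, ∀ t ∈ T₁,
      |(P c).real {ω | ∃ u ∈ cube t (l c * Δ c), c < X c u ω}
        - l c ^ d * psi c * Hlim (W t) (Q t)| ≤ ε * (l c ^ d * psi c) := by
  have hsand : ∀ ε : ℝ, 0 < ε → _ := fun ε (hε : (0 : ℝ) < ε) => exists_abs_measureReal_cube_sub_le
    hα hd hr hW hX hA1 hA2 hA3 hA4 hA5 hTne hΔ hΔ0 hκ hT hl hlΔ hε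
  -- For two side lengths K and K', both normalised values approximate the same probability at one
  -- common c; eliminating it leaves a bound free of c and uniform in t.
  have hcauchy : ∀ ε > 0, ∃ K₀ > 0, ∀ K ≥ K₀, ∀ K' ≥ K₀, ∀ t ∈ T₁,
      |(HK (W t) (Q t) K).toReal / K ^ d - (HK (W t) (Q t) K').toReal / K' ^ d| ≤ ε := by
    intro ε hε
    obtain ⟨K₀, hK₀, h⟩ := hsand (ε / 2) (half_pos hε)
    refine ⟨K₀, hK₀, fun K hK K' hK' t ht => ?_⟩
    obtain ⟨c, h1, h2, hc, hlc⟩ := ((h K hK).2.2.and ((h K' hK').2.2.and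
      ((eventually_gt_atTop 0).and (hl.eventually_gt_atTop 0)))).exists
    have hpos : 0 < l c ^ d * psi c := mul_pos (pow_pos hlc d) (psi_pos hc)
    have h3 := abs_le.1 (h1 t ht)
    have h4 := abs_le.1 (h2 t ht)
    rw [abs_le]
    constructor
    · refine le_of_mul_le_mul_left ?_ hpos
      linarith
    · refine le_of_mul_le_mul_left ?_ hpos
      linarith
  have hlim : ∀ t ∈ T₁, _ := fun t (ht : t ∈ T₁) =>
    tendsto_HK_of_cauchy (W := W t) (Q := Q t) fun ε hε => by
      obtain ⟨K₀, hK₀, h⟩ := hcauchy ε hε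
      obtain ⟨K₁, hK₁, h'⟩ := hsand 1 one_pos
      exact ⟨max K₀ K₁, lt_max_of_lt_left hK₀, fun K hK =>
        ⟨(h' K ((le_max_right _ _).trans hK)).1 t ht, fun K' hK' =>
          h K ((le_max_left _ _).trans hK) K' ((le_max_left _ _).trans hK') t ht⟩⟩
  have hunif : ∀ ε > 0, ∃ K₀ > 0, ∀ K ≥ K₀, ∀ t ∈ T₁,
      |(HK (W t) (Q t) K).toReal / K ^ d - Hlim (W t) (Q t)| ≤ ε := by
    intro ε hε
    obtain ⟨K₀, hK₀, h⟩ := hcauchy ε hε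
    refine ⟨K₀, hK₀, fun K hK t ht => ?_⟩
    refine le_of_tendsto ((hlim t ht).2.const_sub _).abs ?_
    filter_upwards [eventually_ge_atTop K₀] with K' hK'
    exact h K hK K' hK' t ht
  have hasymp : ∀ ε > 0, ∀ᶠ c in atTop, ∀ t ∈ T₁,
      |(P c).real {ω | ∃ u ∈ cube t (l c * Δ c), c < X c u ω}
        - l c ^ d * psi c * Hlim (W t) (Q t)| ≤ ε * (l c ^ d * psi c) := by
    intro ε hε
    obtain ⟨K₀, _, h⟩ := hsand (ε / 2) (half_pos hε)
    obtain ⟨K₁, _, h'⟩ := hunif (ε / 2) (half_pos hε)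
    filter_upwards [(h (max K₀ K₁) (le_max_left _ _)).2.2, eventually_gt_atTop 0,
      hl.eventually_gt_atTop 0] with c h1 hc hlc t ht
    have hpos : 0 < l c ^ d * psi c := mul_pos (pow_pos hlc d) (psi_pos hc)
    have h3 := abs_le.1 (h1 t ht)
    have h4 := abs_le.1 (h' (max K₀ K₁) (le_max_right _ _) t ht)
    have h5 := mul_le_mul_of_nonneg_left h4.1 hpos.le
    have h6 := mul_le_mul_of_nonneg_left h4.2 hpos.le
    rw [abs_le]
    constructor <;> linarith
  refine ⟨fun t ht => (hlim t ht).1, ?_, ?_, hasymp⟩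
  · rw [Metric.uniformContinuousOn_iff]
    intro ε hε
    obtain ⟨K₀, _, h⟩ := hsand (ε / 4) (by positivity)
    obtain ⟨K₁, _, h'⟩ := hunif (ε / 4) (by positivity)
    obtain ⟨η, hη, hc⟩ := (h (max K₀ K₁) (le_max_left _ _)).2.1
    refine ⟨η, hη, fun t ht s hs hts => ?_⟩
    have h1 := abs_le.1 (hc t ht s hs (by rwa [dist_comm, dist_eq_norm] at hts))
    have h2 := abs_le.1 (h' (max K₀ K₁) (le_max_right _ _) t ht)
    have h3 := abs_le.1 (h' (max K₀ K₁) (le_max_right _ _) s hs)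
    rw [Real.dist_eq, abs_lt]
    constructor <;> linarith
  -- At a single c the lower bound with constant κ and the asymptotics with error κ/2 leave at least
  -- κ/2 for H(t).
  · obtain ⟨κ, hκ, η, hη, hpos⟩ := exists_le_measureReal_cube hα hd hr hW hX hA1 hA2 hA5 hΔ hΔ0 hT
    refine ⟨κ / 2, half_pos hκ, fun t ht => ?_⟩
    obtain ⟨c, h1, h2, hc, hlc, hlη⟩ := (hpos.and ((hasymp (κ / 2) (half_pos hκ)).and
      ((eventually_gt_atTop 0).and ((hl.eventually_gt_atTop 0).and
        (hlΔ.eventually (ge_mem_nhds hη)))))).exists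
    have hpos : 0 < l c ^ d * psi c := mul_pos (pow_pos hlc d) (psi_pos hc)
    have h3 := h1 (l c) hlc hlη t ht
    have h4 := (abs_le.1 (h2 t ht)).2
    refine le_of_mul_le_mul_left ?_ hpos
    linarith

end Main

lemma isInner_thickening {d : ℕ} {D : Set (Space d)} {δ₁ δ : ℝ} (h : δ₁ < δ) :
    IsInner (Metric.thickening δ₁ D) (Metric.thickening δ D) := by
  refine ⟨δ - δ₁, sub_pos.2 h, fun t ht v hv => ?_⟩
  rw [Metric.mem_thickening_iff] at ht ⊢
  obtain ⟨z, hz, htz⟩ := ht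
  refine ⟨z, hz, ?_⟩
  have h1 : dist (t + v) t = ‖v‖ := by simp [dist_eq_norm]
  linarith [dist_triangle (t + v) t z]

lemma IsInner.mono {d : ℕ} {T₁ T₂ T : Set (Space d)} (h : IsInner T₂ T) (h₁ : T₁ ⊆ T₂) :
    IsInner T₁ T := by
  obtain ⟨η, hη, h⟩ := h
  exact ⟨η, hη, fun t ht => h t (h₁ ht)⟩

lemma tendsto_zero_of_mul_tendsto_zero {Δ l : ℝ → ℝ} (hΔ : ∀ᶠ c in atTop, 0 < Δ c)
    (hl : Tendsto l atTop atTop) (hlΔ : Tendsto (fun c => l c * Δ c) atTop (𝓝 0)) :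
    Tendsto Δ atTop (𝓝 0) := by
  refine tendsto_of_tendsto_of_tendsto_of_le_of_le' tendsto_const_nhds hlΔ
    (hΔ.mono fun c hc => hc.le) ?_
  filter_upwards [hΔ, hl.eventually_ge_atTop 1] with c hc hlc
  nlinarith

end AsympGaussian

open AsympGaussian in
theorem theorem2p5 {d : ℕ} (hd : 0 < d)
    {Ω : ℝ → Type*} [∀ c, MeasurableSpace (Ω c)]
    (P : (c : ℝ) → Measure (Ω c)) [∀ c, IsProbabilityMeasure (P c)]
    (X : (c : ℝ) → Space d → Ω c → ℝ)
    {Ω' : Space d → Type*} [∀ t, MeasurableSpace (Ω' t)]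
    (Q : (t : Space d) → Measure (Ω' t)) [∀ t, IsProbabilityMeasure (Q t)]
    (W : (t : Space d) → Space d → Ω' t → ℝ)
    (D : Set (Space d)) (δ : ℝ) (hδ : 0 < δ)
    (α : ℝ) (hα : 0 < α) (hα2 : α ≤ 2)
    (L : ℝ → ℝ) (hL : SlowlyVaryingAtZero L)
    (Δ : ℝ → ℝ) (hΔ : IsScale α L Δ)
    (r : Space d → Space d → ℝ) (hr : IsShape r (Metric.thickening δ D))
    (hW : ∀ t ∈ Metric.thickening δ D, IsLimitField α (r t) (W t) (Q t))
    (hX : Standardized X P (Metric.thickening δ D))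
    (hC : CondC X P (Metric.thickening δ D) α L Δ r)
    (hA1 : CondA1 X P (Metric.thickening δ D))
    (hA2 : CondA2 X P (Metric.thickening δ D) Δ W Q)
    (hA3 : CondA3 X P (Metric.thickening δ D) Δ)
    (hA4 : CondA4 X P (Metric.thickening δ D) Δ)
    (hA5 : CondA5 X P (Metric.thickening δ D) Δ)
    (l : ℝ → ℝ) (hl : Tendsto l atTop atTop)
    (hlΔ : Tendsto (fun c => l c * Δ c) atTop (𝓝 0)) :
    (∀ t ∈ D, Tendsto (fun K : ℝ => HK (W t) (Q t) K / ENNReal.ofReal (K ^ d)) atTop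
      (𝓝 (ENNReal.ofReal (Hlim (W t) (Q t))))) ∧
    UniformContinuousOn (fun t => Hlim (W t) (Q t)) D ∧
    (∃ b > 0, ∀ t ∈ D, b ≤ Hlim (W t) (Q t)) ∧
    (∀ ε > 0, ∀ᶠ c in atTop, ∀ t ∈ D,
      |(P c).real {ω | ∃ u ∈ cube t (l c * Δ c), c < X c u ω}
          - l c ^ d * psi c * Hlim (W t) (Q t)|
        ≤ ε * (l c ^ d * psi c * Hlim (W t) (Q t))) ∧
    (∀ δ' < δ, ∀ v₀ : ℝ≥0, ∀ ε > 0, ∀ᶠ c in atTop, ∀ t ∈ D,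
      ∀ B ⊆ Metric.thickening δ' D, volume B ≤ (v₀ : ℝ≥0∞) →
        (P c).real {ω | (∃ u ∈ cube t (l c * Δ c), c < X c u ω) ∧
            ∃ v ∈ B \ cube t (l c * Δ c), c < X c v ω}
          ≤ ε * (l c ^ d * psi c)) := by
  have hΔpos : ∀ᶠ c in atTop, 0 < Δ c := hΔ.mono fun c hc => hc.1.1
  have hΔ0 := tendsto_zero_of_mul_tendsto_zero hΔpos hl hlΔ
  have hκ := hΔ.exists_inv_le_rpow hα hL hΔ0
  rcases D.eq_empty_or_nonempty with rfl | hDne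
  · refine ⟨by simp, by simp [UniformContinuousOn], ⟨1, one_pos, by simp⟩, by simp, by simp⟩
  have hTne : (Metric.thickening δ D).Nonempty := hDne.mono (Metric.self_subset_thickening hδ D)
  have hD : IsInner D (Metric.thickening δ D) := (isInner_thickening (half_lt_self hδ)).mono
    (Metric.self_subset_thickening (half_pos hδ) D)
  obtain ⟨h1, h2, ⟨b, hb, h3⟩, h4⟩ := exists_abs_sub_Hlim_le hα hd hr hW hX hA1 hA2 hA3 hA4
    hA5.hasPairBound hTne hΔpos hΔ0 hκ hD hl hlΔ
  refine ⟨h1, h2, ⟨b, hb, h3⟩, fun ε hε => ?_, fun δ' hδ' v₀ ε hε => ?_⟩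
  -- The lower bound b of H turns an absolute error into a relative one.
  · filter_upwards [h4 (ε * b) (by positivity), eventually_gt_atTop 0, hl.eventually_gt_atTop 0]
      with c hc hc0 hlc t ht
    have hpos : 0 < l c ^ d * psi c := mul_pos (pow_pos hlc d) (psi_pos hc0)
    refine (hc t ht).trans ?_
    rw [mul_assoc]
    refine mul_le_mul_of_nonneg_left ?_ hε.le
    rw [mul_comm]
    exact mul_le_mul_of_nonneg_left (h3 t ht) hpos.le
  -- The inner domain must contain both B and D; δ' may be nonpositive, hence the maximum with δ/2.
  -- The pair estimate is used with K = ℓ_c.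
  · obtain ⟨K₀, _, η, hη, h⟩ := eventually_pair_le hX hA1 hA4 hA5.hasPairBound hd hTne
      (isInner_thickening (D := D) (max_lt hδ' (half_lt_self hδ))) hΔpos hΔ0 hκ hε
    filter_upwards [h, hl.eventually_ge_atTop K₀, hlΔ.eventually (ge_mem_nhds hη)]
      with c hc hlc hlη t ht B hB _
    exact hc (l c) hlc hlη t
      (Metric.self_subset_thickening (lt_max_of_lt_right (half_pos hδ)) D ht) B
      (hB.trans (Metric.thickening_mono (le_max_left _ _) D))
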